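/- **Setting.** Let $p$ be an odd prime, $\chi(a)=\exp(2\pi i a/p)$ for $a\in\mathbb F_p$, and let $(\tfrac{\cdot}{p})$ be the Legendre symbol; let $\varepsilon(p)=0$ if $p\equiv 1 \pmod 4$ and $\varepsilon(p)=1$ otherwise. A (nonadaptive) quopit Clifford circuit on $n$ registers is a finite sequence of gates, each being a Fourier gate $F=p^{-1/2}\sum_{s,t}\chi(st)|s\rangle\langle t|$, a phase gate $R=\sum_t\chi(t(t-1)2^{-1})|t\rangle\langle t|$ (both on one register) or a sum gate $\Sigma=\sum_{s,t}|s,s+t\rangle\langle s,t|$ (on two distinct registers, control and target). Let $U$ be the operator on $(\mathbb C^p)^{\otimes n}$ that the circuit implements. The circuit is in standard form if the last gate on each register is a Fourier gate; these $n$ gates are called terminal, the other Fourier gates non-terminal, and $\alpha$ is the number of non-terminal ones. For $a,b\in\mathbb F_p^n$ the phase polynomial $S\in\mathbb F_p[x_1,\dots,x_\alpha]$ of a circuit in standard form is defined by labelling its wires: the inputs are labelled $a_1,\dots,a_n$; $R$ preserves the label; $\Sigma$ turns the labels $(s,t)$ of control and target into $(s,s+t)$; the $l$-th non-terminal Fourier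 gate has output label $x_l$, and the terminal Fourier gate on register $j$ has output label $b_j$. Then $$S(x)=\sum_{\text{Fourier gates }G}\mathrm{in}(G)\,\mathrm{out}(G)+\sum_{\text{phase gates }G}2^{-1}\,\mathrm{in}(G)\,(\mathrm{in}(G)-1).$$ **Theorem.** (1) There is an efficient $\mathsf{STR}(n)$-simulation of nonadaptive quopit Clifford circuits with computational basis inputs and measurements: a deterministic classical algorithm which, given $p$, a quopit Clifford circuit on $n$ registers, an input $a\in\mathbb F_p^n$, $n$ distinct registers $i_1,\dots,i_n$ and outcomes $y\in\mathbb F_p^n$, computes exactly the probability that measuring the registers $i_1,\dots,i_n$ of $U|a\rangle$ in the computational basis yields $y$, in time polynomial in the length of its input (with numbers written in binary). (2) Appending four Fourier gates to each register that does not end in a Fourier gate turns any quopit Clifford circuit into one in standard form that implements the same $U$. For each circuit in standard form there is a symmetric matrix $\Theta\in M_\alpha(\mathbb F_p)$, independent of $(a,b)$, such that for all $a,b\in\mathbb F_p^n$ there are $\eta\in\mathbb F_p^\alpha$ and $\zeta\in\mathbb F_p$ with $S(x)=x^T\Theta x+\eta^Tx+\zeta$. There is $L\in \mathrm{GL}_\alpha(\mathbb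 F_p)$ such that $L^T\Theta L$ is diagonal. For every such $L$, write $L^T\Theta L=\mathrm{diag}(\lambda_1,\dots,\lambda_\alpha)$, $\mu=L^T\eta$, $X=\{i:\lambda_i\ne0\}$, $Y=\{i:\lambda_i=0,\mu_i=0\}$, $Z=\{i:\lambda_i=0,\mu_i\ne0\}$ and $r=\mathrm{rank}\,\Theta$. Then $r=|X|$ and $$\langle b|U|a\rangle=\frac{\chi(\zeta)}{p^{(n+\alpha)/2}}\prod_{i=1}^{\alpha}\sum_{y\in\mathbb F_p}\chi(\lambda_iy^2+\mu_iy)$$ $$=\frac{\chi(\zeta)}{p^{(n+\alpha)/2}}\Big(\prod_{i\in X} i^{\varepsilon(p)}\chi(-4^{-1}\lambda_i^{-1}\mu_i^2)\Big(\frac{\lambda_i}{p}\Big)\sqrt p\Big)\Big(\prod_{j\in Y}p\Big)\Big(\prod_{k\in Z}0\Big)$$ $$=p^{-(n+r-\alpha)/2}\,\delta_{0,|Z|}\;i^{\,r\varepsilon(p)}\Big(\frac{\prod_{i\in X}\lambda_i}{p}\Big)\chi\Big(\zeta-4^{-1}\sum_{i\in X}\lambda_i^{-1}\mu_i^2\Big)$$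 (in the powers $i^{\varepsilon(p)}$ and $i^{r\varepsilon(p)}$, $i$ is the imaginary unit), and the outcome probability is $$|\langle b|U|a\rangle|^2=p^{-(n+r-\alpha)}\,\delta_{0,|Z|}.$$ -/

import Mathlib

open scoped Matrix

namespace QuopitClifford

/-! ### Quopit Clifford gates and circuits -/

/-- A quopit Clifford gate together with the register(s), among `n`, that it acts on: the Fourier
gate, the phase gate, and the sum gate with its control and its (distinct) target register. -/
inductive Gate (n : ℕ) : Type
  | fourier (j : Fin n) : Gate n
  | phase (j : Fin n) : Gate n
  | sum (c t : Fin n) (hct : c ≠ t) : Gate n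

/-- A nonadaptive quopit Clifford circuit on `n` registers: a list of gates, applied from left to
right (the head of the list is the first gate). -/
abbrev Circuit (n : ℕ) : Type := List (Gate n)

/-- The gate `g` acts on the register `j`. -/
def Gate.ActsOn {n : ℕ} : Gate n → Fin n → Prop
  | .fourier i, j => i = j
  | .phase i, j => i = j
  | .sum c t _, j => c = j ∨ t = j

instance {n : ℕ} (g : Gate n) (j : Fin n) : Decidable (g.ActsOn j) := by
  cases g <;> unfold Gate.ActsOn <;> infer_instance

section Unitary

variable (p : ℕ) [NeZero p]

/-- The additive character `χ(a) = exp(2πia/p)` of `ℤ/p`. -/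
noncomputable def chi (x : ZMod p) : ℂ :=
  Complex.exp (2 * Real.pi * Complex.I * (x.val : ℂ) / (p : ℂ))

/-- `F = p^{-1/2} ∑_{s,t} χ(st) |s⟩⟨t|`. -/
noncomputable def fourierMatrix : Matrix (ZMod p) (ZMod p) ℂ :=
  Matrix.of fun s t => ((Real.sqrt p : ℝ) : ℂ)⁻¹ * chi p (s * t)

/-- `R = ∑_t χ(t(t-1)2⁻¹) |t⟩⟨t|`. -/
noncomputable def phaseMatrix : Matrix (ZMod p) (ZMod p) ℂ :=
  Matrix.diagonal fun t => chi p (t * (t - 1) * 2⁻¹)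

/-- `Σ = ∑_{s,t} |s,s+t⟩⟨s,t|`. -/
noncomputable def sumMatrix : Matrix (ZMod p × ZMod p) (ZMod p × ZMod p) ℂ :=
  Matrix.of fun u v => if u.1 = v.1 ∧ u.2 = v.1 + v.2 then 1 else 0

/-- The action of a gate on `n` quopits: the gate acts on its own register(s), the identity on all
the others. The entry at `(u, v)` is `⟨u|·|v⟩`. -/
noncomputable def Gate.matrix {n : ℕ} : Gate n → Matrix (Fin n → ZMod p) (Fin n → ZMod p) ℂ
  | .fourier j => Matrix.of fun u v =>
      if ∀ k, k ≠ j → u k = v k then fourierMatrix p (u j) (v j) else 0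
  | .phase j => Matrix.of fun u v =>
      if ∀ k, k ≠ j → u k = v k then phaseMatrix p (u j) (v j) else 0
  | .sum c t _ => Matrix.of fun u v =>
      if ∀ k, k ≠ c → k ≠ t → u k = v k then sumMatrix p (u c, u t) (v c, v t) else 0

/-- The operation `U` implemented by a circuit; `U b a` is the amplitude `⟨b|U|a⟩`. -/
noncomputable def circuitOp {n : ℕ} : Circuit n → Matrix (Fin n → ZMod p) (Fin n → ZMod p) ℂ
  | [] => 1
  | g :: C => circuitOp C * g.matrix p

/-- The probability of observing the outcomes `y₁, …, y_m` when the `m` distinct registers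
`i₁, …, i_m` of the circuit `C` with input `|a⟩` are measured in the computational basis. -/
noncomputable def outcomeProb {n m : ℕ} (C : Circuit n) (a : Fin n → ZMod p)
    (I : Fin m ↪ Fin n) (y : Fin m → ZMod p) : ℝ :=
  ∑ b : Fin n → ZMod p with ∀ k, b (I k) = y k, ‖circuitOp p C b a‖ ^ 2

end Unitary

/-! ### Standard form and the phase polynomial -/

/-- The last gate of `C` on the register `j` exists and is a Fourier gate. -/
def EndsInFourier {n : ℕ} (C : Circuit n) (j : Fin n) : Prop :=
  ∃ C₁ C₂ : Circuit n, C = C₁ ++ Gate.fourier j :: C₂ ∧ ∀ g ∈ C₂, ¬ g.ActsOn j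

/-- Standard form: each register terminates in a Fourier gate. -/
def IsStandardForm {n : ℕ} (C : Circuit n) : Prop := ∀ j, EndsInFourier C j

open Classical in
/-- The circuit `C`, padded by four Fourier gates at the end of each register that does not
terminate in a Fourier gate. -/
noncomputable def standardize {n : ℕ} (C : Circuit n) : Circuit n :=
  C ++ (List.finRange n).flatMap fun j =>
    if EndsInFourier C j then [] else List.replicate 4 (Gate.fourier j)

/-- The number `α` of non-terminal Fourier gates. A Fourier gate on the register `j` is terminal if
no later gate acts on `j`. -/
def numNonterminal {n : ℕ} : Circuit n → ℕ
  | [] => 0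
  | .fourier j :: C => (if ∀ g ∈ C, ¬ g.ActsOn j then 0 else 1) + numNonterminal C
  | .phase _ :: C => numNonterminal C
  | .sum _ _ _ :: C => numNonterminal C

/-- The contribution to the phase polynomial of the remaining gates of a circuit, when the wires
now carry the labels `lab` and `l` auxiliary variables have been used. The wire that leaves a
terminal Fourier gate on the register `j` is labelled `b j`, the one that leaves a non-terminal
Fourier gate is labelled by the next variable. Each Fourier gate contributes `in(F) * out(F)`, each
phase gate `2⁻¹ * in(R) * (in(R) - 1)`. -/
noncomputable def phasePolyAux (p : ℕ) {n : ℕ} (b : Fin n → ZMod p) :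
    Circuit n → (Fin n → MvPolynomial ℕ (ZMod p)) → ℕ → MvPolynomial ℕ (ZMod p)
  | [], _, _ => 0
  | .fourier j :: C, lab, l =>
      if ∀ g ∈ C, ¬ g.ActsOn j then
        lab j * MvPolynomial.C (b j) +
          phasePolyAux p b C (Function.update lab j (MvPolynomial.C (b j))) l
      else
        lab j * MvPolynomial.X l +
          phasePolyAux p b C (Function.update lab j (MvPolynomial.X l)) (l + 1)
  | .phase j :: C, lab, l =>
      MvPolynomial.C (2⁻¹ : ZMod p) * (lab j * (lab j - 1)) + phasePolyAux p b C lab l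
  | .sum c t _ :: C, lab, l =>
      phasePolyAux p b C (Function.update lab t (lab c + lab t)) l

/-- The phase polynomial `S` of the circuit `C` with input `a` and outcome `b`, in the auxiliary
variables `X 0, X 1, …, X (α - 1)`. -/
noncomputable def phasePoly (p : ℕ) {n : ℕ} (C : Circuit n) (a b : Fin n → ZMod p) :
    MvPolynomial ℕ (ZMod p) :=
  phasePolyAux p b C (fun j => MvPolynomial.C (a j)) 0

/-- The polynomial `xᵀΘx + ηᵀx + ζ`. -/
noncomputable def quadraticPoly {p m : ℕ} (Θ : Matrix (Fin m) (Fin m) (ZMod p))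
    (η : Fin m → ZMod p) (ζ : ZMod p) : MvPolynomial ℕ (ZMod p) :=
  (∑ i, ∑ j, MvPolynomial.C (Θ i j) * MvPolynomial.X (i : ℕ) * MvPolynomial.X (j : ℕ)) +
    (∑ i, MvPolynomial.C (η i) * MvPolynomial.X (i : ℕ)) + MvPolynomial.C ζ

/-- `ε(p)` is `0` if `p ≡ 1 (mod 4)` and `1` otherwise. -/
def eps (p : ℕ) : ℕ := if p % 4 = 1 then 0 else 1

/-! ### A random access machine with a step count

The memory consists of banks, each an array of natural numbers; a program names finitely many of
them. Programs are structured, and each elementary operation (a constant, a memory access, an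
addition, a truncated subtraction, a halving, a test) costs one step. There is no
multiplication, so a number can grow by only a constant number of bits per step, and polynomial time
for this machine is polynomial time for Turing machines. -/

/-- The content of the memory: bank, address, value. -/
abbrev Memory : Type := ℕ → ℕ → ℕ

/-- Arithmetic expressions. -/
inductive Expr : Type
  | lit (k : ℕ) : Expr
  | load (bank : ℕ) (addr : Expr) : Expr
  | add (e₁ e₂ : Expr) : Expr
  | sub (e₁ e₂ : Expr) : Expr
  | half (e : Expr) : Expr

/-- The value of an expression. -/
def Expr.eval (m : Memory) : Expr → ℕ
  | .lit k => k
  | .load k e => m k (e.eval m)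
  | .add e₁ e₂ => e₁.eval m + e₂.eval m
  | .sub e₁ e₂ => e₁.eval m - e₂.eval m
  | .half e => e.eval m / 2

/-- The number of steps taken to evaluate an expression. -/
def Expr.cost : Expr → ℕ
  | .lit _ => 1
  | .load _ e => e.cost + 1
  | .add e₁ e₂ => e₁.cost + e₂.cost + 1
  | .sub e₁ e₂ => e₁.cost + e₂.cost + 1
  | .half e => e.cost + 1

/-- Programs: do nothing, assign, compose, branch on `e ≠ 0`, repeat while `e ≠ 0`. -/
inductive Program : Type
  | skip : Program
  | store (bank : ℕ) (addr val : Expr) : Program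
  | seq (c d : Program) : Program
  | branch (e : Expr) (c d : Program) : Program
  | loop (e : Expr) (c : Program) : Program

/-- `Exec c m t m'`: started on the memory `m`, the program `c` halts after exactly `t` steps,
leaving the memory `m'`. -/
inductive Exec : Program → Memory → ℕ → Memory → Prop
  | skip (m : Memory) : Exec .skip m 1 m
  | store (k : ℕ) (e₁ e₂ : Expr) (m : Memory) :
      Exec (.store k e₁ e₂) m (e₁.cost + e₂.cost + 1)
        (Function.update m k (Function.update (m k) (e₁.eval m) (e₂.eval m)))
  | seq {c d : Program} {m m₁ m₂ : Memory} {t₁ t₂ : ℕ} :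
      Exec c m t₁ m₁ → Exec d m₁ t₂ m₂ → Exec (.seq c d) m (t₁ + t₂) m₂
  | branchTrue {e : Expr} {c d : Program} {m m₁ : Memory} {t : ℕ} :
      e.eval m ≠ 0 → Exec c m t m₁ → Exec (.branch e c d) m (e.cost + 1 + t) m₁
  | branchFalse {e : Expr} {c d : Program} {m m₁ : Memory} {t : ℕ} :
      e.eval m = 0 → Exec d m t m₁ → Exec (.branch e c d) m (e.cost + 1 + t) m₁
  | loopStop {e : Expr} {c : Program} {m : Memory} :
      e.eval m = 0 → Exec (.loop e c) m (e.cost + 1) m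
  | loopStep {e : Expr} {c : Program} {m m₁ m₂ : Memory} {t₁ t₂ : ℕ} :
      e.eval m ≠ 0 → Exec c m t₁ m₁ → Exec (.loop e c) m₁ t₂ m₂ →
        Exec (.loop e c) m (e.cost + 1 + t₁ + t₂) m₂

/-- The machine is deterministic. -/
theorem Exec.deterministic {c : Program} {m m₁ m₂ : Memory} {t₁ t₂ : ℕ}
    (h₁ : Exec c m t₁ m₁) (h₂ : Exec c m t₂ m₂) : t₁ = t₂ ∧ m₁ = m₂ := by
  induction h₁ generalizing t₂ m₂ with
  | skip m => cases h₂; exact ⟨rfl, rfl⟩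
  | store k e₁ e₂ m => cases h₂; exact ⟨rfl, rfl⟩
  | seq _ _ ih₁ ih₂ =>
    cases h₂ with
    | seq a b =>
      obtain ⟨rfl, rfl⟩ := ih₁ a
      obtain ⟨rfl, rfl⟩ := ih₂ b
      exact ⟨rfl, rfl⟩
  | branchTrue h _ ih =>
    cases h₂ with
    | branchTrue _ a => obtain ⟨rfl, rfl⟩ := ih a; exact ⟨rfl, rfl⟩
    | branchFalse h' _ => exact absurd h' h
  | branchFalse h _ ih =>
    cases h₂ with
    | branchTrue h' _ => exact absurd h h'
    | branchFalse _ a => obtain ⟨rfl, rfl⟩ := ih a; exact ⟨rfl, rfl⟩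
  | loopStop h =>
    cases h₂ with
    | loopStop _ => exact ⟨rfl, rfl⟩
    | loopStep h' _ _ => exact absurd h h'
  | loopStep h _ _ ih₁ ih₂ =>
    cases h₂ with
    | loopStop h' => exact absurd h' h
    | loopStep _ a b =>
      obtain ⟨rfl, rfl⟩ := ih₁ a
      obtain ⟨rfl, rfl⟩ := ih₂ b
      exact ⟨rfl, rfl⟩

/-- The memory at the start: the input is in bank `0`, its number of entries in cell `0` of bank
`1`, and everything else is `0`. -/
def initialMemory (input : List ℕ) : Memory := fun bank i =>
  if bank = 0 then input.getD i 0 else if bank = 1 ∧ i = 0 then input.length else 0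

/-- The size of an input: the total length of its entries, written in binary with a separator. -/
def inputSize (input : List ℕ) : ℕ := (input.map fun x => Nat.size x + 1).sum

/-! ### Efficient simulation -/

/-- The description of a gate: its kind and its registers. -/
def Gate.encode {n : ℕ} : Gate n → List ℕ
  | .fourier j => [0, j, j]
  | .phase j => [1, j, j]
  | .sum c t _ => [2, c, t]

/-- The description of the circuit `C` on `n` quopits with `p` levels, its input `a`, the measured
registers `i₁, …, i_m` and the outcomes `y₁, …, y_m`. -/
def encodeInput (p : ℕ) {n m : ℕ} (C : Circuit n) (a : Fin n → ZMod p)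
    (I : Fin m ↪ Fin n) (y : Fin m → ZMod p) : List ℕ :=
  [p, n, C.length, m] ++ C.flatMap Gate.encode ++ List.ofFn (fun j => (a j).val) ++
    List.ofFn (fun k => (I k : ℕ)) ++ List.ofFn (fun k => (y k).val)

/-- There is an efficient `STR(f(n))`-simulation of nonadaptive quopit Clifford circuits with
computational basis inputs and measurements: one deterministic program that, in a number of steps
bounded by a polynomial in the size of its input, computes the probability of any outcome of a
measurement of any `f(n)` registers, as a fraction of natural numbers that it leaves in the cells
`0` and `1` of bank `2`. -/
def HasEfficientSTRSimulation (f : ℕ → ℕ) : Prop :=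
  ∃ (prog : Program) (P : Polynomial ℕ),
    ∀ (p : ℕ) [Fact p.Prime], p ≠ 2 →
    ∀ (n : ℕ) (C : Circuit n) (a : Fin n → ZMod p)
      (I : Fin (f n) ↪ Fin n) (y : Fin (f n) → ZMod p),
    ∃ (t : ℕ) (m : Memory),
      Exec prog (initialMemory (encodeInput p C a I y)) t m ∧
      t ≤ P.eval (inputSize (encodeInput p C a I y)) ∧
      m 2 1 ≠ 0 ∧
      (m 2 0 : ℝ) / (m 2 1 : ℝ) = outcomeProb p C a I y

end QuopitClifford

open QuopitClifford

namespace QuopitClifford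

/-! ### The character and quadratic Gauss sums -/

section Character

variable (p : ℕ) [NeZero p]

/-! Amplitudes. Summing over the intermediate label at every Fourier gate writes `⟨b|U|a⟩` as
`p^{-(n+α)/2} ∑_x χ(S(x))`; a terminal gate contributes no free label, because its register is idle
afterwards and must already carry `b_j` (`circuitOp_eq_sum_phasePoly`). Wire labels are affine in
`x`, and `a`, `b` enter only their constant terms, so `S` is quadratic with a quadratic part
independent of `a`, `b` (`exists_symm_phasePoly`). In odd characteristic a symmetric `Θ` is diagonal
in an orthogonal basis, and the substitution `x = L y` splits the path sum into one-variable sums: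
quadratic Gauss sums on `X`, `p` on `Y`, `0` on `Z` (`sum_chi_diagonalize`,
`prod_sum_chi_quadratic`). Since `|X| = rank Θ`, collecting the powers of `p` gives the closed form
(`amplitude_eq`).

The sign of the Gauss sum (`sum_chi_sq`) is found by comparing it with an explicit product over a
`p`-th root of unity whose square is the same. They agree up to a sign, the phase of the product is
visible from sines, and the sign is read off modulo the prime above `p`, where Wilson's theorem
decides it (`factorial_relation`, `half_factorial_sq`).

Simulation. The program does not evaluate the amplitude formula; it works on the discrete phase
space `(q, π)`. Conjugation by a Clifford gate permutes the phase point operators by an affine map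
(`gate_conj_pointMatrix`). As `p^n |a⟩⟨a|` is the sum of the operators above `a`, and the diagonal
entry at `b` of an operator is `1` or `0` according to whether its position is `b`, the number `p^n
|⟨b|U|a⟩|²` counts the momenta `z` for which `(a, z)` is moved above `b` (`norm_circuitOp_sq`).
These `z` solve an affine system over `ZMod p`, whose columns come from running the circuit on `n +
1` points. Division-free elimination with `r` pivots shows that the count is `p^{n-r}` or `0`, so
the probability is `p^{-r}` or `0` (`norm_circuitOp_sq_of_isEliminated`). Measuring `n` distinct
registers among `n` fixes all of `b`, so one such count suffices. Explicit invariants and step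
counts then bound the running time. -/

theorem chi_eq_stdAddChar (x : ZMod p) : chi p x = ZMod.stdAddChar x := by
  have h := ZMod.stdAddChar_coe (N := p) (x.val : ℤ)
  rw [show (((x.val : ℕ) : ℤ) : ZMod p) = x by simp] at h
  rw [h, chi, Int.cast_natCast]

theorem chi_add (x y : ZMod p) : chi p (x + y) = chi p x * chi p y := by
  simp [chi_eq_stdAddChar, AddChar.map_add_eq_mul]

theorem chi_zero : chi p 0 = 1 := by simp [chi_eq_stdAddChar]

theorem chi_sum {ι : Type*} (s : Finset ι) (f : ι → ZMod p) :
    chi p (∑ i ∈ s, f i) = ∏ i ∈ s, chi p (f i) := by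
  induction s using Finset.cons_induction with
  | empty => simp [chi_zero]
  | cons a s h ih => simp [chi_add, ih]

theorem norm_chi (x : ZMod p) : ‖chi p x‖ = 1 := by
  rw [chi_eq_stdAddChar, ZMod.stdAddChar_apply]
  exact Circle.norm_coe _

theorem chi_neg (x : ZMod p) : chi p (-x) = (starRingEnd ℂ) (chi p x) := by
  rw [chi_eq_stdAddChar, chi_eq_stdAddChar, AddChar.map_neg_eq_conj]

theorem sum_chi_mul [Fact p.Prime] (b : ZMod p) :
    ∑ x : ZMod p, chi p (x * b) = if b = 0 then (p : ℂ) else 0 := by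
  simp only [chi_eq_stdAddChar]
  rw [AddChar.sum_mulShift b (ZMod.isPrimitive_stdAddChar p)]
  simp [ZMod.card]

theorem isPrimitiveRoot_chi_one : IsPrimitiveRoot (chi p 1) p := by
  have h := Complex.isPrimitiveRoot_exp p (NeZero.ne p)
  rw [chi_eq_stdAddChar]
  have h' := ZMod.stdAddChar_coe (N := p) 1
  simp only [Int.cast_one, mul_one] at h'
  rwa [h']

theorem chi_natCast (k : ℕ) : chi p (k : ZMod p) = chi p 1 ^ k := by
  rw [chi_eq_stdAddChar, chi_eq_stdAddChar, ← AddChar.map_nsmul_eq_pow]; simp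

end Character

/-! ### Quadratic Gauss sums, including the sign -/

section GaussSum

open Polynomial

variable {p : ℕ} [Fact p.Prime]

theorem two_ne_zero_of_ne_two (hp : p ≠ 2) : (2 : ZMod p) ≠ 0 := by
  have : ((2 : ℕ) : ZMod p) ≠ 0 := by
    rw [Ne, ZMod.natCast_eq_zero_iff, Nat.prime_dvd_prime_iff_eq Fact.out Nat.prime_two]
    exact hp
  exact_mod_cast this

/-- An element `a` has `1 + quadraticChar a` square roots; the constant `1` contributes a full sum
of a nontrivial character, which vanishes. Rescaling the argument by `l` then pulls out the value of
the quadratic character. -/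
theorem sum_chi_mul_sq (hp : p ≠ 2) (l : ZMod p) (hl : l ≠ 0) :
    ∑ y : ZMod p, chi p (l * y ^ 2) =
      (quadraticChar (ZMod p) l : ℂ) *
        gaussSum ((quadraticChar (ZMod p)).ringHomComp (Int.castRingHom ℂ)) ZMod.stdAddChar := by
  classical
  have hF : ringChar (ZMod p) ≠ 2 := by rwa [ZMod.ringChar_zmod_n]
  have h1 : ∑ y : ZMod p, chi p (l * y ^ 2) =
      ∑ a : ZMod p, ((quadraticChar (ZMod p) a : ℂ) + 1) * chi p (l * a) := by
    rw [← Finset.sum_fiberwise (s := Finset.univ) (g := fun y : ZMod p => y ^ 2)]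
    refine Finset.sum_congr rfl fun a _ => ?_
    rw [Finset.sum_congr rfl (g := fun _ => chi p (l * a))]
    · rw [Finset.sum_const, nsmul_eq_mul]
      congr 1
      have := quadraticChar_card_sqrts hF a
      rw [Set.toFinset_ofPred] at this
      exact_mod_cast this
    · intro y hy
      rw [(Finset.mem_filter.1 hy).2]
  rw [h1]
  simp only [add_mul, one_mul, Finset.sum_add_distrib]
  have h2 : ∑ a : ZMod p, chi p (l * a) = 0 := by
    simpa [mul_comm, hl] using sum_chi_mul p l
  rw [h2, add_zero]
  have h3 := gaussSum_mulShift ((quadraticChar (ZMod p)).ringHomComp (Int.castRingHom ℂ))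
    (ZMod.stdAddChar (N := p)) (Units.mk0 l hl)
  rw [← h3, gaussSum]
  simp only [chi_eq_stdAddChar, MulChar.ringHomComp_apply, AddChar.mulShift_apply, Units.val_mk0,
    eq_intCast]
  rw [← mul_assoc, ← Int.cast_mul, ← sq, quadraticChar_sq_one hl]
  simp

/-- This fixes the Gauss sum up to sign only; the sign is the substance of the rest of the section.
-/
theorem sq_sum_chi_sq (hp : p ≠ 2) :
    (∑ y : ZMod p, chi p (y ^ 2)) ^ 2 = (-1) ^ (p / 2) * p := by
  have hF : ringChar (ZMod p) ≠ 2 := by rwa [ZMod.ringChar_zmod_n]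
  have h := sum_chi_mul_sq hp 1 one_ne_zero
  simp only [one_mul, map_one, Int.cast_one] at h
  have hodd : p % 2 = 1 := ((Fact.out : p.Prime).eq_two_or_odd).resolve_left hp
  rw [h, gaussSum_sq _ _ (ZMod.isPrimitive_stdAddChar p)]
  · rw [MulChar.ringHomComp_apply, quadraticChar_neg_one hF, ZMod.card,
      ZMod.χ₄_eq_neg_one_pow hodd]
    simp
  · rw [Ne, MulChar.ringHomComp_eq_one_iff (RingHom.injective_int (Int.castRingHom ℂ))]
    exact quadraticChar_ne_one hF
  · exact (quadraticChar_isQuadratic _).comp _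

/-- The product `∏_{k = 1}^m (x ^ ((m + 1) k) - x ^ (m k))`, which at a primitive root of unity of
order `2 * m + 1` is a square root of `± (2 * m + 1)`. -/
noncomputable def rootProd (m : ℕ) : ℤ[X] :=
  ∏ k ∈ Finset.range m, (X ^ ((m + 1) * (k + 1)) - X ^ (m * (k + 1)))

/-- In `∏ (1 - z^k) = 2m + 1` the factors of `k` and `-k` are paired. Modulo `2m + 1` the exponents
`(m + 1)k` and `mk` are `k/2` and `-k/2`, and `(z^{k/2} - z^{-k/2})² = -(1 - z^k)(1 - z^{-k})`. -/
theorem sq_aeval_rootProd {m : ℕ} {z : ℂ} (hz : IsPrimitiveRoot z (2 * m + 1)) :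
    (aeval z (rootProd m)) ^ 2 = (-1) ^ m * ((2 * m + 1 : ℕ) : ℂ) := by
  have h1 := hz.prod_one_sub_pow_eq_order
  have h2 : ∏ k ∈ Finset.range (2 * m), (1 - z ^ (k + 1)) =
      ∏ k ∈ Finset.range m, ((1 - z ^ (k + 1)) * (1 - z ^ (2 * m + 1 - (k + 1)))) := by
    rw [two_mul, Finset.prod_range_add, Finset.prod_mul_distrib]
    congr 1
    rw [← Finset.prod_range_reflect]
    refine Finset.prod_congr rfl fun k hk => ?_
    have := Finset.mem_range.1 hk
    congr 2
    omega
  rw [h2] at h1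
  rw [Nat.cast_succ, ← h1, rootProd, map_prod, ← Finset.prod_pow]
  have h3 : ((-1 : ℂ)) ^ m = ∏ _k ∈ Finset.range m, (-1 : ℂ) := by simp
  rw [h3, ← Finset.prod_mul_distrib]
  refine Finset.prod_congr rfl fun k hk => ?_
  have hk := Finset.mem_range.1 hk
  have hz1 := hz.pow_eq_one
  have e1 : z ^ ((m + 1) * (k + 1)) * z ^ (m * (k + 1)) = 1 := by
    rw [← pow_add, ← add_mul, show m + 1 + m = 2 * m + 1 by ring, pow_mul, hz1, one_pow]
  have e2 : (z ^ ((m + 1) * (k + 1))) ^ 2 = z ^ (k + 1) := by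
    rw [← pow_mul, show (m + 1) * (k + 1) * 2 = (2 * m + 1) * (k + 1) + (k + 1) by ring, pow_add,
      pow_mul, hz1, one_pow, one_mul]
  have e3 : (z ^ (m * (k + 1))) ^ 2 = z ^ (2 * m + 1 - (k + 1)) := by
    have : z ^ (k + 1) ≠ 0 := pow_ne_zero _ (hz.ne_zero (by omega))
    apply mul_right_cancel₀ this
    rw [← pow_add, show 2 * m + 1 - (k + 1) + (k + 1) = 2 * m + 1 by omega, hz1, ← pow_mul,
      ← pow_add, show m * (k + 1) * 2 + (k + 1) = (2 * m + 1) * (k + 1) by ring, pow_mul, hz1,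
      one_pow]
  have e4 : z ^ (k + 1) * z ^ (2 * m + 1 - (k + 1)) = 1 := by
    rw [← pow_add, show (k + 1) + (2 * m + 1 - (k + 1)) = 2 * m + 1 by omega, hz1]
  simp only [map_sub, map_pow, aeval_X]
  linear_combination e2 + e3 - 2 * e1 + e4

theorem prod_neg_one_pow_mul_I (m : ℕ) :
    ∏ k ∈ Finset.range m, ((-1 : ℂ) ^ (k + 1) * Complex.I) =
      if m % 2 = 0 then 1 else -Complex.I := by
  induction m with
  | zero => simp
  | succ m ih =>
    rw [Finset.prod_range_succ, ih]
    rcases Nat.mod_two_eq_zero_or_one m with h | h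
    · have h' : (m + 1) % 2 = 1 := by omega
      have : Odd (m + 1) := Nat.odd_iff.2 h'
      simp [h, h', this.neg_one_pow]
    · have h' : (m + 1) % 2 = 0 := by omega
      have : Even (m + 1) := Nat.even_iff.2 h'
      simp [h, h', this.neg_one_pow]

theorem aeval_rootProd_exp (m : ℕ) :
    ∃ Q : ℝ, 0 < Q ∧ aeval (Complex.exp (2 * Real.pi * Complex.I / (2 * m + 1 : ℕ))) (rootProd m) =
      (if m % 2 = 0 then 1 else -Complex.I) * Q := by
  refine ⟨∏ k ∈ Finset.range m, 2 * Real.sin (Real.pi * (k + 1) / (2 * m + 1)), ?_, ?_⟩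
  · refine Finset.prod_pos fun k hk => ?_
    have hk := Finset.mem_range.1 hk
    have hk' : (k : ℝ) + 1 ≤ m := by exact_mod_cast hk
    refine mul_pos two_pos (Real.sin_pos_of_pos_of_lt_pi (by positivity) ?_)
    rw [div_lt_iff₀ (by positivity)]
    have := Real.pi_pos
    nlinarith
  · rw [← prod_neg_one_pow_mul_I, rootProd, map_prod, Complex.ofReal_prod,
      ← Finset.prod_mul_distrib]
    refine Finset.prod_congr rfl fun k _ => ?_
    -- A square root of the root of unity with `w^(2m+1) = -1`: the two powers in a factor become
    -- `(-1)^(k+1) w^(k+1)` and `(-1)^(k+1) w^(-(k+1))`, whose difference is a signed `2i sin` at an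
    -- angle between `0` and `π`.
    set w := Complex.exp (Real.pi * Complex.I / (2 * m + 1 : ℕ)) with hw
    have hne : ((2 * m + 1 : ℕ) : ℂ) ≠ 0 := Nat.cast_ne_zero.2 (by omega)
    have hw0 : w ≠ 0 := Complex.exp_ne_zero _
    have hz : Complex.exp (2 * Real.pi * Complex.I / (2 * m + 1 : ℕ)) = w ^ 2 := by
      rw [hw, ← Complex.exp_nat_mul]; congr 1; push_cast; ring
    have hwp : w ^ (2 * m + 1) = -1 := by
      rw [hw, ← Complex.exp_nat_mul, mul_div_cancel₀ _ hne, Complex.exp_pi_mul_I]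
    have e1 : (w ^ 2) ^ ((m + 1) * (k + 1)) = (-1) ^ (k + 1) * w ^ (k + 1) := by
      rw [← pow_mul, show 2 * ((m + 1) * (k + 1)) = (2 * m + 1) * (k + 1) + (k + 1) by ring,
        pow_add, pow_mul, hwp]
    have e2 : (w ^ 2) ^ (m * (k + 1)) = (-1) ^ (k + 1) * (w ^ (k + 1))⁻¹ := by
      apply mul_right_cancel₀ (pow_ne_zero (k + 1) hw0)
      rw [← pow_mul, ← pow_add, show 2 * (m * (k + 1)) + (k + 1) = (2 * m + 1) * (k + 1) by ring,
        pow_mul, hwp, mul_assoc, inv_mul_cancel₀ (pow_ne_zero _ hw0), mul_one]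
    have e3 : w ^ (k + 1) =
        Complex.exp (((Real.pi * (k + 1) / (2 * m + 1) : ℝ) : ℂ) * Complex.I) := by
      rw [hw, ← Complex.exp_nat_mul]; congr 1; push_cast; ring
    simp only [map_sub, map_pow, aeval_X]
    rw [hz, e1, e2, e3, ← Complex.exp_neg, Complex.ofReal_mul, Complex.ofReal_sin,
      Complex.ofReal_ofNat, Complex.two_sin]
    rw [neg_mul]
    linear_combination (-1 : ℂ) ^ (k + 1) *
      (Complex.exp (-(((Real.pi * (k + 1) / (2 * m + 1) : ℝ) : ℂ) * Complex.I)) -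
      Complex.exp (((Real.pi * (k + 1) / (2 * m + 1) : ℝ) : ℂ) * Complex.I)) * (-Complex.I_sq)

/-- Power sums over `ZMod p` vanish for exponents below `p - 1`, so only the leading term `y^(p-1)`
survives. -/
theorem sum_eval_sq_of_monic (hp : p ≠ 2) {P : (ZMod p)[X]} (hP : P.Monic)
    (hd : P.natDegree = p / 2) : ∑ y : ZMod p, P.eval (y ^ 2) = -1 := by
  have hodd : p % 2 = 1 := ((Fact.out : p.Prime).eq_two_or_odd).resolve_left hp
  simp only [fun y : ZMod p => eval_eq_sum_range' (p := P) (n := p / 2 + 1) (by omega) (y ^ 2)]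
  rw [Finset.sum_comm, Finset.sum_range_succ, Finset.sum_eq_zero, zero_add]
  · have h1 : P.coeff (p / 2) = 1 := by rw [← hd]; exact hP
    simp only [h1, one_mul, ← pow_mul]
    rw [show 2 * (p / 2) = p - 1 by omega]
    have h2 : ∀ x ∈ (Finset.univ : Finset (ZMod p)).erase 0, x ^ (p - 1) = 1 := fun x hx =>
      ZMod.pow_card_sub_one_eq_one (Finset.ne_of_mem_erase hx)
    have hp1 := (Fact.out : p.Prime).one_lt
    rw [← Finset.add_sum_erase _ _ (Finset.mem_univ 0), zero_pow (by omega),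
      Finset.sum_congr rfl h2, Finset.sum_const, Finset.card_erase_of_mem (Finset.mem_univ _),
      Finset.card_univ, ZMod.card, nsmul_eq_mul, Nat.cast_pred hp1.le]
    simp
  · intro i hi
    have hi := Finset.mem_range.1 hi
    rw [← Finset.mul_sum]
    simp only [← pow_mul]
    rw [FiniteField.sum_pow_lt_card_sub_one (ZMod p) _ (by rw [ZMod.card]; omega), mul_zero]

/-- In `(p - 1)!` the upper factor `m + 1 + k` is `-(m - k)` modulo `p = 2m + 1`, so the upper half
is `(-1)^m m!`, and Wilson's theorem applies. -/
theorem half_factorial_sq (hp : p ≠ 2) :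
    (((p / 2).factorial : ZMod p)) ^ 2 * (-1) ^ (p / 2) = -1 := by
  have hodd : p % 2 = 1 := ((Fact.out : p.Prime).eq_two_or_odd).resolve_left hp
  obtain ⟨m, hm⟩ : ∃ m, p = 2 * m + 1 := ⟨p / 2, by omega⟩
  have hm' : p / 2 = m := by omega
  refine Eq.trans ?_ (ZMod.wilsons_lemma p)
  rw [hm', show p - 1 = m + m by omega,
    ← Nat.factorial_mul_ascFactorial, sq, Nat.cast_mul, mul_assoc]
  congr 1
  rw [Nat.ascFactorial_eq_prod_range, ← Nat.descFactorial_self, Nat.descFactorial_eq_prod_range,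
    Nat.cast_prod, Nat.cast_prod]
  have h3 : ((-1 : ZMod p)) ^ m = ∏ _k ∈ Finset.range m, (-1 : ZMod p) := by simp
  rw [h3, ← Finset.prod_mul_distrib]
  refine Finset.prod_congr rfl fun k hk => ?_
  have hk := Finset.mem_range.1 hk
  have hp0 : ((2 * m + 1 : ℕ) : ZMod p) = 0 := by rw [← hm]; simp
  rw [Nat.cast_sub hk.le]
  push_cast at hp0 ⊢
  linear_combination -hp0

/-- After expansion at `1` the factor with index `k` is `X` times a polynomial with constant term
`(m + 1)(k + 1) - m(k + 1) = k + 1`; hence the lowest term of the product is `m! X^m`. -/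
theorem coeff_comp_map_rootProd (m : ℕ) :
    (((rootProd m).map (Int.castRingHom (ZMod p))).comp (X + 1)).coeff m = m.factorial := by
  have h1 : ((rootProd m).map (Int.castRingHom (ZMod p))).comp (X + 1) =
      X ^ m * ∏ k ∈ Finset.range m,
        divX (((X + 1) ^ ((m + 1) * (k + 1)) - (X + 1) ^ (m * (k + 1)) : (ZMod p)[X])) := by
    rw [rootProd, Polynomial.map_prod, Polynomial.prod_comp]
    have h3 : (X : (ZMod p)[X]) ^ m = ∏ _k ∈ Finset.range m, X := by simp
    rw [h3, ← Finset.prod_mul_distrib]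
    refine Finset.prod_congr rfl fun k _ => ?_
    have h4 := X_mul_divX_add
      (((X + 1) ^ ((m + 1) * (k + 1)) - (X + 1) ^ (m * (k + 1)) : (ZMod p)[X]))
    rw [coeff_sub, coeff_X_add_one_pow, coeff_X_add_one_pow, Nat.choose_zero_right,
      Nat.choose_zero_right, sub_self, C_0, add_zero] at h4
    rw [h4]
    simp
  rw [h1, coeff_X_pow_mul', if_pos le_rfl, Nat.sub_self, coeff_zero_eq_eval_zero, eval_prod,
    ← Finset.prod_range_add_one_eq_factorial, Nat.cast_prod]
  refine Finset.prod_congr rfl fun k _ => ?_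
  rw [← coeff_zero_eq_eval_zero, coeff_divX, coeff_sub, coeff_X_add_one_pow, coeff_X_add_one_pow]
  simp
  ring

/-- A relation `∑ y, ζ ^ (y ^ 2) = c * rootProd` over the `p`-th roots of unity, read modulo
the prime above `p`. -/
theorem factorial_relation (hp : p ≠ 2) (c : ℤ)
    (h : ∑ y : ZMod p, chi p (y ^ 2) = c * aeval (chi p 1) (rootProd (p / 2))) :
    (-1 : ZMod p) = c * ((p / 2).factorial : ZMod p) ^ 2 := by
  have hprime := (Fact.out : p.Prime)
  have hodd : p % 2 = 1 := (hprime.eq_two_or_odd).resolve_left hp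
  have hp1 := hprime.two_le
  set f : ℤ[X] := ∑ y : ZMod p, X ^ (y.val ^ 2) - C c * rootProd (p / 2) with hf
  have hf0 : aeval (chi p 1) f = 0 := by
    rw [hf, map_sub, map_sum, map_mul, aeval_C, sub_eq_zero]
    rw [show (algebraMap ℤ ℂ) c = (c : ℂ) from rfl, ← h]
    refine Finset.sum_congr rfl fun y _ => ?_
    rw [map_pow, aeval_X, ← chi_natCast]
    simp
  have hz := isPrimitiveRoot_chi_one p
  have hdvd : cyclotomic p ℤ ∣ f := by
    rw [cyclotomic_eq_minpoly hz hprime.pos]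
    exact minpoly.isIntegrallyClosed_dvd (hz.isIntegral hprime.pos) hf0
  -- Modulo `p` the cyclotomic polynomial is `(X - 1)^(p-1)`, so a relation at one root of unity
  -- makes all coefficients of the expansion at `1` below degree `p - 1` vanish.
  have hdvd2 : (X - 1 : (ZMod p)[X]) ^ (p - 1) ∣ f.map (Int.castRingHom (ZMod p)) := by
    have h1 := Polynomial.map_dvd (Int.castRingHom (ZMod p)) hdvd
    have h2 := cyclotomic_mul_prime_eq_pow_of_not_dvd (ZMod p) (p := p) (n := 1)
      (by simpa using hprime.one_lt.ne')
    rw [one_mul, cyclotomic_one] at h2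
    rwa [map_cyclotomic, h2] at h1
  have hdvd3 : (X : (ZMod p)[X]) ^ (p - 1) ∣ (f.map (Int.castRingHom (ZMod p))).comp (X + 1) := by
    obtain ⟨g, hg⟩ := hdvd2
    refine ⟨g.comp (X + 1), ?_⟩
    rw [hg, mul_comp, pow_comp]
    simp
  have hc := X_pow_dvd_iff.1 hdvd3 (p / 2) (by omega)
  rw [hf, Polynomial.map_sub, Polynomial.map_sum, Polynomial.map_mul, sub_comp, mul_comp,
    coeff_sub, map_C, C_comp, coeff_C_mul, coeff_comp_map_rootProd, Polynomial.sum_comp,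
    finsetSum_coeff, sub_eq_zero] at hc
  simp only [Polynomial.map_pow, map_X, pow_comp, X_comp, coeff_X_add_one_pow, eq_intCast] at hc
  -- Another factor `m!` turns the binomial coefficients of `y²` into falling factorials, which are
  -- values of a monic polynomial of degree `m = p / 2`.
  rw [sq, ← mul_assoc, ← hc, Finset.sum_mul,
    ← sum_eval_sq_of_monic hp (monic_descPochhammer (ZMod p) (p / 2))
      (descPochhammer_natDegree (ZMod p) (p / 2))]
  refine Finset.sum_congr rfl fun y _ => ?_
  have := descPochhammer_eval_eq_descFactorial (ZMod p) (y.val ^ 2) (p / 2)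
  rw [Nat.descFactorial_eq_factorial_mul_choose] at this
  push_cast at this
  rw [ZMod.natCast_zmod_val] at this
  rw [this, mul_comm]

theorem sum_chi_sq (hp : p ≠ 2) :
    ∑ y : ZMod p, chi p (y ^ 2) = Complex.I ^ eps p * (Real.sqrt p : ℝ) := by
  have hprime := (Fact.out : p.Prime)
  have hodd : p % 2 = 1 := (hprime.eq_two_or_odd).resolve_left hp
  obtain ⟨m, hm⟩ : ∃ m, p = 2 * m + 1 := ⟨p / 2, by omega⟩
  have hm' : p / 2 = m := by omega
  have hz := isPrimitiveRoot_chi_one p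
  have hz1 : chi p 1 = Complex.exp (2 * Real.pi * Complex.I / (2 * m + 1 : ℕ)) := by
    rw [← hm, chi_eq_stdAddChar]
    simpa using ZMod.stdAddChar_coe (N := p) 1
  obtain ⟨Q, hQ, hQD⟩ := aeval_rootProd_exp m
  rw [← hz1] at hQD
  have hsq := sq_sum_chi_sq hp
  have hD : (aeval (chi p 1) (rootProd m)) ^ 2 = (-1) ^ m * ((2 * m + 1 : ℕ) : ℂ) :=
    sq_aeval_rootProd (by rw [← hm]; exact hz)
  have hfac := half_factorial_sq hp
  have hrel := factorial_relation hp
  rw [hm'] at hsq hrel hfac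
  rw [← hm, ← hsq] at hD
  have h2 : (-1 : ZMod p) ≠ 1 := by
    have : Fact (2 < p) := ⟨by have := hprime.two_le; omega⟩
    exact ZMod.neg_one_ne_one
  -- Equal squares leave the factor `1` or `-1`. The relation `-1 = c (m!)²` together with Wilson's
  -- theorem forces `c = (-1)^m`.
  have key : ∑ y : ZMod p, chi p (y ^ 2) = (-1) ^ m * aeval (chi p 1) (rootProd m) := by
    have hne : (((m.factorial : ℕ) : ZMod p)) ^ 2 ≠ 0 := by
      intro h0
      rw [h0, zero_mul] at hfac
      exact one_ne_zero (neg_eq_zero.1 hfac.symm)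
    rcases sq_eq_sq_iff_eq_or_eq_neg.1 hD.symm with h | h
    · have h' := hrel 1 (by rw [h]; simp)
      rcases Nat.even_or_odd m with hm2 | hm2
      · rw [h, hm2.neg_one_pow, one_mul]
      · exfalso
        rw [hm2.neg_one_pow] at hfac
        apply h2
        rw [Int.cast_one, one_mul] at h'
        linear_combination h' - hfac
    · have h' := hrel (-1) (by rw [h]; simp)
      rcases Nat.even_or_odd m with hm2 | hm2
      · exfalso
        rw [hm2.neg_one_pow] at hfac
        apply h2
        push_cast at h'
        linear_combination h' - hfac
      · rw [h, hm2.neg_one_pow, neg_one_mul]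
  have hval : ∑ y : ZMod p, chi p (y ^ 2) = Complex.I ^ eps p * (Q : ℂ) := by
    rw [key, hQD, eps]
    rcases Nat.even_or_odd m with hm2 | hm2
    · rw [hm2.neg_one_pow, if_pos (Nat.even_iff.1 hm2),
        if_pos (by have := Nat.even_iff.1 hm2; omega)]
      simp
    · have := Nat.odd_iff.1 hm2
      rw [hm2.neg_one_pow, if_neg (by omega), if_neg (by omega)]
      simp
  have hQp : Q = Real.sqrt p := by
    rw [eq_comm, Real.sqrt_eq_iff_mul_self_eq (by positivity) hQ.le]
    have h3 := congrArg (fun z : ℂ => ‖z‖) hsq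
    rw [hval] at h3
    simp only [norm_pow, norm_mul, Complex.norm_I, one_pow, one_mul, norm_neg, norm_one,
      Complex.norm_real, Complex.norm_natCast, Real.norm_of_nonneg hQ.le] at h3
    rw [← h3, sq]
  rw [hval, hQp]

theorem sum_chi_quadratic (hp : p ≠ 2) (l u : ZMod p) (hl : l ≠ 0) :
    ∑ y : ZMod p, chi p (l * y ^ 2 + u * y) =
      Complex.I ^ eps p * chi p (-4⁻¹ * l⁻¹ * u ^ 2) * (legendreSym p (l.val : ℤ) : ℂ) *
        ((Real.sqrt p : ℝ) : ℂ) := by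
  have h2 : (2 : ZMod p) ≠ 0 := two_ne_zero_of_ne_two hp
  have h4 : (4 : ZMod p) = 2 * 2 := by norm_num
  have h1 : ∑ y : ZMod p, chi p (l * y ^ 2 + u * y) =
      ∑ y : ZMod p, chi p (-4⁻¹ * l⁻¹ * u ^ 2) * chi p (l * y ^ 2) := by
    -- Completing the square.
    refine Fintype.sum_equiv (Equiv.addRight (2⁻¹ * l⁻¹ * u)) _ _ fun y => ?_
    rw [← chi_add]
    congr 1
    simp only [Equiv.coe_addRight]
    rw [h4]
    field_simp
    ring
  have h5 := sum_chi_mul_sq hp 1 one_ne_zero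
  simp only [one_mul, map_one, Int.cast_one] at h5
  rw [h1, ← Finset.mul_sum, sum_chi_mul_sq hp l hl, ← h5, sum_chi_sq hp, legendreSym]
  rw [show (((l.val : ℕ) : ℤ) : ZMod p) = l by simp]
  ring

end GaussSum

/-! ### Gates as matrices -/

section Matrices

variable {p n : ℕ}

theorem sum_ite_eq_off [NeZero p] {M : Type*} [AddCommMonoid M] (j : Fin n) (v : Fin n → ZMod p)
    (f : (Fin n → ZMod p) → M) :
    ∑ w : Fin n → ZMod p, (if ∀ k, k ≠ j → w k = v k then f w else 0) =
      ∑ x : ZMod p, f (Function.update v j x) := by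
  rw [← Finset.sum_filter]
  refine Finset.sum_bij' (fun w _ => w j) (fun x _ => Function.update v j x) ?_ ?_ ?_ ?_ ?_
  · simp
  · intro x _
    simp +contextual [Function.update_of_ne]
  · intro w hw
    have hw := (Finset.mem_filter.1 hw).2
    funext k
    by_cases hk : k = j
    · subst hk; simp
    · simp [hk, hw k hk]
  · simp
  · intro w hw
    have hw := (Finset.mem_filter.1 hw).2
    congr 1
    funext k
    by_cases hk : k = j
    · subst hk; simp
    · simp [hk, hw k hk]

theorem mul_fourier_apply [NeZero p] (M : Matrix (Fin n → ZMod p) (Fin n → ZMod p) ℂ) (j : Fin n)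
    (b v : Fin n → ZMod p) :
    (M * (Gate.fourier j).matrix p) b v =
      ∑ x : ZMod p, M b (Function.update v j x) * fourierMatrix p x (v j) := by
  rw [Matrix.mul_apply, ← Function.update_eq_self j v]
  simp only [Gate.matrix, Matrix.of_apply, mul_ite, mul_zero]
  rw [sum_ite_eq_off]
  simp

theorem fourier_mul_apply [NeZero p] (M : Matrix (Fin n → ZMod p) (Fin n → ZMod p) ℂ) (j : Fin n)
    (u a : Fin n → ZMod p) :
    ((Gate.fourier j).matrix p * M) u a =
      ∑ x : ZMod p, fourierMatrix p (u j) x * M (Function.update u j x) a := by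
  rw [Matrix.mul_apply]
  simp only [Gate.matrix, Matrix.of_apply, ite_mul, zero_mul]
  simp only [fun w : Fin n → ZMod p => show (∀ k, k ≠ j → u k = w k) ↔ (∀ k, k ≠ j → w k = u k)
    from ⟨fun h k hk => (h k hk).symm, fun h k hk => (h k hk).symm⟩]
  rw [sum_ite_eq_off]
  simp

theorem phase_matrix_eq (j : Fin n) :
    (Gate.phase j).matrix p =
      Matrix.diagonal fun v : Fin n → ZMod p => chi p (v j * (v j - 1) * 2⁻¹) := by
  ext u v
  simp only [Gate.matrix, Matrix.of_apply, phaseMatrix, Matrix.diagonal_apply]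
  by_cases h : u = v
  · subst h; simp
  · rw [if_neg h]
    split_ifs with h1 h2
    · exact absurd (funext fun k => if hk : k = j then hk ▸ h2 else h1 k hk) h
    · rfl
    · rfl

theorem sum_matrix_apply (c t : Fin n) (hct : c ≠ t) (u v : Fin n → ZMod p) :
    (Gate.sum c t hct).matrix p u v =
      if u = Function.update v t (v c + v t) then 1 else 0 := by
  simp only [Gate.matrix, Matrix.of_apply, sumMatrix]
  by_cases h : u = Function.update v t (v c + v t)
  · subst h
    rw [if_pos, if_pos, if_pos rfl]
    · simp [hct]
    · intro k _ hk
      simp [hk]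
  · rw [if_neg h]
    split_ifs with h1 h2
    · refine absurd (funext fun k => ?_) h
      by_cases hk : k = t
      · subst hk; simpa using h2.2
      · rw [Function.update_of_ne hk]
        by_cases hk' : k = c
        · subst hk'; exact h2.1
        · exact h1 k hk' hk
    · rfl
    · rfl

theorem mul_sum_apply [NeZero p] (M : Matrix (Fin n → ZMod p) (Fin n → ZMod p) ℂ) (c t : Fin n)
    (hct : c ≠ t) (b v : Fin n → ZMod p) :
    (M * (Gate.sum c t hct).matrix p) b v = M b (Function.update v t (v c + v t)) := by
  simp [Matrix.mul_apply, sum_matrix_apply]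

theorem sum_mul_apply [NeZero p] (M : Matrix (Fin n → ZMod p) (Fin n → ZMod p) ℂ) (c t : Fin n)
    (hct : c ≠ t) (u a : Fin n → ZMod p) :
    ((Gate.sum c t hct).matrix p * M) u a = M (Function.update u t (u t - u c)) a := by
  have h : ∀ v : Fin n → ZMod p, u = Function.update v t (v c + v t) ↔
      v = Function.update u t (u t - u c) := by
    intro v
    constructor
    · rintro rfl
      simp [hct]
    · rintro rfl
      simp [hct]
  simp [Matrix.mul_apply, sum_matrix_apply, h]

theorem circuitOp_append [NeZero p] (C D : Circuit n) :
    circuitOp p (C ++ D) = circuitOp p D * circuitOp p C := by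
  induction C with
  | nil => simp [circuitOp]
  | cons g C ih => rw [List.cons_append, circuitOp, circuitOp, ih, Matrix.mul_assoc]

/-- The matrix that acts as `A` on the register `j` and trivially on the others. -/
noncomputable def localMatrix (j : Fin n) (A : Matrix (ZMod p) (ZMod p) ℂ) :
    Matrix (Fin n → ZMod p) (Fin n → ZMod p) ℂ :=
  Matrix.of fun u v => if ∀ k, k ≠ j → u k = v k then A (u j) (v j) else 0

theorem localMatrix_mul [NeZero p] (j : Fin n) (A B : Matrix (ZMod p) (ZMod p) ℂ) :
    localMatrix j A * localMatrix j B = localMatrix j (A * B) := by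
  ext u v
  rw [Matrix.mul_apply]
  simp only [localMatrix, Matrix.of_apply, mul_ite, mul_zero]
  rw [sum_ite_eq_off]
  have h : ∀ x, (∀ k, k ≠ j → u k = Function.update v j x k) ↔ ∀ k, k ≠ j → u k = v k :=
    fun x => forall₂_congr fun k hk => by rw [Function.update_of_ne hk]
  simp only [h, Function.update_self]
  split_ifs
  · rw [Matrix.mul_apply]
  · simp

theorem localMatrix_one (j : Fin n) : localMatrix j (1 : Matrix (ZMod p) (ZMod p) ℂ) = 1 := by
  ext u v
  simp only [localMatrix, Matrix.of_apply, Matrix.one_apply]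
  by_cases h : u = v
  · subst h; simp
  · rw [if_neg h]
    split_ifs with h1 h2
    · exact absurd (funext fun k => if hk : k = j then hk ▸ h2 else h1 k hk) h
    · rfl
    · rfl

end Matrices

/-! ### The Fourier gate has order dividing four -/

section Fourier

variable {p : ℕ} [Fact p.Prime] {n : ℕ}

theorem sqrt_inv_mul_sqrt_inv :
    ((Real.sqrt p : ℝ) : ℂ)⁻¹ * ((Real.sqrt p : ℝ) : ℂ)⁻¹ * (p : ℂ) = 1 := by
  have hp : (0 : ℝ) < p := by exact_mod_cast (Fact.out : p.Prime).pos
  rw [← mul_inv, ← Complex.ofReal_mul, Real.mul_self_sqrt hp.le, Complex.ofReal_natCast]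
  exact inv_mul_cancel₀ (by exact_mod_cast hp.ne')

/-- By orthogonality of characters the square is the reflection `s ↦ -s`. Its square is the
identity, which makes the padding by four gates harmless. -/
theorem fourierMatrix_sq_apply (s t : ZMod p) :
    (fourierMatrix p * fourierMatrix p) s t = if s + t = 0 then 1 else 0 := by
  rw [Matrix.mul_apply]
  simp only [fourierMatrix, Matrix.of_apply]
  have h : ∀ x : ZMod p, ((Real.sqrt p : ℝ) : ℂ)⁻¹ * chi p (s * x) *
      (((Real.sqrt p : ℝ) : ℂ)⁻¹ * chi p (x * t)) =
      ((Real.sqrt p : ℝ) : ℂ)⁻¹ * ((Real.sqrt p : ℝ) : ℂ)⁻¹ * chi p (x * (s + t)) := by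
    intro x
    rw [mul_add, chi_add, mul_comm s x]
    ring
  simp only [h]
  rw [← Finset.mul_sum, sum_chi_mul]
  split_ifs
  · exact sqrt_inv_mul_sqrt_inv
  · simp

theorem fourierMatrix_pow_four : fourierMatrix p ^ 4 = 1 := by
  rw [show 4 = 2 * 2 from rfl, pow_mul, sq, sq]
  ext s t
  rw [Matrix.mul_apply]
  simp only [fourierMatrix_sq_apply, Matrix.one_apply, ite_mul, one_mul, zero_mul]
  rw [Finset.sum_eq_single (-s)]
  · simp [neg_add_eq_zero]
  · intro b _ hb
    rw [if_neg fun h => hb (eq_neg_of_add_eq_zero_right h)]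
  · simp

theorem circuitOp_replicate_fourier (j : Fin n) :
    circuitOp p (List.replicate 4 (Gate.fourier j)) = 1 := by
  have h : ∀ k, circuitOp p (List.replicate k (Gate.fourier j)) =
      localMatrix j (fourierMatrix p ^ k) := by
    intro k
    induction k with
    | zero => simp [circuitOp, localMatrix_one]
    | succ k ih =>
      rw [List.replicate_succ, circuitOp, ih, pow_succ, ← localMatrix_mul]
      rfl
  rw [h, fourierMatrix_pow_four, localMatrix_one]

theorem circuitOp_standardize (C : Circuit n) : circuitOp p (standardize C) = circuitOp p C := by
  classical
  rw [standardize, circuitOp_append]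
  suffices h : ∀ l : List (Fin n), circuitOp p (l.flatMap fun j =>
      if EndsInFourier C j then [] else List.replicate 4 (Gate.fourier j)) = 1 by
    convert Matrix.one_mul _
    convert h _
  intro l
  induction l with
  | nil => rfl
  | cons j l ih =>
    rw [List.flatMap_cons, circuitOp_append, ih, Matrix.one_mul]
    split_ifs
    · rfl
    · exact circuitOp_replicate_fourier j

end Fourier

/-! ### Standard form -/

section StandardForm

variable {n : ℕ}

/-- The padding of one register never touches another, and each register occurs once in
`List.finRange n`, so nothing after the block of `j` acts on `j`. -/
theorem isStandardForm_append_flatMap (C : Circuit n) (f : Fin n → Circuit n)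
    (hf : ∀ j, (f j = [] ∧ EndsInFourier C j) ∨ f j = List.replicate 4 (Gate.fourier j)) :
    IsStandardForm (C ++ (List.finRange n).flatMap f) := by
  have hact : ∀ i j, i ≠ j → ∀ g ∈ f i, ¬ g.ActsOn j := by
    intro i j hij g hg
    rcases hf i with h | h
    · simp [h.1] at hg
    · rw [h] at hg
      rw [List.eq_of_mem_replicate hg]
      exact hij
  intro j
  rcases hf j with ⟨h1, C₁, C₂, h2, h3⟩ | h1
  · refine ⟨C₁, C₂ ++ (List.finRange n).flatMap f, by simp [h2], fun g hg => ?_⟩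
    rcases List.mem_append.1 hg with hg | hg
    · exact h3 g hg
    · obtain ⟨i, _, hi⟩ := List.mem_flatMap.1 hg
      refine hact i j ?_ g hi
      rintro rfl
      simp [h1] at hi
  · obtain ⟨l₁, l₂, hl⟩ := List.append_of_mem (List.mem_finRange j)
    have hnd := List.nodup_finRange n
    rw [hl] at hnd
    refine ⟨C ++ l₁.flatMap f ++ List.replicate 3 (Gate.fourier j), l₂.flatMap f, ?_,
      fun g hg => ?_⟩
    · rw [hl, List.flatMap_append, List.flatMap_cons, h1]
      simp [List.replicate]
    · obtain ⟨i, hi, hg⟩ := List.mem_flatMap.1 hg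
      refine hact i j ?_ g hg
      rintro rfl
      have := (List.nodup_cons.1 (List.nodup_append.1 hnd).2.1).1
      exact this hi

theorem isStandardForm_standardize (C : Circuit n) : IsStandardForm (standardize C) := by
  classical
  rw [standardize]
  refine isStandardForm_append_flatMap C _ fun j => ?_
  by_cases h : EndsInFourier C j
  · left; simp [h]
  · right; simp [h]

end StandardForm

/-! ### The action on phase space -/

section PhaseSpace

/-- The action of a gate on the position `q` and the momentum `π`, linear in `(h, q, π)`. -/
def gateStep {R : Type*} [Ring R] {n : ℕ} (h : R) :
    Gate n → (Fin n → R) × (Fin n → R) → (Fin n → R) × (Fin n → R)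
  | .fourier j, v => (Function.update v.1 j (-v.2 j), Function.update v.2 j (v.1 j))
  | .phase j, v => (v.1, Function.update v.2 j (v.2 j + (v.1 j - h)))
  | .sum c t _, v => (Function.update v.1 t (v.1 c + v.1 t), Function.update v.2 c (v.2 c - v.2 t))

/-- The action of a circuit on phase space. -/
def circuitStep {R : Type*} [Ring R] {n : ℕ} (h : R) (C : Circuit n)
    (v : (Fin n → R) × (Fin n → R)) : (Fin n → R) × (Fin n → R) :=
  C.foldl (fun v g => gateStep h g v) v

variable {p : ℕ} {n : ℕ}

/-- Treating the constant `h` of the phase gate as a further coordinate makes the affine action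
linear. This is what allows the circuit to be run on a basis only. -/
theorem gateStep_add {R : Type*} [CommRing R] (h h' : R) (g : Gate n)
    (v v' : (Fin n → R) × (Fin n → R)) :
    gateStep (h + h') g (v + v') = gateStep h g v + gateStep h' g v' := by
  cases g <;>
  · refine Prod.ext (funext fun k => ?_) (funext fun k => ?_) <;>
    simp only [gateStep, Prod.fst_add, Prod.snd_add, Pi.add_apply, Function.update_apply] <;>
    split_ifs <;> ring

theorem gateStep_smul {R : Type*} [CommRing R] (r h : R) (g : Gate n)
    (v : (Fin n → R) × (Fin n → R)) :
    gateStep (r * h) g (r • v) = r • gateStep h g v := by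
  cases g <;>
  · refine Prod.ext (funext fun k => ?_) (funext fun k => ?_) <;>
    simp only [gateStep, Prod.smul_fst, Prod.smul_snd, Pi.smul_apply, smul_eq_mul,
      Function.update_apply] <;>
    split_ifs <;> ring

theorem circuitStep_add {R : Type*} [CommRing R] (h h' : R) (C : Circuit n)
    (v v' : (Fin n → R) × (Fin n → R)) :
    circuitStep (h + h') C (v + v') = circuitStep h C v + circuitStep h' C v' := by
  induction C generalizing v v' with
  | nil => rfl
  | cons g C ih =>
    change circuitStep _ C (gateStep _ g _) = circuitStep _ C _ + circuitStep _ C _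
    rw [gateStep_add, ih]

theorem circuitStep_smul {R : Type*} [CommRing R] (r h : R) (C : Circuit n)
    (v : (Fin n → R) × (Fin n → R)) :
    circuitStep (r * h) C (r • v) = r • circuitStep h C v := by
  induction C generalizing v with
  | nil => rfl
  | cons g C ih =>
    change circuitStep _ C (gateStep _ g _) = r • circuitStep _ C _
    rw [gateStep_smul, ih]

/-- Only the base point carries the affine constant; the directions `w k` are moved by the linear
part, that is, with `h = 0`. -/
theorem circuitStep_sum {R : Type*} [CommRing R] {ι : Type*} (h : R) (C : Circuit n)
    (v : (Fin n → R) × (Fin n → R)) (s : Finset ι) (z : ι → R)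
    (w : ι → (Fin n → R) × (Fin n → R)) :
    circuitStep h C (v + ∑ k ∈ s, z k • w k) =
      circuitStep h C v + ∑ k ∈ s, z k • circuitStep 0 C (w k) := by
  induction s using Finset.cons_induction with
  | empty => simp
  | cons a s ha ih =>
    rw [Finset.sum_cons, Finset.sum_cons, add_left_comm, add_left_comm (circuitStep h C v), ← ih,
      ← circuitStep_smul, ← circuitStep_add]
    simp

variable [Fact p.Prime]

/-- The matrix entry of a one-register phase point operator. -/
noncomputable def pointKernel (q π s t : ZMod p) : ℂ :=
  if 2 * q = s + t then chi p (π * (s - t)) else 0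

/-- The phase point operator at `(q, π)`. -/
noncomputable def pointMatrix (v : (Fin n → ZMod p) × (Fin n → ZMod p)) :
    Matrix (Fin n → ZMod p) (Fin n → ZMod p) ℂ :=
  Matrix.of fun s t => ∏ j, pointKernel (v.1 j) (v.2 j) (s j) (t j)

theorem star_pointKernel (q π s t : ZMod p) :
    star (pointKernel q π s t) = pointKernel q π t s := by
  rw [pointKernel, pointKernel, add_comm t s]
  split_ifs
  · rw [Complex.star_def, ← chi_neg]; congr 1; ring
  · simp

theorem conjTranspose_pointMatrix (v : (Fin n → ZMod p) × (Fin n → ZMod p)) :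
    (pointMatrix v)ᴴ = pointMatrix v := by
  ext s t
  simp only [Matrix.conjTranspose_apply, pointMatrix, Matrix.of_apply, star_prod,
    star_pointKernel]

/-- The Fourier gate rotates phase space by a quarter turn. -/
theorem fourier_pointKernel (q π s t : ZMod p) :
    ∑ x : ZMod p, ∑ y : ZMod p,
      fourierMatrix p s x * (pointKernel q π x y * star (fourierMatrix p t y)) =
      pointKernel (-π) q s t := by
  have h1 : ∀ x : ZMod p, ∑ y : ZMod p,
      fourierMatrix p s x * (pointKernel q π x y * star (fourierMatrix p t y)) =
      ((Real.sqrt p : ℝ) : ℂ)⁻¹ * ((Real.sqrt p : ℝ) : ℂ)⁻¹ *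
        (chi p (-(2 * q * t) - 2 * π * q) * chi p (x * (s + t + 2 * π))) := by
    intro x
    -- The kernel is supported on `x + y = 2q`; the remaining sum over `x` is a character sum that
    -- produces the support condition for the new position `-π`.
    rw [Finset.sum_eq_single (2 * q - x)]
    · simp only [fourierMatrix, Matrix.of_apply, pointKernel]
      have e : chi p (-(2 * q * t) - 2 * π * q) * chi p (x * (s + t + 2 * π)) =
          chi p (s * x) * chi p (π * (x - (2 * q - x))) * chi p (-(t * (2 * q - x))) := by
        rw [← chi_add, ← chi_add, ← chi_add]
        congr 1
        ring
      rw [if_pos (by ring), e, chi_neg, Complex.star_def, map_mul, map_inv₀, Complex.conj_ofReal]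
      ring
    · intro y _ hy
      rw [pointKernel, if_neg, zero_mul, mul_zero]
      intro h
      exact hy (by rw [h]; ring)
    · simp
  simp only [h1]
  rw [← Finset.mul_sum, ← Finset.mul_sum, sum_chi_mul, pointKernel]
  have h2 : (2 * -π = s + t) ↔ s + t + 2 * π = 0 := by
    constructor <;> intro h <;> linear_combination -h
  simp only [h2]
  split_ifs with h
  · have h3 : -(2 * q * t) - 2 * π * q = q * (s - t) := by linear_combination -q * h
    rw [h3]
    linear_combination chi p (q * (s - t)) * sqrt_inv_mul_sqrt_inv (p := p)
  · simp

theorem mul_conjTranspose_apply (A G : Matrix (Fin n → ZMod p) (Fin n → ZMod p) ℂ)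
    (s t : Fin n → ZMod p) : (A * Gᴴ) s t = star ((G * Aᴴ) t s) := by
  rw [← Matrix.conjTranspose_apply, Matrix.conjTranspose_mul, Matrix.conjTranspose_conjTranspose]

theorem prod_update_kernel (j : Fin n) (q π s t : Fin n → ZMod p) (q' π' s' t' : ZMod p) :
    ∏ k, pointKernel (Function.update q j q' k) (Function.update π j π' k)
      (Function.update s j s' k) (Function.update t j t' k) =
      pointKernel q' π' s' t' * ∏ k ∈ Finset.univ.erase j, pointKernel (q k) (π k) (s k) (t k) := by
  rw [← Finset.mul_prod_erase _ _ (Finset.mem_univ j)]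
  simp only [Function.update_self]
  congr 1
  refine Finset.prod_congr rfl fun k hk => ?_
  have := Finset.ne_of_mem_erase hk
  simp [Function.update_of_ne this]

/-- Covariance of the phase point operators. For each gate it reduces to an identity of one- or
two-register kernels, the other registers being unchanged. -/
theorem gate_conj_pointMatrix (hp : p ≠ 2) (g : Gate n)
    (v : (Fin n → ZMod p) × (Fin n → ZMod p)) :
    g.matrix p * (pointMatrix v * (g.matrix p)ᴴ) = pointMatrix (gateStep 2⁻¹ g v) := by
  have h2 : (2 : ZMod p) ≠ 0 := two_ne_zero_of_ne_two hp
  ext s t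
  cases g with
  | fourier j =>
    rw [fourier_mul_apply]
    simp only [mul_conjTranspose_apply, conjTranspose_pointMatrix, fourier_mul_apply, gateStep]
    simp only [pointMatrix, Matrix.of_apply, star_sum, star_mul', star_prod, star_pointKernel]
    have e1 := prod_update_kernel j v.1 v.2 s t (-v.2 j) (v.1 j) (s j) (t j)
    rw [Function.update_eq_self, Function.update_eq_self] at e1
    rw [e1, ← fourier_pointKernel, Finset.sum_mul]
    refine Finset.sum_congr rfl fun x _ => ?_
    rw [Finset.sum_mul, Finset.mul_sum]
    refine Finset.sum_congr rfl fun y _ => ?_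
    have e2 := prod_update_kernel j v.1 v.2 s t (v.1 j) (v.2 j) x y
    rw [Function.update_eq_self, Function.update_eq_self] at e2
    rw [e2]
    ring
  | phase j =>
    rw [phase_matrix_eq, Matrix.diagonal_conjTranspose, Matrix.diagonal_mul, Matrix.mul_diagonal]
    simp only [gateStep, pointMatrix, Matrix.of_apply]
    have e1 := prod_update_kernel j v.1 v.2 s t (v.1 j) (v.2 j + (v.1 j - 2⁻¹)) (s j) (t j)
    rw [Function.update_eq_self, Function.update_eq_self, Function.update_eq_self] at e1
    have e2 := prod_update_kernel j v.1 v.2 s t (v.1 j) (v.2 j) (s j) (t j)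
    simp only [Function.update_eq_self] at e2
    rw [e1, e2, pointKernel, pointKernel, Pi.star_apply, Complex.star_def, ← chi_neg]
    split_ifs with h
    -- On the support `s + t = 2q` the phases combine to `s(s-1)/2 - t(t-1)/2 = (s - t)(q - 1/2)`:
    -- the momentum is shifted by `q - h` with `h = 2⁻¹`.
    · have hq : v.1 j = 2⁻¹ * (s j + t j) := by rw [← h]; field_simp
      have e : chi p ((v.2 j + (v.1 j - 2⁻¹)) * (s j - t j)) =
          chi p (s j * (s j - 1) * 2⁻¹) * chi p (v.2 j * (s j - t j)) *
            chi p (-(t j * (t j - 1) * 2⁻¹)) := by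
        rw [← chi_add, ← chi_add, hq]
        congr 1
        ring
      rw [e]
      ring
    · simp
  | sum c u hcu =>
    -- The sum gate permutes basis vectors, so conjugation evaluates the kernel at preimages. The
    -- `s_c - t_c` arising in the target register is charged to the control, whose momentum becomes
    -- `π_c - π_t`.
    rw [sum_mul_apply, mul_conjTranspose_apply, conjTranspose_pointMatrix, sum_mul_apply]
    simp only [gateStep, pointMatrix, Matrix.of_apply, star_prod, star_pointKernel]
    have hu : u ∈ (Finset.univ : Finset (Fin n)) := Finset.mem_univ u
    have hc : c ∈ (Finset.univ : Finset (Fin n)).erase u :=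
      Finset.mem_erase.2 ⟨hcu, Finset.mem_univ c⟩
    rw [← Finset.mul_prod_erase _ _ hu, ← Finset.mul_prod_erase _ _ hc,
      ← Finset.mul_prod_erase _ _ hu, ← Finset.mul_prod_erase _ _ hc, ← mul_assoc, ← mul_assoc]
    congr 1
    · simp only [Function.update_self, Function.update_of_ne hcu, Function.update_of_ne hcu.symm,
        pointKernel]
      by_cases h1 : 2 * v.1 c = s c + t c
      · have h3 : (2 * v.1 u = s u - s c + (t u - t c)) ↔ 2 * (v.1 c + v.1 u) = s u + t u := by
          constructor <;> intro h
          · linear_combination h1 + h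
          · linear_combination h - h1
        simp only [h1, h3, if_true]
        split_ifs
        · rw [← chi_add, ← chi_add]; congr 1; ring
        · simp
      · simp [h1]
    · refine Finset.prod_congr rfl fun k hk => ?_
      have hk1 := Finset.ne_of_mem_erase hk
      have hk2 := Finset.ne_of_mem_erase (Finset.mem_of_mem_erase hk)
      simp [Function.update_of_ne hk1, Function.update_of_ne hk2]

theorem circuit_conj_pointMatrix (hp : p ≠ 2) (C : Circuit n)
    (v : (Fin n → ZMod p) × (Fin n → ZMod p)) :
    circuitOp p C * (pointMatrix v * (circuitOp p C)ᴴ) =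
      pointMatrix (circuitStep 2⁻¹ C v) := by
  induction C generalizing v with
  | nil => simp [circuitOp, circuitStep]
  | cons g C ih =>
    change _ = pointMatrix (circuitStep _ C (gateStep _ g v))
    rw [← ih, ← gate_conj_pointMatrix hp, circuitOp, Matrix.conjTranspose_mul]
    simp only [Matrix.mul_assoc]

/-- Summing over the momentum forces `s_i = t_i`; with `s_i + t_i = 2 a_i` and `2` invertible, both
equal `a_i`. -/
theorem sum_pointMatrix (hp : p ≠ 2) (a : Fin n → ZMod p) :
    ∑ z : Fin n → ZMod p, pointMatrix (a, z) =
      (p : ℂ) ^ n • Matrix.single a a (1 : ℂ) := by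
  have h2 : (2 : ZMod p) ≠ 0 := two_ne_zero_of_ne_two hp
  ext s t
  rw [Matrix.sum_apply]
  simp only [pointMatrix, Matrix.of_apply]
  rw [← Fintype.prod_sum fun i z => pointKernel (a i) z (s i) (t i)]
  have h : ∀ i, ∑ z : ZMod p, pointKernel (a i) z (s i) (t i) =
      if a i = s i ∧ a i = t i then (p : ℂ) else 0 := by
    intro i
    simp only [pointKernel]
    by_cases h1 : 2 * a i = s i + t i
    · simp only [h1, if_true]
      rw [sum_chi_mul]
      congr 1
      rw [eq_iff_iff]
      constructor
      · intro h
        have : 2 * a i = 2 * s i := by linear_combination h1 - h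
        have h3 := mul_left_cancel₀ h2 this
        exact ⟨h3, by rw [h3]; linear_combination h⟩
      · rintro ⟨h3, h4⟩
        rw [← h3, ← h4, sub_self]
    · rw [if_neg]
      · simp [h1]
      · rintro ⟨h3, h4⟩
        apply h1
        rw [← h3, ← h4, two_mul]
  simp only [h]
  rw [Matrix.smul_apply, Matrix.single_apply]
  by_cases hst : a = s ∧ a = t
  · obtain ⟨rfl, rfl⟩ := hst
    simp
  · rw [if_neg hst]
    have : ∃ i, ¬ (a i = s i ∧ a i = t i) := by
      by_contra! hcon
      exact hst ⟨funext fun i => (hcon i).1, funext fun i => (hcon i).2⟩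
    obtain ⟨i, hi⟩ := this
    rw [Finset.prod_eq_zero (Finset.mem_univ i) (if_neg hi), smul_zero]

/-- The probability of an outcome is the normalized number of the phase space points above the input
that the circuit moves to a point above the outcome. -/
theorem norm_circuitOp_sq (hp : p ≠ 2) (C : Circuit n) (a b : Fin n → ZMod p) :
    (p : ℝ) ^ n * ‖circuitOp p C b a‖ ^ 2 =
      (Finset.univ.filter fun z : Fin n → ZMod p => (circuitStep 2⁻¹ C (a, z)).1 = b).card := by
  have h2 : (2 : ZMod p) ≠ 0 := two_ne_zero_of_ne_two hp
  have h1 : circuitOp p C * ((∑ z : Fin n → ZMod p, pointMatrix (a, z)) * (circuitOp p C)ᴴ) =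
      ∑ z : Fin n → ZMod p, pointMatrix (circuitStep 2⁻¹ C (a, z)) := by
    rw [Finset.sum_mul, Finset.mul_sum]
    exact Finset.sum_congr rfl fun z _ => circuit_conj_pointMatrix hp C (a, z)
  -- The diagonal entry at `b`: on the left it is `p^n |⟨b|U|a⟩|²`, on the right each phase point
  -- operator contributes `1` if its position is `b` and `0` otherwise.
  have h3 := congrFun (congrFun h1 b) b
  rw [sum_pointMatrix hp, Matrix.sum_apply, Matrix.smul_mul, Matrix.mul_smul,
    Matrix.smul_apply] at h3
  have h4 : (circuitOp p C * (Matrix.single a a (1 : ℂ) * (circuitOp p C)ᴴ)) b b =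
      ((‖circuitOp p C b a‖ ^ 2 : ℝ) : ℂ) := by
    rw [Matrix.mul_apply, Finset.sum_eq_single a]
    · rw [Matrix.single_mul_apply_same, one_mul, Matrix.conjTranspose_apply, Complex.star_def,
        Complex.mul_conj, Complex.normSq_eq_norm_sq]
    · intro x _ hx
      rw [Matrix.single_mul_apply_of_ne _ _ _ _ _ hx, mul_zero]
    · simp
  have h5 : ∀ z : Fin n → ZMod p, pointMatrix (circuitStep 2⁻¹ C (a, z)) b b =
      if (circuitStep 2⁻¹ C (a, z)).1 = b then 1 else 0 := by
    intro z
    simp only [pointMatrix, Matrix.of_apply, pointKernel, sub_self, mul_zero, chi_zero]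
    rw [Finset.prod_ite_zero, Finset.prod_const_one]
    congr 1
    rw [eq_iff_iff, funext_iff]
    refine ⟨fun h i => mul_left_cancel₀ h2 ((h i (Finset.mem_univ i)).trans (two_mul _).symm),
      fun h i _ => by rw [h i, two_mul]⟩
  rw [h4] at h3
  simp only [h5, Finset.sum_boole, smul_eq_mul] at h3
  exact_mod_cast h3

end PhaseSpace

/-! ### The sum over paths -/

section PathSum

variable {p : ℕ} {n : ℕ}

/-- The value of the phase polynomial of `C` on the labels `v` at the point `x`. -/
def phaseVal (b : Fin n → ZMod p) : Circuit n → (Fin n → ZMod p) → (ℕ → ZMod p) → ZMod p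
  | [], _, _ => 0
  | .fourier j :: C, v, x =>
      if ∀ g ∈ C, ¬ g.ActsOn j then v j * b j + phaseVal b C (Function.update v j (b j)) x
      else v j * x 0 + phaseVal b C (Function.update v j (x 0)) (fun i => x (i + 1))
  | .phase j :: C, v, x => 2⁻¹ * (v j * (v j - 1)) + phaseVal b C v x
  | .sum c t _ :: C, v, x => phaseVal b C (Function.update v t (v c + v t)) x

/-- `phaseVal` always consumes the variable `0` and shifts the rest, which suits induction on the
circuit; the offset `l` translates between the two numberings. -/
theorem eval_phasePolyAux (b : Fin n → ZMod p) (x : ℕ → ZMod p) (C : Circuit n)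
    (lab : Fin n → MvPolynomial ℕ (ZMod p)) (l : ℕ) :
    MvPolynomial.eval x (phasePolyAux p b C lab l) =
      phaseVal b C (fun j => MvPolynomial.eval x (lab j)) (fun i => x (i + l)) := by
  have hupd : ∀ (lab : Fin n → MvPolynomial ℕ (ZMod p)) (j : Fin n) (q : MvPolynomial ℕ (ZMod p)),
      (fun k => MvPolynomial.eval x (Function.update lab j q k)) =
        Function.update (fun k => MvPolynomial.eval x (lab k)) j (MvPolynomial.eval x q) := by
    intro lab j q
    funext k
    by_cases hk : k = j
    · subst hk; simp
    · simp [hk]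
  induction C generalizing lab l with
  | nil => simp [phasePolyAux, phaseVal]
  | cons g C ih =>
    cases g with
    | fourier j =>
      rw [phasePolyAux, phaseVal]
      split_ifs
      · rw [map_add, ih, hupd]; simp
      · rw [map_add, ih, hupd]
        simp only [map_mul, MvPolynomial.eval_X, zero_add]
        congr 2
        funext i
        congr 1
        ring
    | phase j => rw [phasePolyAux, phaseVal, map_add, ih]; simp
    | sum c t h => rw [phasePolyAux, phaseVal, ih, hupd]; simp

/-- The number of Fourier gates. -/
def numFourier : Circuit n → ℕ
  | [] => 0
  | .fourier _ :: C => numFourier C + 1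
  | .phase _ :: C => numFourier C
  | .sum _ _ _ :: C => numFourier C

/-- Every register on which the circuit acts ends in a Fourier gate. -/
def EndsInFourierOnSupport (C : Circuit n) : Prop :=
  ∀ j, (∃ g ∈ C, g.ActsOn j) → EndsInFourier C j

theorem EndsInFourier.of_cons {g : Gate n} {C : Circuit n} {j : Fin n}
    (h : EndsInFourier (g :: C) j) (hg : g ≠ .fourier j ∨ ∃ g' ∈ C, g'.ActsOn j) :
    EndsInFourier C j := by
  obtain ⟨C₁, C₂, h1, h2⟩ := h
  cases C₁ with
  | nil =>
    rw [List.nil_append, List.cons.injEq] at h1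
    obtain ⟨rfl, rfl⟩ := h1
    rcases hg with hg | ⟨g', hg', ha⟩
    · exact absurd rfl hg
    · exact absurd ha (h2 g' hg')
  | cons g' C₁ =>
    rw [List.cons_append, List.cons.injEq] at h1
    exact ⟨C₁, C₂, h1.2, h2⟩

theorem EndsInFourier.exists_actsOn {C : Circuit n} {j : Fin n} (h : EndsInFourier C j) :
    ∃ g ∈ C, g.ActsOn j := by
  obtain ⟨C₁, C₂, rfl, _⟩ := h
  exact ⟨.fourier j, by simp, rfl⟩

/-- Standard form is lost when a terminal gate is dropped from the front, because its register
becomes idle. The condition restricted to active registers survives, so the path-sum induction uses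
it. -/
theorem EndsInFourierOnSupport.tail {g : Gate n} {C : Circuit n}
    (h : EndsInFourierOnSupport (g :: C)) : EndsInFourierOnSupport C := by
  rintro j ⟨g', hg', ha⟩
  exact (h j ⟨g', List.mem_cons_of_mem _ hg', ha⟩).of_cons (Or.inr ⟨g', hg', ha⟩)

theorem EndsInFourierOnSupport.exists_actsOn_tail {g : Gate n} {C : Circuit n} {j : Fin n}
    (h : EndsInFourierOnSupport (g :: C)) (hg : g ≠ .fourier j) (ha : g.ActsOn j) :
    ∃ g' ∈ C, g'.ActsOn j :=
  ((h j ⟨g, List.mem_cons_self, ha⟩).of_cons (Or.inl hg)).exists_actsOn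

/-- Each active register has exactly one terminal Fourier gate. -/
theorem numFourier_eq (C : Circuit n) (h : EndsInFourierOnSupport C) :
    numFourier C = numNonterminal C +
      (Finset.univ.filter fun j => ∃ g ∈ C, g.ActsOn j).card := by
  have same : ∀ (g : Gate n) (C : Circuit n), (∀ j, g.ActsOn j → ∃ g' ∈ C, g'.ActsOn j) →
      (Finset.univ.filter fun j => ∃ g' ∈ g :: C, g'.ActsOn j) =
      (Finset.univ.filter fun j => ∃ g' ∈ C, g'.ActsOn j) := by
    intro g C hg
    refine Finset.filter_congr fun j _ => ?_
    rw [List.exists_mem_cons_iff, or_iff_right_of_imp (hg j)]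
  induction C with
  | nil => simp [numFourier, numNonterminal]
  | cons g C ih =>
    have ih := ih h.tail
    cases g with
    | fourier j =>
      rw [numFourier, numNonterminal, ih]
      split_ifs with hj
      · have : (Finset.univ.filter fun k => ∃ g' ∈ Gate.fourier j :: C, g'.ActsOn k) =
            insert j (Finset.univ.filter fun k => ∃ g' ∈ C, g'.ActsOn k) := by
          ext k
          rw [Finset.mem_insert, Finset.mem_filter, Finset.mem_filter, List.exists_mem_cons_iff]
          simp only [Finset.mem_univ, true_and, Gate.ActsOn, eq_comm]
        rw [this, Finset.card_insert_of_notMem]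
        · omega
        · simpa using hj
      · push Not at hj
        rw [same]
        · omega
        · rintro k rfl
          exact hj
    | phase j =>
      rw [numFourier, numNonterminal, ih, same]
      exact fun k hk => h.exists_actsOn_tail (by simp) hk
    | sum c t hct =>
      rw [numFourier, numNonterminal, ih, same]
      exact fun k hk => h.exists_actsOn_tail (by simp) hk

/-- An idle register keeps its value. In the path sum this collapses the label sum of a terminal
Fourier gate to the single term `b j`. -/
theorem circuitOp_eq_zero [NeZero p] (C : Circuit n) (j : Fin n) (hj : ∀ g ∈ C, ¬ g.ActsOn j)
    (b v : Fin n → ZMod p) (h : b j ≠ v j) : circuitOp p C b v = 0 := by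
  induction C generalizing v with
  | nil =>
    rw [circuitOp, Matrix.one_apply_ne]
    rintro rfl
    exact h rfl
  | cons g C ih =>
    have hC := fun g' hg' => hj g' (List.mem_cons_of_mem _ hg')
    have hg := hj g List.mem_cons_self
    rw [circuitOp]
    cases g with
    | fourier i =>
      rw [mul_fourier_apply]
      refine Finset.sum_eq_zero fun x _ => ?_
      rw [ih hC _ (by rwa [Function.update_of_ne fun h' => hg h'.symm]), zero_mul]
    | phase i => rw [phase_matrix_eq, Matrix.mul_diagonal, ih hC _ h, zero_mul]
    | sum c t hct =>
      rw [mul_sum_apply, ih hC _ (by rwa [Function.update_of_ne fun h' => hg (Or.inr h'.symm)])]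

/-- The extension of a vector by zero to a sequence. -/
def extendZero {m : ℕ} (x : Fin m → ZMod p) (i : ℕ) : ZMod p := if h : i < m then x ⟨i, h⟩ else 0

theorem extendZero_cons {m : ℕ} (x₀ : ZMod p) (x : Fin m → ZMod p) :
    extendZero (Fin.cons x₀ x : Fin (m + 1) → ZMod p) 0 = x₀ ∧
      (fun i => extendZero (Fin.cons x₀ x : Fin (m + 1) → ZMod p) (i + 1)) = extendZero x := by
  constructor
  · simp [extendZero]
  · funext i
    simp only [extendZero, Nat.add_lt_add_iff_right]
    split_ifs with h
    · exact Fin.cons_succ (α := fun _ => ZMod p) x₀ x ⟨i, h⟩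
    · rfl

theorem sum_fin_succ_fun {R M : Type*} [Fintype R] [AddCommMonoid M] {m : ℕ}
    (f : (Fin (m + 1) → R) → M) :
    ∑ x, f x = ∑ x₀ : R, ∑ x : Fin m → R, f (Fin.cons x₀ x) := by
  rw [← (Fin.consEquiv fun _ => R).sum_comp, Fintype.sum_prod_type]
  rfl

/-- The induction needs `hv`: registers without remaining gates already carry their output label.
Without it the amplitude would be zero while the path sum need not be. -/
theorem circuitOp_eq_sum_paths [NeZero p] (C : Circuit n) (hC : EndsInFourierOnSupport C) (m : ℕ)
    (hm : m = numNonterminal C) (b v : Fin n → ZMod p)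
    (hv : ∀ j, (∀ g ∈ C, ¬ g.ActsOn j) → v j = b j) :
    circuitOp p C b v = (((Real.sqrt p : ℝ) : ℂ)⁻¹) ^ numFourier C *
      ∑ x : Fin m → ZMod p, chi p (phaseVal b C v (extendZero x)) := by
  induction C generalizing m v with
  | nil =>
    have hvb : v = b := funext fun j => hv j (by simp)
    simp only [numNonterminal] at hm
    subst hm hvb
    simp [circuitOp, phaseVal, numFourier, chi_zero]
  | cons g C ih =>
    have ih := ih hC.tail
    rw [circuitOp]
    cases g with
    | fourier j =>
      rw [mul_fourier_apply]
      simp only [numNonterminal] at hm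
      simp only [phaseVal, numFourier]
      split_ifs at hm ⊢ with hj
      · rw [Finset.sum_eq_single (b j)]
        · rw [ih m (by omega)]
          · simp only [chi_add]
            rw [← Finset.mul_sum, fourierMatrix, Matrix.of_apply, pow_succ, mul_comm (b j)]
            ring
          · intro k hk
            by_cases hkj : k = j
            · subst hkj; simp
            · rw [Function.update_of_ne hkj]
              refine hv k fun g hg => ?_
              rcases List.mem_cons.1 hg with rfl | hg
              · exact fun h => hkj h.symm
              · exact hk g hg
        · intro x _ hx
          rw [circuitOp_eq_zero C j hj, zero_mul]
          simpa using hx.symm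
        · simp
      -- For a non-terminal gate the label summed over becomes the first path variable.
      · obtain ⟨m, rfl⟩ : ∃ m', m = m' + 1 := ⟨numNonterminal C, by omega⟩
        rw [sum_fin_succ_fun, Finset.mul_sum]
        refine Finset.sum_congr rfl fun x₀ _ => ?_
        rw [ih m (by omega)]
        · simp only [(extendZero_cons _ _).1, (extendZero_cons _ _).2, chi_add]
          rw [← Finset.mul_sum, fourierMatrix, Matrix.of_apply, pow_succ, mul_comm x₀]
          ring
        · intro k hk
          have hkj : k ≠ j := by
            rintro rfl
            exact hj hk
          rw [Function.update_of_ne hkj]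
          refine hv k fun g hg => ?_
          rcases List.mem_cons.1 hg with rfl | hg
          · exact fun h => hkj h.symm
          · exact hk g hg
    | phase j =>
      rw [phase_matrix_eq, Matrix.mul_diagonal, ih m hm]
      · simp only [phaseVal, numFourier, chi_add]
        rw [← Finset.mul_sum, mul_comm (2⁻¹ : ZMod p)]
        ring
      · intro k hk
        refine hv k fun g hg => ?_
        rcases List.mem_cons.1 hg with rfl | hg
        · intro h
          -- A phase gate is never the last gate on its register, so this register cannot be idle in
          -- the tail.
          obtain ⟨g', hg', h'⟩ := hC.exists_actsOn_tail (by simp) h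
          exact hk g' hg' h'
        · exact hk g hg
    | sum c t hct =>
      rw [mul_sum_apply, ih m hm]
      · simp only [phaseVal, numFourier]
      · intro k hk
        have hn : ¬ (Gate.sum c t hct).ActsOn k := by
          intro h
          obtain ⟨g', hg', h'⟩ := hC.exists_actsOn_tail (by simp) h
          exact hk g' hg' h'
        rw [Function.update_of_ne fun h => hn (Or.inr h.symm)]
        refine hv k fun g hg => ?_
        rcases List.mem_cons.1 hg with rfl | hg
        · exact hn
        · exact hk g hg

theorem circuitOp_eq_sum_phasePoly [NeZero p] (C : Circuit n) (hC : IsStandardForm C)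
    (a b : Fin n → ZMod p) :
    circuitOp p C b a = (((Real.sqrt p : ℝ) : ℂ)⁻¹) ^ (n + numNonterminal C) *
      ∑ x : Fin (numNonterminal C) → ZMod p,
        chi p (MvPolynomial.eval (extendZero x) (phasePoly p C a b)) := by
  have hS : EndsInFourierOnSupport C := fun j _ => hC j
  have hcard := numFourier_eq C hS
  rw [Finset.filter_true_of_mem fun j _ => (hC j).exists_actsOn, Finset.card_univ,
    Fintype.card_fin, add_comm] at hcard
  rw [circuitOp_eq_sum_paths C hS _ rfl b a, hcard]
  · simp only [phasePoly, eval_phasePolyAux, MvPolynomial.eval_C, add_zero]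
  · intro j hj
    obtain ⟨g, hg, h⟩ := (hC j).exists_actsOn
    exact absurd h (hj g hg)

end PathSum

/-! ### The phase polynomial is quadratic -/

section Quadratic

open MvPolynomial

variable {p : ℕ} {n : ℕ} {σ : Type*} {m : ℕ}

/-- A family of affine forms with a common linear part. -/
def IsAffineFamily (m : ℕ) (l : σ → MvPolynomial ℕ (ZMod p)) : Prop :=
  ∃ A : Fin m → ZMod p, ∀ s, ∃ c : ZMod p, l s = (∑ i, C (A i) * X (i : ℕ)) + C c

/-- A family of quadratic polynomials with a common quadratic part. -/
def IsQuadraticFamily (m : ℕ) (S : σ → MvPolynomial ℕ (ZMod p)) : Prop :=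
  ∃ Θ : Matrix (Fin m) (Fin m) (ZMod p), ∀ s, ∃ η ζ, S s = quadraticPoly Θ η ζ

theorem IsAffineFamily.const (c : σ → ZMod p) : IsAffineFamily m fun s => C (c s) :=
  ⟨0, fun s => ⟨c s, by simp⟩⟩

theorem IsAffineFamily.var (i : ℕ) (hi : i < m) :
    IsAffineFamily m fun _ : σ => (X i : MvPolynomial ℕ (ZMod p)) :=
  ⟨Pi.single ⟨i, hi⟩ 1, fun _ => ⟨0, by
    rw [Finset.sum_eq_single ⟨i, hi⟩]
    · simp
    · intro j _ hj
      simp [hj]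
    · simp⟩⟩

theorem IsAffineFamily.add {l l' : σ → MvPolynomial ℕ (ZMod p)} (h : IsAffineFamily m l)
    (h' : IsAffineFamily m l') : IsAffineFamily m fun s => l s + l' s := by
  obtain ⟨A, hA⟩ := h
  obtain ⟨A', hA'⟩ := h'
  refine ⟨A + A', fun s => ?_⟩
  obtain ⟨c, hc⟩ := hA s
  obtain ⟨c', hc'⟩ := hA' s
  refine ⟨c + c', ?_⟩
  simp only [hc, hc', Pi.add_apply, map_add, add_mul, Finset.sum_add_distrib]
  ring

theorem IsAffineFamily.mul {l l' : σ → MvPolynomial ℕ (ZMod p)} (h : IsAffineFamily m l)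
    (h' : IsAffineFamily m l') : IsQuadraticFamily m fun s => l s * l' s := by
  obtain ⟨A, hA⟩ := h
  obtain ⟨A', hA'⟩ := h'
  refine ⟨Matrix.of fun i j => A i * A' j, fun s => ?_⟩
  obtain ⟨c, hc⟩ := hA s
  obtain ⟨c', hc'⟩ := hA' s
  refine ⟨fun i => A i * c' + c * A' i, c * c', ?_⟩
  have h1 : ∑ i, ∑ j, C ((Matrix.of fun i j => A i * A' j) i j) * X (i : ℕ) * X (j : ℕ) =
      (∑ i, C (A i) * X (i : ℕ)) * (∑ j, C (A' j) * X (j : ℕ)) := by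
    rw [Finset.sum_mul_sum]
    refine Finset.sum_congr rfl fun i _ => Finset.sum_congr rfl fun j _ => ?_
    rw [Matrix.of_apply, map_mul]
    ring
  have h2 : ∑ i, C (A i * c' + c * A' i) * X (i : ℕ) =
      (∑ i, C (A i) * X (i : ℕ)) * C c' + C c * ∑ i, C (A' i) * X (i : ℕ) := by
    rw [Finset.sum_mul, Finset.mul_sum, ← Finset.sum_add_distrib]
    refine Finset.sum_congr rfl fun i _ => ?_
    rw [map_add, map_mul, map_mul]
    ring
  simp only [hc, hc', quadraticPoly]
  rw [h1, h2, map_mul]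
  ring

theorem IsQuadraticFamily.add {S S' : σ → MvPolynomial ℕ (ZMod p)} (h : IsQuadraticFamily m S)
    (h' : IsQuadraticFamily m S') : IsQuadraticFamily m fun s => S s + S' s := by
  obtain ⟨Θ, hΘ⟩ := h
  obtain ⟨Θ', hΘ'⟩ := h'
  refine ⟨Θ + Θ', fun s => ?_⟩
  obtain ⟨η, ζ, h⟩ := hΘ s
  obtain ⟨η', ζ', h'⟩ := hΘ' s
  refine ⟨η + η', ζ + ζ', ?_⟩
  simp only [h, h', quadraticPoly, Pi.add_apply, Matrix.add_apply, map_add, add_mul,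
    Finset.sum_add_distrib]
  ring

theorem IsQuadraticFamily.zero : IsQuadraticFamily m fun _ : σ => (0 : MvPolynomial ℕ (ZMod p)) :=
  ⟨0, fun _ => ⟨0, 0, by simp [quadraticPoly]⟩⟩

theorem isAffineFamily_update {lab : σ → Fin n → MvPolynomial ℕ (ZMod p)}
    (h : ∀ j, IsAffineFamily m fun s => lab s j) (j : Fin n) {l : σ → MvPolynomial ℕ (ZMod p)}
    (hl : IsAffineFamily m l) (k : Fin n) :
    IsAffineFamily m fun s => Function.update (lab s) j (l s) k := by
  by_cases hk : k = j
  · subst hk; simpa using hl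
  · simpa [hk] using h k

/-- All labels are affine, and the index `s` affects only their constant terms. A product of two
labels therefore has a quadratic part that does not depend on `s`. -/
theorem isQuadraticFamily_phasePolyAux (b : σ → Fin n → ZMod p) (K : Circuit n)
    (lab : σ → Fin n → MvPolynomial ℕ (ZMod p)) (l : ℕ)
    (hlab : ∀ j, IsAffineFamily m fun s => lab s j) (hl : l + numNonterminal K ≤ m) :
    IsQuadraticFamily m fun s => phasePolyAux p (b s) K (lab s) l := by
  induction K generalizing lab l with
  | nil => exact IsQuadraticFamily.zero
  | cons g K ih =>
    cases g with
    | fourier j =>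
      simp only [numNonterminal] at hl
      simp only [phasePolyAux]
      split_ifs at hl ⊢ with hj
      · exact ((hlab j).mul (.const fun s => b s j)).add
          (ih _ _ (isAffineFamily_update hlab j (.const fun s => b s j)) (by omega))
      · exact ((hlab j).mul (.var l (by omega))).add
          (ih _ _ (isAffineFamily_update hlab j (.var l (by omega))) (by omega))
    | phase j =>
      simp only [phasePolyAux]
      have h1 : IsAffineFamily m fun s => lab s j - 1 := by
        simpa [sub_eq_add_neg] using (hlab j).add (.const fun _ => -1)
      obtain ⟨A, hA⟩ := h1
      have h2 : IsAffineFamily m fun s => C (2⁻¹ : ZMod p) * (lab s j - 1) := by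
        refine ⟨fun i => 2⁻¹ * A i, fun s => ?_⟩
        obtain ⟨c, hc⟩ := hA s
        refine ⟨2⁻¹ * c, ?_⟩
        simp only [hc, map_mul, mul_add, Finset.mul_sum, mul_assoc]
      have h3 := (hlab j).mul h2
      simp only [mul_left_comm _ (C (2⁻¹ : ZMod p))] at h3
      exact h3.add (ih _ _ hlab (by simpa [numNonterminal] using hl))
    | sum c t hct =>
      simp only [phasePolyAux]
      exact ih _ _ (isAffineFamily_update hlab t ((hlab c).add (hlab t)))
        (by simpa [numNonterminal] using hl)

theorem exists_symm_phasePoly [Fact p.Prime] (hp : p ≠ 2) (K : Circuit n) :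
    ∃ Θ : Matrix (Fin (numNonterminal K)) (Fin (numNonterminal K)) (ZMod p), Θ.IsSymm ∧
      ∀ a b : Fin n → ZMod p, ∃ η ζ, phasePoly p K a b = quadraticPoly Θ η ζ := by
  -- Indexing the family by all pairs `(a, b)` is what makes `Θ` the same for all of them. It is
  -- then symmetrized, which uses `2⁻¹`.
  obtain ⟨Θ, hΘ⟩ := isQuadraticFamily_phasePolyAux (p := p) (m := numNonterminal K)
    (σ := (Fin n → ZMod p) × (Fin n → ZMod p)) (fun s => s.2) K (fun s j => C (s.1 j)) 0
    (fun j => IsAffineFamily.const fun s : (Fin n → ZMod p) × (Fin n → ZMod p) => s.1 j) (by simp)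
  have h2 := two_ne_zero_of_ne_two hp
  refine ⟨(2⁻¹ : ZMod p) • (Θ + Θᵀ), ?_, fun a b => ?_⟩
  · rw [Matrix.IsSymm, Matrix.transpose_smul, Matrix.transpose_add, Matrix.transpose_transpose,
      add_comm]
  · obtain ⟨η, ζ, h⟩ := hΘ (a, b)
    refine ⟨η, ζ, ?_⟩
    refine h.trans ?_
    rw [quadraticPoly, quadraticPoly]
    congr 2
    have h3 : ∑ i, ∑ j, C (Θᵀ i j) * X (i : ℕ) * X (j : ℕ) =
        ∑ i, ∑ j, C (Θ i j) * X (i : ℕ) * X (j : ℕ) := by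
      rw [Finset.sum_comm]
      refine Finset.sum_congr rfl fun i _ => Finset.sum_congr rfl fun j _ => ?_
      rw [Matrix.transpose_apply]
      ring
    have h4 : ∑ i, ∑ j, C (((2⁻¹ : ZMod p) • (Θ + Θᵀ)) i j) * X (i : ℕ) * X (j : ℕ) =
        C (2⁻¹ : ZMod p) * (∑ i, ∑ j, C (Θ i j) * X (i : ℕ) * X (j : ℕ) +
          ∑ i, ∑ j, C (Θᵀ i j) * X (i : ℕ) * X (j : ℕ)) := by
      simp only [mul_add, Finset.mul_sum, ← Finset.sum_add_distrib]
      refine Finset.sum_congr rfl fun i _ => Finset.sum_congr rfl fun j _ => ?_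
      rw [Matrix.smul_apply, Matrix.add_apply, smul_eq_mul, map_mul, map_add]
      ring
    rw [h4, h3, ← two_mul, ← mul_assoc, show (2 : MvPolynomial ℕ (ZMod p)) = C 2 from
      (map_ofNat C 2).symm, ← map_mul, inv_mul_cancel₀ h2, map_one, one_mul]

theorem eval_quadraticPoly (Θ : Matrix (Fin m) (Fin m) (ZMod p)) (η : Fin m → ZMod p) (ζ : ZMod p)
    (x : Fin m → ZMod p) :
    eval (extendZero x) (quadraticPoly Θ η ζ) = x ⬝ᵥ Θ *ᵥ x + η ⬝ᵥ x + ζ := by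
  have h : ∀ i : Fin m, extendZero x (i : ℕ) = x i := fun i => by simp [extendZero]
  simp only [quadraticPoly, map_add, map_sum, map_mul, eval_C, eval_X, h, dotProduct,
    Matrix.mulVec, Finset.mul_sum]
  congr 2
  refine Finset.sum_congr rfl fun i _ => Finset.sum_congr rfl fun j _ => ?_
  ring

/-- The columns of `L` are an orthogonal basis for the symmetric bilinear form of `Θ`, which exists
when `2` is invertible. -/
theorem exists_isUnit_diagonal {K : Type*} [Field K] (h2 : (2 : K) ≠ 0)
    (Θ : Matrix (Fin m) (Fin m) K) (hΘ : Θ.IsSymm) :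
    ∃ (L : Matrix (Fin m) (Fin m) K) (lam : Fin m → K),
      IsUnit L ∧ Lᵀ * Θ * L = Matrix.diagonal lam := by
  let _ := invertibleOfNonzero h2
  have hB : LinearMap.IsSymm (Matrix.toBilin' Θ) := by
    refine ⟨fun x y => ?_⟩
    simp only [Matrix.toBilin'_apply', RingHom.id_apply]
    rw [Matrix.dotProduct_mulVec, ← Matrix.mulVec_transpose, hΘ.eq, dotProduct_comm]
  obtain ⟨v, hv⟩ := LinearMap.BilinForm.exists_orthogonal_basis hB
  have hdim : Module.finrank K (Fin m → K) = m := by simp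
  let w := v.reindex (finCongr hdim)
  refine ⟨(Pi.basisFun K (Fin m)).toMatrix w, fun i => Matrix.toBilin' Θ (w i) (w i), ?_, ?_⟩
  · let _ := (Pi.basisFun K (Fin m)).invertibleToMatrix w
    exact isUnit_of_invertible _
  · have key : ∀ i j, (((Pi.basisFun K (Fin m)).toMatrix w)ᵀ * Θ *
        (Pi.basisFun K (Fin m)).toMatrix w) i j = Matrix.toBilin' Θ (w i) (w j) := by
      intro i j
      rw [Matrix.toBilin'_apply', Matrix.dotProduct_mulVec]
      rfl
    ext i j
    rw [key, Matrix.diagonal_apply]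
    split_ifs with hij
    · rw [hij]
    · have := hv (i := (finCongr hdim).symm i) (j := (finCongr hdim).symm j) (by simpa using hij)
      simpa [w] using this

end Quadratic

/-! ### Evaluation of the amplitude -/

section Amplitude

variable {p : ℕ} [Fact p.Prime] {m : ℕ}

theorem card_ne_zero_eq_rank {Θ L : Matrix (Fin m) (Fin m) (ZMod p)} {lam : Fin m → ZMod p}
    (hL : IsUnit L) (h : Lᵀ * Θ * L = Matrix.diagonal lam) :
    (Finset.univ.filter fun i => lam i ≠ 0).card = Θ.rank := by
  have hdet : IsUnit L.det := (Matrix.isUnit_iff_isUnit_det L).1 hL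
  have hdet' : IsUnit Lᵀ.det := by rwa [Matrix.det_transpose]
  have h1 : (Lᵀ * Θ * L).rank = Θ.rank := by
    rw [Matrix.rank_mul_eq_left_of_isUnit_det _ _ hdet,
      Matrix.rank_mul_eq_right_of_isUnit_det _ _ hdet']
  rw [← h1, h, Matrix.rank_diagonal, Fintype.card_subtype]

/-- The substitution `x = L y` is a bijection and separates the variables. -/
theorem sum_chi_diagonalize (Θ L : Matrix (Fin m) (Fin m) (ZMod p)) (η lam : Fin m → ZMod p)
    (ζ : ZMod p) (hL : IsUnit L) (h : Lᵀ * Θ * L = Matrix.diagonal lam) :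
    ∑ x : Fin m → ZMod p, chi p (x ⬝ᵥ Θ *ᵥ x + η ⬝ᵥ x + ζ) =
      chi p ζ * ∏ i, ∑ y : ZMod p, chi p (lam i * y ^ 2 + (Lᵀ *ᵥ η) i * y) := by
  have hbij : Function.Bijective (L.mulVec) :=
    ⟨Matrix.mulVec_injective_iff_isUnit.2 hL, Matrix.mulVec_surjective_iff_isUnit.2 hL⟩
  rw [← (Equiv.ofBijective _ hbij).sum_comp, Fintype.prod_sum, Finset.mul_sum]
  refine Finset.sum_congr rfl fun y _ => ?_
  rw [← chi_sum, ← chi_add]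
  congr 1
  rw [Equiv.ofBijective_apply]
  have h1 : L *ᵥ y ⬝ᵥ Θ *ᵥ (L *ᵥ y) = ∑ i, lam i * y i ^ 2 := by
    have : L *ᵥ y ⬝ᵥ Θ *ᵥ (L *ᵥ y) = y ⬝ᵥ (Lᵀ * Θ * L) *ᵥ y := by
      rw [← Matrix.mulVec_mulVec, ← Matrix.mulVec_mulVec, Matrix.dotProduct_mulVec y,
        Matrix.vecMul_transpose]
    rw [this, h, dotProduct]
    refine Finset.sum_congr rfl fun i _ => ?_
    rw [Matrix.mulVec_diagonal]
    ring
  have h2 : η ⬝ᵥ L *ᵥ y = ∑ i, (Lᵀ *ᵥ η) i * y i := by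
    rw [Matrix.dotProduct_mulVec, ← Matrix.mulVec_transpose, dotProduct]
  rw [h1, h2, Finset.sum_add_distrib]
  ring

theorem prod_sum_chi_quadratic (hp : p ≠ 2) (lam μ : Fin m → ZMod p) :
    ∏ i, ∑ y : ZMod p, chi p (lam i * y ^ 2 + μ i * y) =
      (∏ i with lam i ≠ 0, Complex.I ^ eps p * chi p (-4⁻¹ * (lam i)⁻¹ * μ i ^ 2) *
        (legendreSym p ((lam i).val : ℤ) : ℂ) * ((Real.sqrt p : ℝ) : ℂ)) *
      (∏ _i ∈ (Finset.univ.filter fun i => lam i = 0 ∧ μ i = 0), (p : ℂ)) *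
      (∏ _i ∈ (Finset.univ.filter fun i => lam i = 0 ∧ μ i ≠ 0), (0 : ℂ)) := by
  rw [← Finset.prod_filter_mul_prod_filter_not _ (fun i => lam i ≠ 0), mul_assoc]
  congr 1
  · refine Finset.prod_congr rfl fun i hi => ?_
    exact sum_chi_quadratic hp _ _ (Finset.mem_filter.1 hi).2
  · rw [← Finset.prod_filter_mul_prod_filter_not _ (fun i => μ i = 0), Finset.filter_filter,
      Finset.filter_filter]
    simp only [not_not]
    congr 1
    · refine Finset.prod_congr rfl fun i hi => ?_
      obtain ⟨h1, h2⟩ := (Finset.mem_filter.1 hi).2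
      simp [h1, h2, chi_zero, ZMod.card]
    · refine Finset.prod_congr rfl fun i hi => ?_
      obtain ⟨h1, h2⟩ := (Finset.mem_filter.1 hi).2
      simpa [h1, h2, mul_comm] using sum_chi_mul p (μ i)

theorem legendreSym_prod {ι : Type*} (s : Finset ι) (f : ι → ZMod p) :
    legendreSym p ((∏ i ∈ s, f i).val : ℤ) = ∏ i ∈ s, legendreSym p ((f i).val : ℤ) := by
  have h : ∀ x : ZMod p, legendreSym p (x.val : ℤ) = quadraticChar (ZMod p) x := by
    intro x
    rw [legendreSym, show (((x.val : ℕ) : ℤ) : ZMod p) = x by simp]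
  simp only [h, map_prod]

theorem rpow_amplitude (n r s : ℕ) :
    (((p : ℝ) ^ (((n : ℝ) + (r + s : ℕ)) / 2) : ℝ))⁻¹ * (Real.sqrt p) ^ r * (p : ℝ) ^ s =
      (p : ℝ) ^ (-((n : ℝ) + r - (r + s : ℕ)) / 2) := by
  have hp : (0 : ℝ) < p := by exact_mod_cast (Fact.out : p.Prime).pos
  rw [Real.sqrt_eq_rpow, ← Real.rpow_natCast ((p : ℝ) ^ (1 / 2 : ℝ)), ← Real.rpow_mul hp.le,
    ← Real.rpow_natCast (p : ℝ) s, ← Real.rpow_neg hp.le, ← Real.rpow_add hp, ← Real.rpow_add hp]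
  congr 1
  push_cast
  ring

theorem sqrt_inv_pow (k : ℕ) :
    (((Real.sqrt p : ℝ) : ℂ)⁻¹) ^ k = (((p : ℝ) ^ ((k : ℝ) / 2) : ℝ) : ℂ)⁻¹ := by
  have hp : (0 : ℝ) < p := by exact_mod_cast (Fact.out : p.Prime).pos
  rw [inv_pow, ← Complex.ofReal_pow, Real.sqrt_eq_rpow, ← Real.rpow_natCast, ← Real.rpow_mul hp.le,
    one_div_mul_eq_div]

theorem amplitude_eq (n r : ℕ) (lam μ : Fin m → ZMod p) (ζ : ZMod p)
    (X Y Z : Finset (Fin m)) (hX : X = Finset.univ.filter fun i => lam i ≠ 0)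
    (hY : Y = Finset.univ.filter fun i => lam i = 0 ∧ μ i = 0)
    (hZ : Z = Finset.univ.filter fun i => lam i = 0 ∧ μ i ≠ 0) (hr : X.card = r) :
    chi p ζ / (((p : ℝ) ^ (((n : ℝ) + m) / 2) : ℝ) : ℂ) *
        (∏ i ∈ X, Complex.I ^ eps p * chi p (-4⁻¹ * (lam i)⁻¹ * μ i ^ 2) *
          (legendreSym p ((lam i).val : ℤ) : ℂ) * ((Real.sqrt p : ℝ) : ℂ)) *
        (∏ _j ∈ Y, (p : ℂ)) * (∏ _k ∈ Z, (0 : ℂ)) =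
      (((p : ℝ) ^ (-((n : ℝ) + r - m) / 2) : ℝ) : ℂ) *
        (if Z.card = 0 then 1 else 0) * Complex.I ^ (r * eps p) *
        (legendreSym p ((∏ i ∈ X, lam i).val : ℤ) : ℂ) *
        chi p (ζ - 4⁻¹ * ∑ i ∈ X, (lam i)⁻¹ * μ i ^ 2) := by
  by_cases hZ0 : Z.card = 0
  · have hZe := Finset.card_eq_zero.1 hZ0
    rw [if_pos hZ0, hZe, Finset.prod_empty, mul_one, mul_one, Finset.prod_const]
    -- With `Z` empty the indices split into `X` and `Y`; this converts `√p ^ |X| · p ^ |Y|` into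
    -- the stated power of `p`.
    have hm : m = r + Y.card := by
      have h1 : X.card + (Finset.univ.filter fun i => ¬ lam i ≠ 0).card = m := by
        rw [hX, Finset.card_filter_add_card_filter_not, Finset.card_univ, Fintype.card_fin]
      have h2 : (Finset.univ.filter fun i => ¬ lam i ≠ 0) = Y := by
        rw [hY]
        refine Finset.filter_congr fun i _ => ?_
        rw [not_not]
        refine ⟨fun h => ⟨h, ?_⟩, fun h => h.1⟩
        by_contra h3
        have : i ∈ Z := by rw [hZ]; simp [h, h3]
        simp [hZe] at this
      rw [h2] at h1
      omega
    rw [Finset.prod_mul_distrib, Finset.prod_mul_distrib, Finset.prod_mul_distrib,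
      Finset.prod_const, Finset.prod_const, hr, ← chi_sum, legendreSym_prod, ← pow_mul,
      mul_comm r, Int.cast_prod, sub_eq_add_neg ζ, chi_add, ← mul_neg_one (4⁻¹ * _)]
    have h5 : 4⁻¹ * ∑ i ∈ X, (lam i)⁻¹ * μ i ^ 2 * -1 = ∑ i ∈ X, -4⁻¹ * (lam i)⁻¹ * μ i ^ 2 := by
      rw [Finset.mul_sum]
      refine Finset.sum_congr rfl fun i _ => ?_
      ring
    rw [mul_assoc (4⁻¹ : ZMod p), Finset.sum_mul, h5]
    have h6 := congrArg (fun x : ℝ => (x : ℂ)) (rpow_amplitude (p := p) n r Y.card)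
    simp only [← hm] at h6
    rw [← h6]
    simp only [Complex.ofReal_mul, Complex.ofReal_inv, Complex.ofReal_pow, Complex.ofReal_natCast]
    ring
  · rw [if_neg hZ0, Finset.prod_const (s := Z), zero_pow hZ0]
    simp

theorem norm_amplitude_sq (n r : ℕ) (lam : Fin m → ZMod p) (c : ZMod p) (d : ℂ)
    (X : Finset (Fin m)) (hX : ∀ i ∈ X, lam i ≠ 0) :
    ‖(((p : ℝ) ^ (-((n : ℝ) + r - m) / 2) : ℝ) : ℂ) * d * Complex.I ^ (r * eps p) *
        (legendreSym p ((∏ i ∈ X, lam i).val : ℤ) : ℂ) * chi p c‖ ^ 2 =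
      (p : ℝ) ^ (-((n : ℤ) + r - m)) * ‖d‖ ^ 2 := by
  have hp : (0 : ℝ) < p := by exact_mod_cast (Fact.out : p.Prime).pos
  have hleg : ‖(legendreSym p ((∏ i ∈ X, lam i).val : ℤ) : ℂ)‖ = 1 := by
    have h0 : (((∏ i ∈ X, lam i).val : ℤ) : ZMod p) ≠ 0 := by
      rw [show (((∏ i ∈ X, lam i).val : ℤ) : ZMod p) = ∏ i ∈ X, lam i by
        rw [Int.cast_natCast, ZMod.natCast_zmod_val]]
      exact Finset.prod_ne_zero_iff.2 hX
    rcases legendreSym.eq_one_or_neg_one p h0 with h | h <;> rw [h] <;> simp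
  simp only [norm_mul, hleg, norm_chi, norm_pow, Complex.norm_I, one_pow, mul_one, mul_pow]
  congr 1
  rw [Complex.norm_real, Real.norm_of_nonneg (Real.rpow_nonneg hp.le _), ← Real.rpow_natCast,
    ← Real.rpow_mul hp.le, ← Real.rpow_intCast]
  congr 1
  push_cast
  ring

end Amplitude

/-! ### Assembly of the amplitude formulas -/

theorem amplitude_formulas {p : ℕ} [Fact p.Prime] (hp : p ≠ 2) {n : ℕ} (C : Circuit n)
    (hC : IsStandardForm C) :
    ∃ Θ : Matrix (Fin (numNonterminal C)) (Fin (numNonterminal C)) (ZMod p),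
      Θ.IsSymm ∧
      (∃ (L : Matrix (Fin (numNonterminal C)) (Fin (numNonterminal C)) (ZMod p))
        (lam : Fin (numNonterminal C) → ZMod p),
        IsUnit L ∧ Lᵀ * Θ * L = Matrix.diagonal lam) ∧
      ∀ a b : Fin n → ZMod p,
        ∃ (η : Fin (numNonterminal C) → ZMod p) (ζ : ZMod p),
          phasePoly p C a b = quadraticPoly Θ η ζ ∧
          ∀ (L : Matrix (Fin (numNonterminal C)) (Fin (numNonterminal C)) (ZMod p))
            (lam μ : Fin (numNonterminal C) → ZMod p)
            (X Y Z : Finset (Fin (numNonterminal C))),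
            IsUnit L → Lᵀ * Θ * L = Matrix.diagonal lam → μ = Lᵀ *ᵥ η →
            X = {i | lam i ≠ 0} → Y = {i | lam i = 0 ∧ μ i = 0} →
            Z = {i | lam i = 0 ∧ μ i ≠ 0} →
            X.card = Θ.rank ∧
            circuitOp p C b a =
              chi p ζ / (((p : ℝ) ^ (((n : ℝ) + numNonterminal C) / 2) : ℝ) : ℂ) *
                ∏ i, ∑ y : ZMod p, chi p (lam i * y ^ 2 + μ i * y) ∧
            circuitOp p C b a =
              chi p ζ / (((p : ℝ) ^ (((n : ℝ) + numNonterminal C) / 2) : ℝ) : ℂ) *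
                (∏ i ∈ X, Complex.I ^ eps p * chi p (-4⁻¹ * (lam i)⁻¹ * μ i ^ 2) *
                  (legendreSym p ((lam i).val : ℤ) : ℂ) * ((Real.sqrt p : ℝ) : ℂ)) *
                (∏ _j ∈ Y, (p : ℂ)) * (∏ _k ∈ Z, (0 : ℂ)) ∧
            circuitOp p C b a =
              (((p : ℝ) ^ (-((n : ℝ) + Θ.rank - numNonterminal C) / 2) : ℝ) : ℂ) *
                (if Z.card = 0 then 1 else 0) * Complex.I ^ (Θ.rank * eps p) *
                (legendreSym p ((∏ i ∈ X, lam i).val : ℤ) : ℂ) *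
                chi p (ζ - 4⁻¹ * ∑ i ∈ X, (lam i)⁻¹ * μ i ^ 2) ∧
            ‖circuitOp p C b a‖ ^ 2 =
              (p : ℝ) ^ (-((n : ℤ) + Θ.rank - numNonterminal C)) *
                (if Z.card = 0 then 1 else 0) := by
  obtain ⟨Θ, hΘ, hS⟩ := exists_symm_phasePoly (p := p) hp C
  refine ⟨Θ, hΘ, exists_isUnit_diagonal (two_ne_zero_of_ne_two hp) Θ hΘ, fun a b => ?_⟩
  obtain ⟨η, ζ, h⟩ := hS a b
  refine ⟨η, ζ, h, fun L lam μ X Y Z hL hdiag hμ hX hY hZ => ?_⟩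
  replace hX : X = Finset.univ.filter fun i => lam i ≠ 0 := by
    ext i; simp [← Finset.mem_coe, hX]
  replace hY : Y = Finset.univ.filter fun i => lam i = 0 ∧ μ i = 0 := by
    ext i; simp [← Finset.mem_coe, hY]
  replace hZ : Z = Finset.univ.filter fun i => lam i = 0 ∧ μ i ≠ 0 := by
    ext i; simp [← Finset.mem_coe, hZ]
  have hr : X.card = Θ.rank := by rw [hX]; exact card_ne_zero_eq_rank hL hdiag
  have h1 : circuitOp p C b a =
      chi p ζ / (((p : ℝ) ^ (((n : ℝ) + numNonterminal C) / 2) : ℝ) : ℂ) *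
        ∏ i, ∑ y : ZMod p, chi p (lam i * y ^ 2 + μ i * y) := by
    rw [circuitOp_eq_sum_phasePoly C hC, h, sqrt_inv_pow]
    simp only [eval_quadraticPoly]
    rw [sum_chi_diagonalize Θ L η lam ζ hL hdiag, ← hμ]
    push_cast
    ring
  have h2 : circuitOp p C b a =
      chi p ζ / (((p : ℝ) ^ (((n : ℝ) + numNonterminal C) / 2) : ℝ) : ℂ) *
        (∏ i ∈ X, Complex.I ^ eps p * chi p (-4⁻¹ * (lam i)⁻¹ * μ i ^ 2) *
          (legendreSym p ((lam i).val : ℤ) : ℂ) * ((Real.sqrt p : ℝ) : ℂ)) *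
        (∏ _j ∈ Y, (p : ℂ)) * (∏ _k ∈ Z, (0 : ℂ)) := by
    rw [h1, prod_sum_chi_quadratic hp, ← hX, ← hY, ← hZ]
    ring
  have h3 := h2.trans (amplitude_eq n Θ.rank lam μ ζ X Y Z hX hY hZ hr)
  refine ⟨hr, h1, h2, h3, ?_⟩
  rw [h3, norm_amplitude_sq]
  · split_ifs <;> simp
  · intro i hi
    rw [hX] at hi
    exact (Finset.mem_filter.1 hi).2

/-! ### Reasoning about programs -/

section Programs

/-- Started on `m`, the program `c` halts after at most `T` steps in a memory that satisfies `Q`. -/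
def Halts (c : Program) (m : Memory) (T : ℕ) (Q : Memory → Prop) : Prop :=
  ∃ t m', Exec c m t m' ∧ t ≤ T ∧ Q m'

theorem Halts.mono {c : Program} {m : Memory} {T T' : ℕ} {Q Q' : Memory → Prop}
    (h : Halts c m T Q) (hT : T ≤ T') (hQ : ∀ m', Q m' → Q' m') : Halts c m T' Q' := by
  obtain ⟨t, m', h1, h2, h3⟩ := h
  exact ⟨t, m', h1, h2.trans hT, hQ m' h3⟩

theorem Halts.seq {c d : Program} {m : Memory} {T T' : ℕ} {Q : Memory → Prop}
    (h : Halts c m T fun m' => Halts d m' T' Q) : Halts (.seq c d) m (T + T') Q := by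
  obtain ⟨t, m', h1, h2, t', m'', h3, h4, h5⟩ := h
  exact ⟨t + t', m'', .seq h1 h3, Nat.add_le_add h2 h4, h5⟩

theorem Halts.branch {e : Expr} {c d : Program} {m : Memory} {T : ℕ} {Q : Memory → Prop}
    (h₁ : e.eval m ≠ 0 → Halts c m T Q) (h₂ : e.eval m = 0 → Halts d m T Q) :
    Halts (.branch e c d) m (e.cost + 1 + T) Q := by
  by_cases h : e.eval m = 0
  · obtain ⟨t, m', h1, h2, h3⟩ := h₂ h
    exact ⟨_, m', .branchFalse h h1, Nat.add_le_add_left h2 _, h3⟩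
  · obtain ⟨t, m', h1, h2, h3⟩ := h₁ h
    exact ⟨_, m', .branchTrue h h1, Nat.add_le_add_left h2 _, h3⟩

/-- A loop whose body decreases a variant while maintaining an invariant. -/
theorem Halts.loop {e : Expr} {c : Program} {T : ℕ} (I : Memory → Prop) (V : Memory → ℕ)
    (step : ∀ m, I m → e.eval m ≠ 0 → Halts c m T fun m' => I m' ∧ V m' < V m)
    (m : Memory) (hm : I m) :
    Halts (.loop e c) m (V m * (e.cost + 1 + T) + (e.cost + 1)) fun m' => I m' ∧ e.eval m' = 0 := by
  induction hV : V m using Nat.strong_induction_on generalizing m with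
  | _ v ih =>
    by_cases h : e.eval m = 0
    · exact ⟨_, m, .loopStop h, Nat.le_add_left _ _, hm, h⟩
    · obtain ⟨t, m₁, h1, h2, h3, h4⟩ := step m hm h
      obtain ⟨t', m₂, h5, h6, h7⟩ := ih (V m₁) (hV ▸ h4) m₁ h3 rfl
      refine ⟨_, m₂, .loopStep h h1 h5, ?_, h7⟩
      have h8 : (V m₁ + 1) * (e.cost + 1 + T) ≤ v * (e.cost + 1 + T) :=
        Nat.mul_le_mul_right _ (hV ▸ h4)
      rw [Nat.add_mul, Nat.one_mul] at h8
      omega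

/-- The memory `m` with the value `v` in the cell `i` of bank `k`. -/
def setCell (m : Memory) (k i v : ℕ) : Memory := Function.update m k (Function.update (m k) i v)

theorem setCell_apply (m : Memory) (k i v k' : ℕ) :
    setCell m k i v k' = if k' = k then Function.update (m k) i v else m k' := by
  rw [setCell, Function.update_apply]

theorem setCell_eq_self (m : Memory) (k i : ℕ) : setCell m k i (m k i) = m := by
  rw [setCell, Function.update_eq_self, Function.update_eq_self]

/-- Programs without loops. -/
def Program.loopFree : Program → Bool
  | .skip => true
  | .store _ _ _ => true
  | .seq c d => c.loopFree && d.loopFree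
  | .branch _ c d => c.loopFree && d.loopFree
  | .loop _ _ => false

/-- The effect of a program without loops. -/
def Program.run : Program → Memory → Memory
  | .skip, m => m
  | .store k e₁ e₂, m => setCell m k (e₁.eval m) (e₂.eval m)
  | .seq c d, m => d.run (c.run m)
  | .branch e c d, m => if e.eval m = 0 then d.run m else c.run m
  | .loop _ _, m => m

/-- A bound for the number of steps of a program without loops. -/
def Program.flatCost : Program → ℕ
  | .skip => 1
  | .store _ e₁ e₂ => e₁.cost + e₂.cost + 1
  | .seq c d => c.flatCost + d.flatCost
  | .branch e c d => e.cost + 1 + (c.flatCost + d.flatCost)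
  | .loop _ _ => 0

theorem Program.exec_run (c : Program) (hc : c.loopFree = true) (m : Memory) :
    ∃ t, Exec c m t (c.run m) ∧ t ≤ c.flatCost := by
  induction c generalizing m with
  | skip => exact ⟨1, .skip m, le_rfl⟩
  | store k e₁ e₂ => exact ⟨_, .store k e₁ e₂ m, le_rfl⟩
  | seq c d ihc ihd =>
    rw [loopFree, Bool.and_eq_true] at hc
    obtain ⟨t, h1, h2⟩ := ihc hc.1 m
    obtain ⟨t', h3, h4⟩ := ihd hc.2 (c.run m)
    exact ⟨_, .seq h1 h3, Nat.add_le_add h2 h4⟩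
  | branch e c d ihc ihd =>
    rw [loopFree, Bool.and_eq_true] at hc
    rw [run, flatCost]
    split_ifs with h
    · obtain ⟨t, h1, h2⟩ := ihd hc.2 m
      exact ⟨_, .branchFalse h h1, by omega⟩
    · obtain ⟨t, h1, h2⟩ := ihc hc.1 m
      exact ⟨_, .branchTrue h h1, by omega⟩
  | loop e c => simp [loopFree] at hc

theorem Halts.of_run {c : Program} (hc : c.loopFree = true) {m : Memory} {Q : Memory → Prop}
    (h : Q (c.run m)) : Halts c m c.flatCost Q := by
  obtain ⟨t, h1, h2⟩ := c.exec_run hc m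
  exact ⟨t, _, h1, h2, h⟩

/-- The variable that is kept in the cell `0` of bank `k`. -/
def var (k : ℕ) : Expr := .load k (.lit 0)

/-- The assignment of `e` to the variable of bank `k`. -/
def assign (k : ℕ) (e : Expr) : Program := .store k (.lit 0) e

/-- The variable `i` runs from `0` to the value of the variable `N`, exclusively. -/
def forLoop (i N : ℕ) (c : Program) : Program :=
  .seq (assign i (.lit 0))
    (.loop (.sub (var N) (var i)) (.seq c (assign i (.add (var i) (.lit 1)))))

/-- Each round costs `T` plus `6` for the guard and `6` for the increment; the `9` is the
initialization and the final guard. The invariant must not depend on the counter cell, which is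
rewritten between rounds (`hI`). -/
theorem Halts.forLoop {i N : ℕ} {c : Program} {T n : ℕ} (hiN : i ≠ N) (I : ℕ → Memory → Prop)
    (hI : ∀ j m v, I j m → I j (setCell m i 0 v))
    (step : ∀ j m, j < n → I j m → m i 0 = j → m N 0 = n →
      Halts c m T fun m' => I (j + 1) m' ∧ m' i 0 = j ∧ m' N 0 = n)
    (m : Memory) (hm : I 0 m) (hN : m N 0 = n) :
    Halts (forLoop i N c) m (n * (T + 12) + 9) fun m' => I n m' := by
  rw [QuopitClifford.forLoop]
  have h1 : Halts (assign i (.lit 0)) m 3 fun m' => I 0 m' ∧ m' i 0 = 0 ∧ m' N 0 = n :=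
    ⟨3, _, Exec.store i _ _ m, le_rfl, hI 0 m 0 hm, by simp [Expr.eval], by
      simp [Expr.eval, hiN.symm, hN]⟩
  refine Halts.mono (Halts.seq (T' := n * (T + 12) + 6) (h1.mono le_rfl fun m₁ hm₁ => ?_))
    (by omega) fun _ h => h
  refine Halts.mono (Halts.loop (T := T + 6)
    (fun m' => ∃ j ≤ n, I j m' ∧ m' i 0 = j ∧ m' N 0 = n)
    (fun m' => n - m' i 0) ?_ m₁ ⟨0, Nat.zero_le _, hm₁⟩) ?_ ?_
  · rintro m₂ ⟨j, hj, h2, h3, h4⟩ hne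
    simp only [Expr.eval, var, h3, h4] at hne
    refine Halts.seq (T' := 6) ((step j m₂ (by omega) h2 h3 h4).mono le_rfl fun m₃ hm₃ => ?_)
    refine ⟨6, _, Exec.store i _ _ m₃, le_rfl, ⟨j + 1, by omega, hI _ m₃ _ hm₃.1, ?_, ?_⟩, ?_⟩
    · simp [Expr.eval, var, hm₃.2.1]
    · simp [hiN.symm, hm₃.2.2]
    · simp only [Expr.eval, var, Function.update_self, hm₃.2.1, h3]
      omega
  · simp only [Expr.cost, var, hm₁.2.1]
    have : n * (1 + 1 + (1 + 1) + 1 + 1 + (T + 6)) ≤ n * (T + 12) :=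
      Nat.mul_le_mul_left _ (by omega)
    simp only [Nat.sub_zero]
    omega
  · rintro m' ⟨⟨j, hj, h2, h3, h4⟩, h5⟩
    simp only [Expr.eval, var, h3, h4] at h5
    rwa [show n = j by omega]

/-! ### Modular arithmetic -/

/-- One step of the reduction of the variable `v` modulo the variable of bank `3`. -/
def reduce (v : ℕ) : Program :=
  .branch (.sub (.add (var v) (.lit 1)) (var 3)) (assign v (.sub (var v) (var 3))) .skip

/-- The number `x` after one step of the reduction modulo `N`. -/
def reduceOnce (N x : ℕ) : ℕ := if N ≤ x then x - N else x

theorem run_reduce (v : ℕ) (m : Memory) :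
    (reduce v).run m = setCell m v 0 (reduceOnce (m 3 0) (m v 0)) := by
  -- With truncated subtraction `v + 1 - N` is nonzero exactly when `N ≤ v`, so it serves as the
  -- comparison.
  have he : (Expr.sub (.add (var v) (.lit 1)) (var 3)).eval m = m v 0 + 1 - m 3 0 := rfl
  rw [reduce, Program.run, he, reduceOnce]
  by_cases h : m 3 0 ≤ m v 0
  · rw [if_neg (by omega), if_pos h]
    rfl
  · rw [if_pos (by omega), if_neg h, setCell_eq_self]
    rfl

theorem reduceOnce_modEq (N x : ℕ) : reduceOnce N x ≡ x [MOD N] := by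
  rw [reduceOnce]
  split_ifs with h
  · rw [Nat.ModEq]
    conv_rhs => rw [← Nat.sub_add_cancel h, Nat.add_mod_right]
  · rfl

theorem reduceOnce_lt {N x : ℕ} (hx : x < N + N) : reduceOnce N x < N := by
  rw [reduceOnce]
  split_ifs <;> omega

/-- Binary multiplication of the variables of the banks `13` and `14`, modulo the variable of bank
`3`; the result appears in bank `15`. -/
def mulMod : Program :=
  .seq (assign 15 (.lit 0))
    (.loop (var 14)
      (.seq (.branch (.sub (var 14) (.add (.half (var 14)) (.half (var 14))))
          (.seq (assign 15 (.add (var 15) (var 13))) (reduce 15)) .skip)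
        (.seq (assign 13 (.add (var 13) (var 13)))
          (.seq (reduce 13) (assign 14 (.half (var 14)))))))

theorem size_half_lt {y : ℕ} (hy : y ≠ 0) : (y / 2).size < y.size := by
  have h1 : y < 2 ^ y.size := Nat.lt_size_self y
  have h2 : 0 < y.size := Nat.size_pos.2 (Nat.pos_of_ne_zero hy)
  have h3 : (y / 2).size ≤ y.size - 1 := by
    rw [Nat.size_le]
    obtain ⟨s, hs⟩ : ∃ s, y.size = s + 1 := ⟨y.size - 1, by omega⟩
    rw [hs, pow_succ] at h1
    rw [hs, Nat.add_sub_cancel]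
    omega
  omega

/-- Invariant: accumulator plus `x * y` is constant modulo `N`, while `x` doubles and `y` is halved;
the variant is the bit length of `y`. For `N = 0` the reduction does nothing and the congruence is
an equality, so the same program multiplies exactly. -/
theorem halts_mulMod (m : Memory) (B : ℕ) (hB : (m 14 0).size ≤ B)
    (hx : m 3 0 = 0 ∨ m 13 0 < m 3 0) :
    Halts mulMod m (B * 100 + 100) fun m' =>
      m' 15 0 ≡ m 13 0 * m 14 0 [MOD m 3 0] ∧ (m 3 0 = 0 ∨ m' 15 0 < m 3 0) ∧
      ∀ k, k ≠ 13 → k ≠ 14 → k ≠ 15 → m' k = m k := by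
  refine Halts.mono (Halts.seq (T := 3) (T' := B * 100 + 10) (Halts.of_run rfl ?_)) (by omega)
    fun _ h => h
  refine Halts.mono (Halts.loop (T := 90) (fun m' =>
      m' 15 0 + m' 13 0 * m' 14 0 ≡ m 13 0 * m 14 0 [MOD m 3 0] ∧
      (m 3 0 = 0 ∨ m' 15 0 < m 3 0 ∧ m' 13 0 < m 3 0) ∧
      ∀ k, k ≠ 13 → k ≠ 14 → k ≠ 15 → m' k = m k)
    (fun m' => (m' 14 0).size) ?_ _ ⟨?_, ?_, ?_⟩) ?_ ?_
  · rintro m₁ ⟨h1, h2, h3⟩ hne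
    have h30 : m₁ 3 = m 3 := h3 3 (by decide) (by decide) (by decide)
    simp only [Expr.eval, var] at hne
    refine (Halts.of_run (by rfl) (Q := fun m' => _) ?_).mono (by decide) fun _ h => h
    simp only [Program.run, run_reduce, assign, Expr.eval, var]
    -- The tested expression is the lowest bit of the multiplier; the first case is the even one.
    split_ifs with hodd
    · simp only [setCell_apply, Function.update_self, if_true, if_false,
        Nat.reduceEqDiff, h30]
      refine ⟨⟨?_, ?_, ?_⟩, size_half_lt hne⟩
      · refine Nat.ModEq.trans (Nat.ModEq.add_left _ ((reduceOnce_modEq _ _).mul_right _)) ?_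
        refine Nat.ModEq.trans ?_ h1
        have h5 : m₁ 14 0 = 2 * (m₁ 14 0 / 2) := by omega
        generalize m₁ 14 0 / 2 = y at h5 ⊢
        rw [h5]
        apply congrArg (· % m 3 0)
        ring
      · rcases h2 with h2 | h2
        · exact Or.inl h2
        · exact Or.inr ⟨h2.1, reduceOnce_lt (by omega)⟩
      · intro k hk1 hk2 hk3
        simp only [hk1, hk2, if_false]
        exact h3 k hk1 hk2 hk3
    · simp only [setCell_apply, Function.update_self, if_true, if_false,
        Nat.reduceEqDiff, h30]
      refine ⟨⟨?_, ?_, ?_⟩, size_half_lt hne⟩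
      · refine Nat.ModEq.trans (Nat.ModEq.add (reduceOnce_modEq _ _)
          ((reduceOnce_modEq _ _).mul_right _)) ?_
        refine Nat.ModEq.trans ?_ h1
        have h5 : m₁ 14 0 = 2 * (m₁ 14 0 / 2) + 1 := by omega
        generalize m₁ 14 0 / 2 = y at h5 ⊢
        rw [h5]
        apply congrArg (· % m 3 0)
        ring
      · rcases h2 with h2 | h2
        · exact Or.inl h2
        · exact Or.inr ⟨reduceOnce_lt (by omega), reduceOnce_lt (by omega)⟩
      · intro k hk1 hk2 hk3
        simp only [hk1, hk2, hk3, if_false]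
        exact h3 k hk1 hk2 hk3
  · simp [Program.run, assign, setCell_apply, Expr.eval, Nat.ModEq]
  · rcases hx with hx | hx
    · exact Or.inl hx
    · refine Or.inr ⟨?_, ?_⟩ <;> simp [Program.run, assign, setCell_apply, Expr.eval] <;> omega
  · intro k hk1 hk2 hk3
    simp [Program.run, assign, setCell_apply, hk3]
  · simp only [Expr.cost, var, Program.run, assign, setCell_apply]
    have : (m 14 0).size * (1 + 1 + 1 + 90) ≤ B * 93 := Nat.mul_le_mul hB (by norm_num)
    simp only [Nat.reduceEqDiff, if_false]
    omega
  · rintro m' ⟨⟨h1, h2, h3⟩, h4⟩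
    simp only [Expr.eval, var] at h4
    rw [h4, mul_zero, add_zero] at h1
    exact ⟨h1, h2.imp_right And.left, h3⟩

end Programs

/-! ### Running a circuit on points of phase space -/

section Simulation

theorem Halts.loop_step {e : Expr} {c : Program} {m : Memory} {T T' : ℕ} {Q : Memory → Prop}
    (he : e.eval m ≠ 0) (h : Halts c m T fun m' => Halts (.loop e c) m' T' Q) :
    Halts (.loop e c) m (e.cost + 1 + T + T') Q := by
  obtain ⟨t, m₁, h1, h2, t', m₂, h3, h4, h5⟩ := h
  exact ⟨_, m₂, .loopStep he h1 h3, by omega, h5⟩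

theorem Halts.loop_stop {e : Expr} {c : Program} {m : Memory} {Q : Memory → Prop}
    (he : e.eval m = 0) (h : Q m) : Halts (.loop e c) m (e.cost + 1) Q :=
  ⟨_, m, .loopStop he, le_rfl, h⟩

/-- The memories agree outside the banks of the list `S`. -/
def Agree (S : List ℕ) (m m' : Memory) : Prop := ∀ k, k ∉ S → m' k = m k

theorem Agree.refl (S : List ℕ) (m : Memory) : Agree S m m := fun _ _ => rfl

/-- Frame rule: every program is specified with the banks it may change. Layout: `3` is `p`, `4` is
`n`, `5` is `n + 1`, `6` the address after the gates; `7` and `8` a column and its address; `20`,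
`21` position and momentum, `11` the phase constant; `13`–`15` multiplication; `22` the matrix, `23`
the pivot row, `19` the number of pivots; `26` and `28` numerator and denominator. -/
theorem Agree.trans {S S' S'' : List ℕ} {m m' m'' : Memory} (h : Agree S m m')
    (h' : Agree S' m' m'') (hS : S ⊆ S'' := by decide) (hS' : S' ⊆ S'' := by decide) :
    Agree S'' m m'' := fun k hk =>
  (h' k fun h => hk (hS' h)).trans (h k fun h => hk (hS h))

theorem Agree.setCell {S : List ℕ} {m m' : Memory} (h : Agree S m m') (k i v : ℕ)
    (hk : k ∈ S := by decide) : Agree S m (setCell m' k i v) := fun k' hk' => by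
  rw [setCell_apply, if_neg (fun h' : k' = k => hk' (h' ▸ hk)), h k' hk']

variable {p n : ℕ}

/-- The array `f` holds the vector `x`. -/
def Represents (f : ℕ → ℕ) (x : Fin n → ZMod p) : Prop := ∀ j : Fin n, f j = (x j).val

theorem Represents.update {f : ℕ → ℕ} {x : Fin n → ZMod p} (h : Represents f x) (c : Fin n)
    (v : ZMod p) : Represents (Function.update f c v.val) (Function.update x c v) := by
  intro j
  by_cases hj : j = c
  · subst hj; simp
  · rw [Function.update_of_ne hj, Function.update_of_ne fun h' => hj (Fin.ext h'), h j]

theorem eq_val_of_modEq [NeZero p] {x : ℕ} (hx : x < p) {y : ZMod p} (h : (x : ZMod p) = y) :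
    x = y.val := by
  rw [← h, ZMod.val_cast_of_lt hx]

theorem natCast_reduceOnce (x : ℕ) : ((reduceOnce p x : ℕ) : ZMod p) = x :=
  (ZMod.natCast_eq_natCast_iff _ _ _).2 (reduceOnce_modEq p x)

/-- A sum of two reduced residues is below `2p`, so one conditional subtraction reduces it. The same
holds for `x + (p - y)`, where `p - y` itself may equal `p`. -/
theorem reduceOnce_val_add [NeZero p] (x y : ZMod p) :
    reduceOnce p (x.val + y.val) = (x + y).val := by
  have hx := ZMod.val_lt x
  have hy := ZMod.val_lt y
  refine eq_val_of_modEq (reduceOnce_lt (by omega)) ?_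
  rw [natCast_reduceOnce]
  simp

theorem natCast_sub_val [NeZero p] (y : ZMod p) : ((p - y.val : ℕ) : ZMod p) = -y := by
  rw [Nat.cast_sub (ZMod.val_lt y).le]
  simp

theorem reduceOnce_val_sub [NeZero p] (x y : ZMod p) :
    reduceOnce p (x.val + (p - y.val)) = (x - y).val := by
  have hx := ZMod.val_lt x
  refine eq_val_of_modEq (reduceOnce_lt (by omega)) ?_
  rw [natCast_reduceOnce, Nat.cast_add, natCast_sub_val]
  simp [sub_eq_add_neg]

theorem reduceOnce_val_neg [NeZero p] (y : ZMod p) : reduceOnce p (p - y.val) = (-y).val := by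
  simpa using reduceOnce_val_sub 0 y

/-! ### The simulation of a circuit on a point of phase space -/

/-- The entries of the description of the gate at the address in bank `10`. -/
def gateKind : Expr := .load 0 (var 10)

/-- The first register of the gate. -/
def gateFst : Expr := .load 0 (.add (var 10) (.lit 1))

/-- The second register of the gate. -/
def gateSnd : Expr := .load 0 (.add (var 10) (.lit 2))

/-- The action of the gate described at the address in bank `10` on the position in bank `20` and
the momentum in bank `21`. -/
def gateProg : Program :=
  .branch gateKind
    (.branch (.sub gateKind (.lit 1))
      (.seq (assign 24 (.add (.load 20 gateFst) (.load 20 gateSnd)))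
        (.seq (reduce 24)
        (.seq (.store 20 gateSnd (var 24))
        (.seq (assign 24 (.add (.load 21 gateFst) (.sub (var 3) (.load 21 gateSnd))))
        (.seq (reduce 24) (.store 21 gateFst (var 24)))))))
      (.seq (assign 24 (.add (.load 21 gateFst) (.load 20 gateFst)))
        (.seq (reduce 24)
        (.seq (assign 24 (.add (var 24) (.sub (var 3) (var 11))))
        (.seq (reduce 24) (.store 21 gateFst (var 24)))))))
    (.seq (assign 24 (.sub (var 3) (.load 21 gateFst)))
      (.seq (reduce 24)
      (.seq (.store 21 gateFst (.load 20 gateFst)) (.store 20 gateFst (var 24)))))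

theorem run_gateProg [NeZero p] (m : Memory) (g : Gate n) (h : ZMod p)
    (v : (Fin n → ZMod p) × (Fin n → ZMod p)) (hp : m 3 0 = p) (hh : m 11 0 = h.val)
    (hg : g.encode = [m 0 (m 10 0), m 0 (m 10 0 + 1), m 0 (m 10 0 + 2)])
    (h1 : Represents (m 20) v.1) (h2 : Represents (m 21) v.2) :
    Represents (gateProg.run m 20) (gateStep h g v).1 ∧
      Represents (gateProg.run m 21) (gateStep h g v).2 ∧
      Agree [20, 21, 24] m (gateProg.run m) := by
  cases g with
  | fourier j =>
    simp only [Gate.encode, List.cons.injEq] at hg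
    have hr : gateProg.run m = setCell (setCell (setCell m 24 0 (-v.2 j).val) 21 j (v.1 j).val)
        20 j (-v.2 j).val := by
      simp only [gateProg, Program.run, run_reduce, gateKind, gateFst, assign, Expr.eval, var,
        ← hg.1, ← hg.2.1, setCell_apply, if_true, if_false, Nat.reduceEqDiff, Function.update_self,
        hp, h2 j, h1 j, reduceOnce_val_neg]
      simp [setCell]
    rw [hr]
    refine ⟨?_, ?_, ((((Agree.refl _ m).setCell _ _ _).setCell _ _ _).setCell _ _ _)⟩
    · simpa [setCell_apply, gateStep] using h1.update j (-v.2 j)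
    · simpa [setCell_apply, gateStep] using h2.update j (v.1 j)
  | phase j =>
    simp only [Gate.encode, List.cons.injEq] at hg
    have hr : gateProg.run m = setCell (setCell m 24 0 (v.2 j + v.1 j - h).val) 21 j
        (v.2 j + v.1 j - h).val := by
      simp only [gateProg, Program.run, run_reduce, gateKind, gateFst, assign, Expr.eval, var,
        ← hg.1, ← hg.2.1, setCell_apply, if_true, if_false, Nat.reduceEqDiff, Function.update_self,
        hp, hh, h2 j, h1 j, reduceOnce_val_add, reduceOnce_val_sub]
      simp [setCell]
    rw [hr]
    refine ⟨?_, ?_, (((Agree.refl _ m).setCell _ _ _).setCell _ _ _)⟩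
    · simpa [setCell_apply, gateStep] using h1
    · simpa [setCell_apply, gateStep, add_sub_assoc] using h2.update j (v.2 j + v.1 j - h)
  | sum c t hct =>
    simp only [Gate.encode, List.cons.injEq, and_true] at hg
    have hr : gateProg.run m = setCell (setCell (setCell (setCell m 24 0 (v.1 c + v.1 t).val) 20 t
        (v.1 c + v.1 t).val) 24 0 (v.2 c - v.2 t).val) 21 c (v.2 c - v.2 t).val := by
      simp only [gateProg, Program.run, run_reduce, gateKind, gateFst, gateSnd, assign, Expr.eval,
        var, ← hg.1, ← hg.2.1, ← hg.2.2, setCell_apply, if_true, if_false, Nat.reduceEqDiff,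
        Function.update_self, hp, h2 c, h2 t, h1 c, h1 t, reduceOnce_val_add, reduceOnce_val_sub]
      simp [setCell]
    rw [hr]
    refine ⟨?_, ?_,
      (((((Agree.refl _ m).setCell _ _ _).setCell _ _ _).setCell _ _ _).setCell _ _ _)⟩
    · simpa [setCell_apply, gateStep] using h1.update t (v.1 c + v.1 t)
    · simpa [setCell_apply, gateStep] using h2.update c (v.2 c - v.2 t)

/-- The description of the circuit `C` is in the array `f` from the address `q` on. -/
def EncodesAt (f : ℕ → ℕ) : ℕ → Circuit n → Prop
  | _, [] => True
  | q, g :: C => g.encode = [f q, f (q + 1), f (q + 2)] ∧ EncodesAt f (q + 3) C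

/-- The simulation of the gates from the address in bank `10` to the one in bank `6`. -/
def circuitProg : Program :=
  .loop (.sub (var 6) (var 10)) (.seq gateProg (assign 10 (.add (var 10) (.lit 3))))

theorem halts_circuitProg [NeZero p] (C : Circuit n) (h : ZMod p) (m : Memory)
    (v : (Fin n → ZMod p) × (Fin n → ZMod p)) (hp : m 3 0 = p) (hh : m 11 0 = h.val)
    (hC : EncodesAt (m 0) (m 10 0) C) (hend : m 6 0 = m 10 0 + 3 * C.length)
    (h1 : Represents (m 20) v.1) (h2 : Represents (m 21) v.2) :
    Halts circuitProg m (C.length * 300 + 6) fun m' =>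
      Represents (m' 20) (circuitStep h C v).1 ∧ Agree [10, 20, 21, 24] m m' := by
  induction C generalizing m v with
  | nil =>
    refine (Halts.loop_stop ?_ ⟨h1, Agree.refl _ m⟩).mono ?_ fun _ h => h
    · simp [Expr.eval, var, hend]
    · simp [Expr.cost, var]
  | cons g C ih =>
    obtain ⟨h3, h4, h5⟩ := run_gateProg m g h v hp hh hC.1 h1 h2
    rw [List.length_cons] at hend
    have e10 : gateProg.run m 10 = m 10 := h5 10 (by decide)
    have e3 : gateProg.run m 3 = m 3 := h5 3 (by decide)
    have e11 : gateProg.run m 11 = m 11 := h5 11 (by decide)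
    have e0 : gateProg.run m 0 = m 0 := h5 0 (by decide)
    have e6 : gateProg.run m 6 = m 6 := h5 6 (by decide)
    refine Halts.mono (Halts.loop_step (T := 290) (T' := C.length * 300 + 6) ?_
      (Halts.mono (Halts.of_run (by rfl)
        (Q := fun m' => m' = setCell (gateProg.run m) 10 0 (m 10 0 + 3)) ?_)
        (Nat.le_of_ble_eq_true rfl) fun m' hm' => ?_)) ?_ fun _ h => h
    · simp only [Expr.eval, var, hend]
      omega
    · simp only [Program.run, assign, Expr.eval, var, e10]
    · subst hm'
      refine (ih _ (gateStep h g v) ?_ ?_ ?_ ?_ ?_ ?_).mono le_rfl ?_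
      · simp [setCell_apply, e3, hp]
      · simp [setCell_apply, e11, hh]
      · simpa [setCell_apply, e0] using hC.2
      · simp only [setCell_apply, e6, hend, Nat.reduceEqDiff, if_false, if_true,
          Function.update_self]
        ring
      · simpa [setCell_apply] using h3
      · simpa [setCell_apply] using h4
      · rintro m' ⟨h6, h7⟩
        exact ⟨h6, Agree.trans (Agree.setCell (S := [10, 20, 21, 24])
          (h5.trans (Agree.refl [] _)) 10 0 _) h7⟩
    · simp only [Expr.cost, var, List.length_cons]
      omega

/-! ### The matrix of the positions -/

/-- The parameter of the phase gate in the column `k`: the last column is the constant one. -/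
noncomputable def columnParam (p n k : ℕ) : ZMod p := if k < n then 0 else 2⁻¹

/-- The point of phase space that is propagated to obtain the column `k`. -/
def columnPoint (a : Fin n → ZMod p) (k : ℕ) : (Fin n → ZMod p) × (Fin n → ZMod p) :=
  (fun j => if k < n then 0 else a j, fun j => if (j : ℕ) = k then 1 else 0)

/-- The initialization of the banks `20`, `21` and `11` for the column in bank `7`. -/
def columnInit : Program :=
  .seq (forLoop 9 4 (.seq
      (.branch (.sub (var 4) (var 7)) (.store 20 (var 9) (.lit 0))
        (.store 20 (var 9) (.load 0 (.add (var 6) (var 9)))))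
      (.store 21 (var 9) (.lit 0))))
    (.seq (.branch (.sub (var 4) (var 7))
        (.seq (.store 21 (var 7) (.lit 1)) (assign 11 (.lit 0)))
        (assign 11 (.half (.add (var 3) (.lit 1)))))
      (assign 10 (.lit 4)))

/-- The constant of the phase gate is thus obtained by one halving, without modular inversion. -/
theorem val_two_inv [Fact p.Prime] (hp : p ≠ 2) : (p + 1) / 2 = (2⁻¹ : ZMod p).val := by
  have hodd : p % 2 = 1 := ((Fact.out : p.Prime).eq_two_or_odd).resolve_left hp
  have h2 := (Fact.out : p.Prime).two_le
  refine eq_val_of_modEq (by omega) ?_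
  apply mul_left_cancel₀ (two_ne_zero_of_ne_two hp)
  rw [mul_inv_cancel₀ (two_ne_zero_of_ne_two hp)]
  have h3 : ((2 * ((p + 1) / 2) : ℕ) : ZMod p) = ((p + 1 : ℕ) : ZMod p) := by
    congr 1
    omega
  push_cast at h3
  simpa using h3

theorem halts_columnInit [Fact p.Prime] (hp2 : p ≠ 2) (a : Fin n → ZMod p) (m : Memory) (k : ℕ)
    (hp : m 3 0 = p) (hn : m 4 0 = n) (hk : m 7 0 = k) (hkn : k ≤ n)
    (ha : ∀ j : Fin n, m 0 (m 6 0 + j) = (a j).val) :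
    Halts columnInit m (n * 60 + 60) fun m' =>
      Represents (m' 20) (columnPoint a k).1 ∧ Represents (m' 21) (columnPoint a k).2 ∧
      m' 11 0 = (columnParam p n k).val ∧ m' 10 0 = 4 ∧
      Agree [9, 10, 11, 20, 21] m m' := by
  have h1p : 1 < p := (Fact.out : p.Prime).one_lt
  have hval1 : (1 : ZMod p).val = 1 := by
    rw [ZMod.val_one_eq_one_mod, Nat.mod_eq_of_lt h1p]
  refine Halts.mono (Halts.seq (T := n * 60 + 9) (T' := 51)
    (Halts.mono (Halts.forLoop (n := n) (T := 48) (by decide)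
    (fun j m' => (∀ i : Fin n, (i : ℕ) < j → m' 20 i = ((columnPoint a k).1 i).val ∧ m' 21 i = 0) ∧
      Agree [9, 20, 21] m m')
    ?_ ?_ m ⟨fun i hi => absurd hi (by omega), Agree.refl _ m⟩ hn) (by omega) ?_)) (by omega)
      fun _ h => h
  · rintro j m' v ⟨h1, h2⟩
    exact ⟨by simpa [setCell_apply] using h1, h2.setCell _ _ _⟩
  · rintro j m' hj ⟨h1, h2⟩ h3 h4
    have e7 : m' 7 = m 7 := h2 7 (by decide)
    have e6 : m' 6 = m 6 := h2 6 (by decide)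
    have e0 : m' 0 = m 0 := h2 0 (by decide)
    refine (Halts.of_run (by rfl) (Q := fun m'' => m'' = setCell (setCell m' 20 j
      ((columnPoint a k).1 ⟨j, hj⟩).val) 21 j 0) ?_).mono (by decide) ?_
    · simp only [Program.run, Expr.eval, var, h3, h4, e7, hk, e6, e0]
      have := ha ⟨j, hj⟩
      simp only at this
      split_ifs with h5
      · rw [this]
        have h6 : ¬ k < n := by omega
        simp [columnPoint, h6, setCell_apply, h3]
      · have h6 : k < n := by omega
        simp [columnPoint, h6, setCell_apply, h3]
    · rintro m'' rfl
      refine ⟨⟨fun i hi => ?_, (h2.setCell _ _ _).setCell _ _ _⟩, by simp [setCell_apply, h3],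
        by simp [setCell_apply, h4]⟩
      by_cases hij : (i : ℕ) = j
      · subst hij
        simp [setCell_apply]
      · simpa [setCell_apply, hij] using h1 i (by omega)
  · rintro m' ⟨h1, h2⟩
    have e7 : m' 7 = m 7 := h2 7 (by decide)
    have e4 : m' 4 = m 4 := h2 4 (by decide)
    have e3 : m' 3 = m 3 := h2 3 (by decide)
    refine (Halts.of_run (by rfl) ?_).mono (by decide) fun _ h => h
    simp only [Program.run, Expr.eval, var, assign, e7, e4, e3, hk, hn, hp]
    split_ifs with h5
    · obtain rfl : k = n := by omega
      refine ⟨?_, ?_, ?_, ?_, ?_⟩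
      · intro i
        simpa [setCell_apply] using (h1 i i.2).1
      · intro i
        have := i.2.ne
        simpa [setCell_apply, columnPoint, this] using (h1 i i.2).2
      · simp [setCell_apply, columnParam, val_two_inv hp2]
      · simp [setCell_apply]
      · exact Agree.setCell (Agree.setCell (h2.trans (Agree.refl [] _)) _ _ _) _ _ _
    · have hlt : k < n := by omega
      refine ⟨?_, ?_, ?_, ?_, ?_⟩
      · intro i
        simpa [setCell_apply] using (h1 i i.2).1
      · intro i
        by_cases hik : (i : ℕ) = k
        · simp [setCell_apply, columnPoint, hik, hval1]
        · simpa [setCell_apply, columnPoint, hik] using (h1 i i.2).2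
      · simp [setCell_apply, columnParam, hlt]
      · simp [setCell_apply]
      · exact Agree.setCell (Agree.setCell (Agree.setCell
          (h2.trans (Agree.refl [] _)) _ _ _) _ _ _) _ _ _

/-- The computation of the column in bank `7`, of which the address is in bank `8`. -/
def columnProg : Program :=
  .seq columnInit (.seq circuitProg
    (.seq (forLoop 9 4 (.store 22 (.add (var 9) (var 8)) (.load 20 (var 9))))
      (assign 8 (.add (var 8) (var 4)))))

/-- The first `K` columns of the matrix `A` are in the array `f`. -/
def RepMat (f : ℕ → ℕ) (A : Fin n → ℕ → ZMod p) (K : ℕ) : Prop :=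
  ∀ (i : Fin n) (k : ℕ), k < K → f (i + n * k) = (A i k).val

/-- The matrix of the positions, with the constants in column `n`. -/
noncomputable def positionMatrix (C : Circuit n) (a : Fin n → ZMod p) (i : Fin n) (k : ℕ) :
    ZMod p :=
  (circuitStep (columnParam p n k) C (columnPoint a k)).1 i

theorem address_lt {i k k' : ℕ} (hi : i < n) (hk : k < k') : i + n * k < n * k' := by
  have : n * (k + 1) ≤ n * k' := Nat.mul_le_mul_left n hk
  rw [Nat.mul_add, Nat.mul_one] at this
  omega

theorem halts_columnProg [Fact p.Prime] (hp2 : p ≠ 2) (C : Circuit n) (a : Fin n → ZMod p)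
    (m : Memory) (k : ℕ) (hp : m 3 0 = p) (hn : m 4 0 = n) (hk : m 7 0 = k) (hkn : k ≤ n)
    (hoff : m 8 0 = n * k) (ha : ∀ j : Fin n, m 0 (m 6 0 + j) = (a j).val)
    (hC : EncodesAt (m 0) 4 C) (hend : m 6 0 = 4 + 3 * C.length)
    (hA : RepMat (m 22) (positionMatrix C a) k) :
    Halts columnProg m (n * 100 + C.length * 300 + 100) fun m' =>
      RepMat (m' 22) (positionMatrix C a) (k + 1) ∧ m' 8 0 = n * (k + 1) ∧
      Agree [8, 9, 10, 11, 20, 21, 22, 24] m m' := by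
  refine Halts.mono (Halts.seq (T := n * 60 + 60) (T' := n * 40 + C.length * 300 + 40)
    ((halts_columnInit hp2 a m k hp hn hk hkn ha).mono le_rfl ?_)) (by omega) fun _ h => h
  rintro m₁ ⟨h1, h2, h3, h4, h5⟩
  have e3 : m₁ 3 = m 3 := h5 3 (by decide)
  have e0 : m₁ 0 = m 0 := h5 0 (by decide)
  have e6 : m₁ 6 = m 6 := h5 6 (by decide)
  refine Halts.mono (Halts.seq (T := C.length * 300 + 6) (T' := n * 40 + 30)
    ((halts_circuitProg C (columnParam p n k) m₁ _ (by rw [e3, hp]) h3 (by rwa [e0, h4])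
      (by rw [e6, h4, hend]) h1 h2).mono le_rfl ?_)) (by omega) fun _ h => h
  rintro m₂ ⟨h6, h7⟩
  have h8 : Agree [9, 10, 11, 20, 21, 24] m m₂ := h5.trans h7
  have e4 : m₂ 4 = m 4 := h8 4 (by decide)
  have e22 : m₂ 22 = m 22 := h8 22 (by decide)
  have e8 : m₂ 8 = m 8 := h8 8 (by decide)
  refine Halts.mono (Halts.seq (T := n * 40 + 9) (T' := 20) (Halts.mono (Halts.forLoop (n := n)
    (T := 28) (by decide)
    (fun j m' => (∀ i : Fin n, (i : ℕ) < j → m' 22 (i + n * k) = (positionMatrix C a i k).val) ∧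
      (∀ q < n * k, m' 22 q = m 22 q) ∧ Agree [9, 22] m₂ m')
    ?_ ?_ m₂ ⟨fun i hi => absurd hi (by omega), fun q _ => by rw [e22], Agree.refl _ _⟩
      (by rw [e4, hn])) (by omega) ?_)) (by omega) fun _ h => h
  · rintro j m' v ⟨h9, h10, h11⟩
    exact ⟨by simpa [setCell_apply] using h9, by simpa [setCell_apply] using h10,
      h11.setCell _ _ _⟩
  · rintro j m' hj ⟨h9, h10, h11⟩ h12 h13
    have e8' : m' 8 = m 8 := (h11 8 (by decide)).trans e8
    have e20' : m' 20 = m₂ 20 := h11 20 (by decide)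
    refine (Halts.of_run (by rfl) (Q := fun m'' => m'' = setCell m' 22 (j + n * k)
      (positionMatrix C a ⟨j, hj⟩ k).val) ?_).mono (by decide) ?_
    · simp only [Program.run, Expr.eval, var, h12, e8', hoff, e20']
      rw [h6 ⟨j, hj⟩, positionMatrix]
    · rintro m'' rfl
      refine ⟨⟨fun i hi => ?_, fun q hq => ?_, h11.setCell _ _ _⟩, by simp [setCell_apply, h12],
        by simp [setCell_apply, h13]⟩
      · by_cases hij : (i : ℕ) = j
        · subst hij
          simp [setCell_apply]
        · simpa [setCell_apply, hij] using h9 i (by omega)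
      · have : q ≠ j + n * k := by omega
        simpa [setCell_apply, this] using h10 q hq
  · rintro m' ⟨h9, h10, h11⟩
    have h12 : Agree [9, 10, 11, 20, 21, 22, 24] m m' := h8.trans h11
    have e8' : m' 8 = m 8 := h12 8 (by decide)
    have e4' : m' 4 = m 4 := h12 4 (by decide)
    refine (Halts.of_run (by rfl) ?_).mono (by decide) fun _ h => h
    simp only [Program.run, Expr.eval, var, assign, e8', e4', hoff, hn]
    refine ⟨fun i k' hk' => ?_, ?_, (h12.trans (Agree.refl [] _)).setCell _ _ _⟩
    · rcases Nat.lt_succ_iff_lt_or_eq.1 hk' with hk' | rfl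
      · simpa [setCell_apply, h10 _ (address_lt i.2 hk')] using hA i k' hk'
      · simpa [setCell_apply] using h9 i i.2
    · simp [setCell_apply]
      ring

end Simulation

/-! ### Elimination without division -/

section Elimination

variable {p n : ℕ}

/-- The value of the affine form in the row `i` of `A`, with the constants in column `n`. -/
def rowVal (A : Fin n → ℕ → ZMod p) (i : Fin n) (z : Fin n → ZMod p) : ZMod p :=
  ∑ k : Fin n, A i k * z k + A i n

/-- The number of common zeros of the affine forms in the rows of `A`. -/
def solCount [NeZero p] (A : Fin n → ℕ → ZMod p) : ℕ :=
  (Finset.univ.filter fun z : Fin n → ZMod p => ∀ i, rowVal A i z = 0).card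

/-- The elimination of the variable `k` with the row `j`, which becomes zero. -/
def pivot (A : Fin n → ℕ → ZMod p) (j : Fin n) (k : ℕ) (i : Fin n) (l : ℕ) : ZMod p :=
  A j k * A i l + A j l * -A i k

theorem rowVal_pivot (A : Fin n → ℕ → ZMod p) (i j : Fin n) (k : ℕ) (z : Fin n → ZMod p) :
    rowVal (pivot A j k) i z = A j k * rowVal A i z - A i k * rowVal A j z := by
  simp only [rowVal, pivot, mul_add, Finset.mul_sum, add_mul, Finset.sum_add_distrib]
  have h : ∀ x : Fin n, A j x * -A i k * z x = -(A i k * (A j x * z x)) := fun x => by ring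
  simp only [h, Finset.sum_neg_distrib, mul_assoc]
  ring

theorem rowVal_add_single (A : Fin n → ℕ → ZMod p) (i k : Fin n) (z : Fin n → ZMod p)
    (c : ZMod p) : rowVal A i (z + Pi.single k c) = rowVal A i z + A i k * c := by
  simp only [rowVal, Pi.add_apply, mul_add, Finset.sum_add_distrib, Pi.single_apply, mul_ite,
    mul_zero, Finset.sum_ite_eq', Finset.mem_univ, if_true]
  ring

/-- The row `j` of the new system is zero and the variable `k` no longer occurs, so `z_k` is free.
Each old solution yields the `p` new ones on its line in direction `k`. -/
theorem solCount_pivot [Fact p.Prime] (A : Fin n → ℕ → ZMod p) (j k : Fin n) (h : A j k ≠ 0) :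
    solCount (pivot A j k) = p * solCount A := by
  have hcard : p * solCount A = ((Finset.univ.filter fun z : Fin n → ZMod p =>
      ∀ i, rowVal A i z = 0) ×ˢ (Finset.univ : Finset (ZMod p))).card := by
    rw [Finset.card_product, Finset.card_univ, ZMod.card, mul_comm]
    rfl
  rw [hcard, solCount]
  refine Finset.card_bij'
    -- A new solution is moved along the coordinate `k` until the row `j` vanishes; the length of
    -- the shift is the second component.
    (fun z _ => (z + Pi.single k (-(rowVal A j z / A j k)), rowVal A j z / A j k))
    (fun w _ => w.1 + Pi.single k w.2) ?_ ?_ ?_ ?_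
  · intro z hz
    have hz := (Finset.mem_filter.1 hz).2
    refine Finset.mem_product.2 ⟨Finset.mem_filter.2 ⟨Finset.mem_univ _, fun i => ?_⟩,
      Finset.mem_univ _⟩
    have h1 := hz i
    rw [rowVal_pivot] at h1
    simp only
    rw [rowVal_add_single]
    field_simp
    linear_combination h1
  · intro w hw
    have hw := (Finset.mem_filter.1 (Finset.mem_product.1 hw).1).2
    refine Finset.mem_filter.2 ⟨Finset.mem_univ _, fun i => ?_⟩
    rw [rowVal_pivot, rowVal_add_single, rowVal_add_single, hw i, hw j]
    ring
  · intro z _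
    simp [add_assoc, ← Pi.single_add]
  · intro w hw
    have hw := (Finset.mem_filter.1 (Finset.mem_product.1 hw).1).2
    have h1 : rowVal A j (w.1 + Pi.single k w.2) / A j k = w.2 := by
      rw [rowVal_add_single, hw j, zero_add, mul_div_cancel_left₀ _ h]
    refine Prod.ext ?_ h1
    simp only [h1]
    rw [add_assoc, ← Pi.single_add]
    simp

theorem solCount_of_zero [Fact p.Prime] (A : Fin n → ℕ → ZMod p)
    (h : ∀ i, ∀ k < n, A i k = 0) :
    solCount A = if ∀ i, A i n = 0 then p ^ n else 0 := by
  have h1 : ∀ i z, rowVal A i z = A i n := by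
    intro i z
    rw [rowVal, Finset.sum_eq_zero, zero_add]
    intro k _
    rw [h i k k.2, zero_mul]
  simp only [solCount, h1]
  split_ifs with h2
  · simp [h2, ZMod.card]
  · simp [h2]

/-- The state of the elimination of the matrix `A₀` before the row `j` of the column `k` is
considered. -/
structure IsEliminated [NeZero p] (A₀ A : Fin n → ℕ → ZMod p) (r k j : ℕ) : Prop where
  solCount_eq : solCount A = p ^ r * solCount A₀
  before : ∀ i, ∀ k' < k, A i k' = 0
  current : ∀ i : Fin n, (i : ℕ) < j → A i k = 0
  rank_le : r ≤ n * k + j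

/-- A pivot clears its entire column, including its own row, and preserves earlier zero columns. The
bound in `rank_le` merely counts visited entries, which is enough for the running time. -/
theorem IsEliminated.pivot [Fact p.Prime] {A₀ A : Fin n → ℕ → ZMod p} {r k : ℕ} {j : Fin n}
    (h : IsEliminated A₀ A r k j) (hk : k < n) (hA : A j k ≠ 0) :
    IsEliminated A₀ (pivot A j k) (r + 1) k (j + 1) where
  solCount_eq := by
    have := solCount_pivot A j ⟨k, hk⟩ hA
    simp only at this
    rw [this, h.solCount_eq]
    ring
  before i k' hk' := by simp [QuopitClifford.pivot, h.before i k' hk', h.before j k' hk']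
  current i _ := by
    rw [QuopitClifford.pivot]
    ring
  rank_le := by
    have := h.rank_le
    omega

theorem IsEliminated.skip [NeZero p] {A₀ A : Fin n → ℕ → ZMod p} {r k : ℕ} {j : Fin n}
    (h : IsEliminated A₀ A r k j) (hA : A j k = 0) : IsEliminated A₀ A r k (j + 1) where
  solCount_eq := h.solCount_eq
  before := h.before
  current i hi := by
    rcases Nat.lt_succ_iff_lt_or_eq.1 hi with hi | hi
    · exact h.current i hi
    · rw [Fin.ext hi, hA]
  rank_le := h.rank_le.trans (by omega)

theorem IsEliminated.next [NeZero p] {A₀ A : Fin n → ℕ → ZMod p} {r k : ℕ}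
    (h : IsEliminated A₀ A r k n) : IsEliminated A₀ A r (k + 1) 0 where
  solCount_eq := h.solCount_eq
  before i k' hk' := by
    rcases Nat.lt_succ_iff_lt_or_eq.1 hk' with hk' | rfl
    · exact h.before i k' hk'
    · exact h.current i i.2
  current i hi := absurd hi (Nat.not_lt_zero _)
  rank_le := h.rank_le.trans (by rw [Nat.mul_add]; omega)

end Elimination

/-! ### The program for the elimination -/

section EliminationProgram

variable {p n : ℕ}

theorem address_inj {i i' : Fin n} {k k' : ℕ} (h : (i : ℕ) + n * k = i' + n * k') :
    i = i' ∧ k = k' := by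
  have hn : 0 < n := i.pos
  have h1 := congrArg (· % n) h
  have h2 := congrArg (· / n) h
  simp only [Nat.add_mul_mod_self_left, Nat.mod_eq_of_lt i.2, Nat.mod_eq_of_lt i'.2] at h1
  simp only [Nat.add_mul_div_left _ _ hn, Nat.div_eq_of_lt i.2, Nat.div_eq_of_lt i'.2,
    Nat.zero_add] at h2
  exact ⟨Fin.ext h1, h2⟩

theorem RepMat.update {f : ℕ → ℕ} {A A' : Fin n → ℕ → ZMod p} {K k : ℕ} (h : RepMat f A K)
    (i : Fin n) (h1 : ∀ i' k', (i' ≠ i ∨ k' ≠ k) → A' i' k' = A i' k') :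
    RepMat (Function.update f (i + n * k) (A' i k).val) A' K := by
  intro i' k' hk'
  by_cases h2 : i' = i ∧ k' = k
  · rw [h2.1, h2.2, Function.update_self]
  · rw [Function.update_of_ne fun h3 => h2 (address_inj h3), h i' k' hk', h1]
    by_contra! h3
    exact h2 h3

theorem RepMat.congr {f : ℕ → ℕ} {A A' : Fin n → ℕ → ZMod p} {K : ℕ} (h : RepMat f A K)
    (h1 : ∀ i, ∀ k < K, A' i k = A i k) : RepMat f A' K := fun i k hk => by
  rw [h i k hk, h1 i k hk]

/-- The subtraction of the outcome from the constant column, whose address is in bank `8`. -/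
def outcomeProg : Program :=
  forLoop 9 4
    (.seq (assign 25 (.add (.load 0 (.add (.add (var 6) (var 4)) (var 9))) (var 8)))
    (.seq (assign 24 (.add (.load 22 (var 25))
      (.sub (var 3) (.load 0 (.add (.add (var 6) (.add (var 4) (var 4))) (var 9))))))
    (.seq (reduce 24) (.store 22 (var 25) (var 24)))))

/-- The loop runs over measurements rather than registers: the outcome `y j` is subtracted in row `e
j`, and injectivity of `e` ensures that each row is corrected once. -/
theorem halts_outcomeProg [NeZero p] (A : Fin n → ℕ → ZMod p) (e : Fin n ≃ Fin n)
    (y : Fin n → ZMod p) (m : Memory) (hp : m 3 0 = p) (hn : m 4 0 = n) (hoff : m 8 0 = n * n)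
    (he : ∀ j : Fin n, m 0 (m 6 0 + n + j) = e j)
    (hy : ∀ j : Fin n, m 0 (m 6 0 + (n + n) + j) = (y j).val) (hA : RepMat (m 22) A (n + 1)) :
    Halts outcomeProg m (n * 112 + 9) fun m' =>
      RepMat (m' 22) (fun i k => if k = n then A i k - y (e.symm i) else A i k) (n + 1) ∧
      Agree [9, 22, 24, 25] m m' := by
  refine (Halts.forLoop (n := n) (T := 100) (by decide) (fun j m' =>
    RepMat (m' 22) (fun i k => if k = n ∧ (e.symm i : ℕ) < j then A i k - y (e.symm i) else A i k)
      (n + 1) ∧ Agree [9, 22, 24, 25] m m') ?_ ?_ m ?_ hn).mono le_rfl ?_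
  · rintro j m' v ⟨h1, h2⟩
    exact ⟨by simpa [setCell_apply] using h1, h2.setCell _ _ _⟩
  · rintro j m' hj ⟨h1, h2⟩ h3 h4
    have e0 : m' 0 = m 0 := h2 0 (by decide)
    have e3 : m' 3 = m 3 := h2 3 (by decide)
    have e4 : m' 4 = m 4 := h2 4 (by decide)
    have e6 : m' 6 = m 6 := h2 6 (by decide)
    have e8 : m' 8 = m 8 := h2 8 (by decide)
    have hej := he ⟨j, hj⟩
    have hyj := hy ⟨j, hj⟩
    have hAj := h1 (e ⟨j, hj⟩) n (Nat.lt_succ_self n)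
    simp only [Equiv.symm_apply_apply, lt_irrefl, and_false, if_false] at hej hyj hAj
    refine (Halts.of_run (by rfl) (Q := fun m'' => m'' = setCell (setCell (setCell (setCell m' 25 0
      (e ⟨j, hj⟩ + n * n)) 24 0 ((A (e ⟨j, hj⟩) n).val + (p - (y ⟨j, hj⟩).val))) 24 0
        (A (e ⟨j, hj⟩) n - y ⟨j, hj⟩).val) 22 (e ⟨j, hj⟩ + n * n)
        (A (e ⟨j, hj⟩) n - y ⟨j, hj⟩).val) ?_).mono (by decide) ?_
    · simp only [Program.run, run_reduce, assign, Expr.eval, var, setCell_apply, if_true, if_false,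
        Nat.reduceEqDiff, Function.update_self, e0, e3, e4, e6, e8, h3, hp, hn, hoff, hej, hyj, hAj,
        reduceOnce_val_sub]
    · rintro m'' rfl
      refine ⟨⟨?_, (((h2.setCell _ _ _).setCell _ _ _).setCell _ _ _).setCell _ _ _⟩,
        by simp [setCell_apply, h3], by simp [setCell_apply, h4]⟩
      have := h1.update (k := n) (A' := fun i k =>
        if k = n ∧ (e.symm i : ℕ) < j + 1 then A i k - y (e.symm i) else A i k) (e ⟨j, hj⟩) ?_
      · simpa [setCell_apply] using this
      · intro i' k' h5
        by_cases hk : k' = n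
        · have h6 : (e.symm i' : ℕ) ≠ j := by
            intro h7
            rcases h5 with h5 | h5
            · apply h5
              rw [← e.symm_apply_eq.1 (Fin.ext h7 : e.symm i' = ⟨j, hj⟩)]
            · exact h5 hk
          have h7 : ((e.symm i' : ℕ) < j + 1) ↔ ((e.symm i' : ℕ) < j) := by omega
          simp only [h7]
        · simp [hk]
  · exact ⟨hA.congr fun i k _ => by simp, Agree.refl _ _⟩
  · rintro m' ⟨h1, h2⟩
    refine ⟨h1.congr fun i k _ => ?_, h2⟩
    simp

/-- The elimination in one entry: the row is in bank `10`, the address of the column in bank `17`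
and its number in bank `12`, the pivot row in bank `23`, the column of the pivot in bank `7`, and
the entry of that column in bank `18`. -/
def entryProg : Program :=
  .seq (.seq (assign 13 (.load 23 (var 7))) (assign 14 (.load 22 (.add (var 10) (var 17)))))
    (.seq mulMod
    (.seq (.seq (assign 24 (var 15))
      (.seq (assign 13 (.load 23 (var 12))) (assign 14 (.sub (var 3) (var 18)))))
    (.seq mulMod
      (.seq (assign 24 (.add (var 24) (var 15)))
      (.seq (reduce 24)
      (.seq (.store 22 (.add (var 10) (var 17)) (var 24))
        (assign 17 (.add (var 17) (var 4)))))))))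

theorem halts_entryProg [NeZero p] (m : Memory) (i off k l : ℕ) (t u w c : ZMod p)
    (hp : m 3 0 = p) (hn : m 4 0 = n) (hk : m 7 0 = k) (hl : m 12 0 = l) (hi : m 10 0 = i)
    (hoff : m 17 0 = off) (ht : m 23 k = t.val) (hu : m 22 (i + off) = u.val)
    (hw : m 23 l = w.val) (hc : m 18 0 = c.val) :
    Halts entryProg m (p.size * 200 + 400) fun m' =>
      m' 22 = Function.update (m 22) (i + off) (t * u + w * -c).val ∧ m' 17 0 = off + n ∧
      Agree [13, 14, 15, 17, 22, 24] m m' := by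
  have hp0 : 0 < p := NeZero.pos p
  refine Halts.mono (Halts.seq (T := 30) (T' := p.size * 200 + 370) (Halts.mono
    (Halts.of_run (by rfl) (Q := fun m' => m' = setCell (setCell m 13 0 t.val) 14 0 u.val) ?_)
    (by decide) ?_)) (by omega) fun _ h => h
  · simp [Program.run, assign, Expr.eval, var, setCell_apply, hk, hi, hoff, ht, hu]
  rintro m₁ rfl
  refine Halts.mono (Halts.seq (T := p.size * 100 + 100) (T' := p.size * 100 + 270) (Halts.mono
    (halts_mulMod _ p.size ?_ ?_) le_rfl ?_)) (by omega) fun _ h => h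
  · simpa [setCell_apply] using Nat.size_le_size (ZMod.val_lt u).le
  · right
    simpa [setCell_apply, hp] using ZMod.val_lt t
  rintro m₂ ⟨h1, h2, h3⟩
  simp only [setCell_apply, if_true, if_false, Nat.reduceEqDiff, Function.update_self, hp]
    at h1 h2 h3
  have h15 : m₂ 15 0 = (t * u).val := by
    refine eq_val_of_modEq (h2.resolve_left hp0.ne') ?_
    rw [(ZMod.natCast_eq_natCast_iff _ _ _).2 h1]
    simp
  have hag : Agree [13, 14, 15, 17, 22, 24] m m₂ := by
    intro k' hk'
    simp only [List.mem_cons, not_or] at hk'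
    rw [h3 k' hk'.1 hk'.2.1 hk'.2.2.1, if_neg hk'.2.1, if_neg hk'.1]
  have hm₂ : ∀ k', k' ≠ 13 → k' ≠ 14 → k' ≠ 15 → m₂ k' = m k' := fun k' h4 h5 h6 => by
    rw [h3 k' h4 h5 h6, if_neg h5, if_neg h4]
  refine Halts.mono (Halts.seq (T := 30) (T' := p.size * 100 + 240) (Halts.mono
    (Halts.of_run (by rfl) (Q := fun m' => m' = setCell (setCell (setCell m₂ 24 0 (t * u).val)
      13 0 w.val) 14 0 (p - c.val)) ?_) (by decide) ?_)) (by omega) fun _ h => h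
  · have e23 := hm₂ 23 (by decide) (by decide) (by decide)
    have e12 := hm₂ 12 (by decide) (by decide) (by decide)
    have e3 := hm₂ 3 (by decide) (by decide) (by decide)
    have e18 := hm₂ 18 (by decide) (by decide) (by decide)
    simp [Program.run, assign, Expr.eval, var, setCell_apply, h15, e23, e12, e3, e18, hl, hw, hc,
      hp]
  rintro m₃ rfl
  have e3 := hm₂ 3 (by decide) (by decide) (by decide)
  refine Halts.mono (Halts.seq (T := p.size * 100 + 100) (T' := 100) (Halts.mono
    (halts_mulMod _ p.size ?_ ?_) le_rfl ?_)) (by omega) fun _ h => h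
  -- The multiplier `p - c` is left unreduced and equals `p` for `c = 0`; `mulMod` bounds only the
  -- bit length of its second factor.
  · simpa [setCell_apply] using Nat.size_le_size (Nat.sub_le p c.val)
  · right
    simpa [setCell_apply, e3, hp] using ZMod.val_lt w
  rintro m₄ ⟨h4, h5, h6⟩
  simp only [setCell_apply, if_true, if_false, Nat.reduceEqDiff, Function.update_self, e3, hp]
    at h4 h5 h6
  have h15' : m₄ 15 0 = (w * -c).val := by
    refine eq_val_of_modEq (h5.resolve_left hp0.ne') ?_
    rw [(ZMod.natCast_eq_natCast_iff _ _ _).2 h4, Nat.cast_mul, natCast_sub_val]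
    simp
  have h24 : m₄ 24 0 = (t * u).val := by
    rw [h6 24 (by decide) (by decide) (by decide)]
    simp
  have hm₄ : ∀ k', k' ≠ 13 → k' ≠ 14 → k' ≠ 15 → k' ≠ 24 → m₄ k' = m k' := fun k' g1 g2 g3 g4 => by
    rw [h6 k' g1 g2 g3, if_neg g2, if_neg g1, if_neg g4, hm₂ k' g1 g2 g3]
  have hag' : Agree [13, 14, 15, 17, 22, 24] m m₄ := by
    intro k' hk'
    simp only [List.mem_cons, not_or] at hk'
    exact hm₄ k' hk'.1 hk'.2.1 hk'.2.2.1 hk'.2.2.2.2.2.1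
  have f22 := hm₄ 22 (by decide) (by decide) (by decide) (by decide)
  have f10 := hm₄ 10 (by decide) (by decide) (by decide) (by decide)
  have f17 := hm₄ 17 (by decide) (by decide) (by decide) (by decide)
  have f3 := hm₄ 3 (by decide) (by decide) (by decide) (by decide)
  have f4 := hm₄ 4 (by decide) (by decide) (by decide) (by decide)
  refine (Halts.of_run (by rfl) (Q := fun m' => m' = setCell (setCell (setCell (setCell m₄ 24 0
    ((t * u).val + (w * -c).val)) 24 0 (t * u + w * -c).val) 22 (i + off) (t * u + w * -c).val) 17 0
      (off + n)) ?_).mono (by decide) ?_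
  · simp only [Program.run, run_reduce, assign, Expr.eval, var, setCell_apply, if_true, if_false,
      Nat.reduceEqDiff, Function.update_self, h24, h15', f10, f17, f3, f4, hi, hoff, hn, hp,
      reduceOnce_val_add]
  · rintro m₅ rfl
    refine ⟨by simp [setCell_apply, f22], by simp [setCell_apply],
      (((hag'.setCell _ _ _).setCell _ _ _).setCell _ _ _).setCell _ _ _⟩

/-- The elimination in the row in bank `10`. -/
def rowProg : Program :=
  .seq (.seq (assign 18 (.load 22 (.add (var 10) (var 8)))) (assign 17 (.lit 0)))
    (forLoop 12 5 entryProg)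

/-- The entry `A i k` is needed for the whole row but is overwritten when the loop reaches column
`k`, hence the copy in bank `18`. -/
theorem halts_rowProg [NeZero p] (A : Fin n → ℕ → ZMod p) (t : ℕ → ZMod p) (m : Memory) (i : Fin n)
    (k : ℕ) (hkn : k < n) (hp : m 3 0 = p) (hn : m 4 0 = n) (hn' : m 5 0 = n + 1) (hk : m 7 0 = k)
    (hi : m 10 0 = i) (hoff : m 8 0 = n * k) (ht : ∀ l ≤ n, m 23 l = (t l).val)
    (hA : RepMat (m 22) A (n + 1)) :
    Halts rowProg m ((n + 1) * (p.size * 200 + 412) + 50) fun m' =>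
      RepMat (m' 22) (fun i' l => if i' = i then t k * A i' l + t l * -A i' k else A i' l)
        (n + 1) ∧
      Agree [12, 13, 14, 15, 17, 18, 22, 24] m m' := by
  refine Halts.mono (Halts.seq (T := 30) (T' := (n + 1) * (p.size * 200 + 412) + 9) (Halts.mono
    (Halts.of_run (by rfl) (Q := fun m' => m' = setCell (setCell m 18 0 (A i k).val) 17 0 0) ?_)
    (by decide) ?_)) (by omega) fun _ h => h
  · simp [Program.run, assign, Expr.eval, var, hi, hoff, hA i k (by omega)]
  rintro m₁ rfl
  refine (Halts.forLoop (n := n + 1) (T := p.size * 200 + 400) (by decide) (fun l m' =>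
    RepMat (m' 22) (fun i' l' => if i' = i ∧ l' < l then t k * A i' l' + t l' * -A i' k
      else A i' l') (n + 1) ∧ m' 17 0 = n * l ∧ m' 18 0 = (A i k).val ∧
      Agree [12, 13, 14, 15, 17, 18, 22, 24] m m') ?_ ?_ _ ?_ ?_).mono le_rfl ?_
  · rintro j m' v ⟨h1, h2, h3, h4⟩
    exact ⟨by simpa [setCell_apply] using h1, by simpa [setCell_apply] using h2,
      by simpa [setCell_apply] using h3, h4.setCell _ _ _⟩
  · rintro l m' hl ⟨h1, h2, h3, h4⟩ h5 h6
    have e3 : m' 3 = m 3 := h4 3 (by decide)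
    have e4 : m' 4 = m 4 := h4 4 (by decide)
    have e7 : m' 7 = m 7 := h4 7 (by decide)
    have e10 : m' 10 = m 10 := h4 10 (by decide)
    have e23 : m' 23 = m 23 := h4 23 (by decide)
    have hu := h1 i l hl
    simp only [lt_irrefl, and_false, if_false] at hu
    refine (halts_entryProg m' i (n * l) k l (t k) (A i l) (t l) (A i k) (by rw [e3, hp])
      (by rw [e4, hn]) (by rw [e7, hk]) h5 (by rw [e10, hi]) h2 (by rw [e23, ht k hkn.le]) hu
      (by rw [e23, ht l (by omega)]) h3).mono le_rfl ?_
    rintro m'' ⟨h7, h8, h9⟩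
    refine ⟨⟨?_, ?_, ?_, h4.trans h9⟩, ?_, ?_⟩
    · rw [h7]
      have := h1.update (k := l) (A' := fun i' l' => if i' = i ∧ l' < l + 1 then
        t k * A i' l' + t l' * -A i' k else A i' l') i ?_
      · simpa using this
      · intro i' k' h10
        have h11 : (i' = i ∧ k' < l + 1) ↔ (i' = i ∧ k' < l) := by
          refine and_congr_right fun h12 => ?_
          have : k' ≠ l := h10.resolve_left (not_not.2 h12)
          omega
        simp only [h11]
    · rw [h8]
      ring
    · rw [h9 18 (by decide), h3]
    · rw [h9 12 (by decide), h5]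
    · rw [h9 5 (by decide), h6]
  · refine ⟨?_, by simp [setCell_apply], by simp [setCell_apply],
      ((Agree.refl _ _).setCell _ _ _).setCell _ _ _⟩
    simpa [setCell_apply] using hA
  · simp [setCell_apply, hn']
  · rintro m' ⟨h1, _, _, h4⟩
    refine ⟨h1.congr fun i' l hl => ?_, h4⟩
    simp [hl]

/-- The elimination with the row in bank `9` of the variable in bank `7`. -/
def pivotProg : Program :=
  .seq (assign 17 (.lit 0))
    (.seq (forLoop 12 5 (.seq (.store 23 (var 12) (.load 22 (.add (var 9) (var 17))))
      (assign 17 (.add (var 17) (var 4)))))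
    (.seq (forLoop 10 4 rowProg) (assign 19 (.add (var 19) (.lit 1)))))

/-- A bound for the cost of `pivotProg`. -/
def pivotCost (n s : ℕ) : ℕ :=
  (n + 1) * 42 + n * ((n + 1) * (s * 200 + 412) + 62) + 50

/-- The pivot row is copied to bank `23` because the loop over all rows turns it into zero while
later rows still need it. -/
theorem halts_pivotProg [NeZero p] (A : Fin n → ℕ → ZMod p) (m : Memory) (j : Fin n)
    (k : ℕ) (hkn : k < n) (hp : m 3 0 = p) (hn : m 4 0 = n) (hn' : m 5 0 = n + 1) (hk : m 7 0 = k)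
    (hj : m 9 0 = j) (hoff : m 8 0 = n * k) (hA : RepMat (m 22) A (n + 1)) :
    Halts pivotProg m (pivotCost n p.size) fun m' =>
      RepMat (m' 22) (pivot A j k) (n + 1) ∧ m' 19 0 = m 19 0 + 1 ∧
      Agree [10, 12, 13, 14, 15, 17, 18, 19, 22, 23, 24] m m' := by
  rw [pivotCost]
  refine Halts.mono (Halts.seq (T := 10)
    (T' := (n + 1) * 42 + n * ((n + 1) * (p.size * 200 + 412) + 62) + 30) (Halts.mono
    (Halts.of_run (by rfl) (Q := fun m' => m' = setCell m 17 0 0) ?_)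
    (by decide) ?_)) (by omega) fun _ h => h
  · simp [Program.run, assign, Expr.eval]
  rintro m₁ rfl
  refine Halts.mono (Halts.seq (T := (n + 1) * 42 + 9)
    (T' := n * ((n + 1) * (p.size * 200 + 412) + 62) + 20) (Halts.mono (Halts.forLoop (n := n + 1)
    (T := 30) (by decide) (fun l m' => (∀ l' < l, m' 23 l' = (A j l').val) ∧ m' 17 0 = n * l ∧
      Agree [12, 17, 23] m m') ?_ ?_ _ ?_ ?_) le_rfl ?_)) (by omega) fun _ h => h
  · rintro l m' v ⟨h1, h2, h3⟩
    exact ⟨by simpa [setCell_apply] using h1, by simpa [setCell_apply] using h2, h3.setCell _ _ _⟩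
  · rintro l m' hl ⟨h1, h2, h3⟩ h4 h5
    have e9 : m' 9 = m 9 := h3 9 (by decide)
    have e4 : m' 4 = m 4 := h3 4 (by decide)
    have e22 : m' 22 = m 22 := h3 22 (by decide)
    refine (Halts.of_run (by rfl) (Q := fun m'' => m'' = setCell (setCell m' 23 l (A j l).val) 17 0
      (n * l + n)) ?_).mono (by decide) ?_
    · simp [Program.run, assign, Expr.eval, var, setCell_apply, h4, h2, e9, e4, e22, hj, hn,
        hA j l hl]
    · rintro m'' rfl
      refine ⟨⟨fun l' hl' => ?_, ?_, (h3.setCell _ _ _).setCell _ _ _⟩, by simp [setCell_apply, h4],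
        by simp [setCell_apply, h5]⟩
      · by_cases h6 : l' = l
        · subst h6
          simp [setCell_apply]
        · simpa [setCell_apply, h6] using h1 l' (by omega)
      · simp [setCell_apply]
        ring
  · exact ⟨fun l hl => absurd hl (Nat.not_lt_zero _), by simp [setCell_apply],
      (Agree.refl _ _).setCell _ _ _⟩
  · simp [setCell_apply, hn']
  rintro m₂ ⟨h1, _, h2⟩
  have e4 : m₂ 4 = m 4 := h2 4 (by decide)
  have e22 : m₂ 22 = m 22 := h2 22 (by decide)
  refine Halts.mono (Halts.seq (T := n * ((n + 1) * (p.size * 200 + 412) + 62) + 9)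
    (T' := 10) (Halts.mono (Halts.forLoop (n := n)
    (T := (n + 1) * (p.size * 200 + 412) + 50) (by decide) (fun i m' =>
      RepMat (m' 22) (fun i' l => if (i' : ℕ) < i then pivot A j k i' l else A i' l) (n + 1) ∧
      Agree [10, 12, 13, 14, 15, 17, 18, 22, 24] m₂ m') ?_ ?_ _ ?_ ?_) le_rfl ?_)) (by omega)
      fun _ h => h
  · rintro i m' v ⟨h3, h4⟩
    exact ⟨by simpa [setCell_apply] using h3, h4.setCell _ _ _⟩
  · rintro i m' hi ⟨h3, h4⟩ h5 h6
    have h7 : Agree [10, 12, 13, 14, 15, 17, 18, 22, 23, 24] m m' := h2.trans h4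
    have e23 : m' 23 = m₂ 23 := h4 23 (by decide)
    refine (halts_rowProg (fun i' l => if (i' : ℕ) < i then pivot A j k i' l else A i' l)
      (fun l => A j l) m' ⟨i, hi⟩ k hkn (by rw [h7 3 (by decide), hp]) h6
      (by rw [h7 5 (by decide), hn']) (by rw [h7 7 (by decide), hk]) h5
      (by rw [h7 8 (by decide), hoff]) (fun l hl => by rw [e23, h1 l (by omega)]) h3).mono le_rfl ?_
    rintro m'' ⟨h8, h9⟩
    refine ⟨⟨h8.congr fun i' l _ => ?_, h4.trans h9⟩, by rw [h9 10 (by decide), h5],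
      by rw [h9 4 (by decide), h6]⟩
    by_cases h10 : i' = ⟨i, hi⟩
    · subst h10
      simp [pivot]
    · have h11 : (i' : ℕ) ≠ i := fun h => h10 (Fin.ext h)
      have h12 : (i' : ℕ) < i + 1 ↔ (i' : ℕ) < i := by omega
      simp only [h10, h12, if_false]
  · refine ⟨?_, Agree.refl _ _⟩
    rw [e22]
    exact hA.congr fun i l _ => by simp
  · rw [e4, hn]
  rintro m₃ ⟨h3, h4⟩
  have h5 : Agree [10, 12, 13, 14, 15, 17, 18, 22, 23, 24] m m₃ := h2.trans h4
  have e19 : m₃ 19 = m 19 := h5 19 (by decide)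
  refine (Halts.of_run (by rfl) (Q := fun m' => m' = setCell m₃ 19 0 (m 19 0 + 1)) ?_).mono
    (by decide) ?_
  · simp [Program.run, assign, Expr.eval, var, e19]
  · rintro m₄ rfl
    refine ⟨?_, by simp [setCell_apply], (h5.trans (Agree.refl [] _)).setCell _ _ _⟩
    have : RepMat (m₃ 22) (pivot A j k) (n + 1) := h3.congr fun i l _ => by simp
    simpa [setCell_apply] using this

/-- The elimination of the variable in bank `7`, the address of whose column is in bank `8`. -/
def columnElimProg : Program :=
  forLoop 9 4 (.branch (.load 22 (.add (var 9) (var 8))) pivotProg .skip)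

theorem halts_columnElimProg [Fact p.Prime] (A₀ A : Fin n → ℕ → ZMod p) (m : Memory)
    (k : ℕ) (hkn : k < n) (hp : m 3 0 = p) (hn : m 4 0 = n) (hn' : m 5 0 = n + 1) (hk : m 7 0 = k)
    (hoff : m 8 0 = n * k) (hA : RepMat (m 22) A (n + 1)) (hE : IsEliminated A₀ A (m 19 0) k 0) :
    Halts columnElimProg m (n * (pivotCost n p.size + 22) + 9) fun m' =>
      (∃ A', RepMat (m' 22) A' (n + 1) ∧ IsEliminated A₀ A' (m' 19 0) (k + 1) 0) ∧
      Agree [9, 10, 12, 13, 14, 15, 17, 18, 19, 22, 23, 24] m m' := by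
  refine (Halts.forLoop (n := n) (T := pivotCost n p.size + 10) (by decide) (fun j m' =>
    (∃ A', RepMat (m' 22) A' (n + 1) ∧ IsEliminated A₀ A' (m' 19 0) k j) ∧
      Agree [9, 10, 12, 13, 14, 15, 17, 18, 19, 22, 23, 24] m m') ?_ ?_ _ ?_ hn).mono le_rfl ?_
  · rintro j m' v ⟨⟨A', h1, h2⟩, h3⟩
    exact ⟨⟨A', by simpa [setCell_apply] using h1, by simpa [setCell_apply] using h2⟩,
      h3.setCell _ _ _⟩
  · rintro j m' hj ⟨⟨A', h1, h2⟩, h3⟩ h4 h5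
    have e8 : m' 8 = m 8 := h3 8 (by decide)
    have he : (Expr.load 22 (.add (var 9) (var 8))).eval m' = (A' ⟨j, hj⟩ k).val := by
      simp only [Expr.eval, var, h4, e8, hoff]
      exact h1 ⟨j, hj⟩ k (by omega)
    refine (Halts.branch (T := pivotCost n p.size) (fun h6 => ?_) fun h6 => ?_).mono ?_ fun _ h => h
    · rw [he, ne_eq, ZMod.val_eq_zero] at h6
      refine (halts_pivotProg A' m' ⟨j, hj⟩ k hkn (by rw [h3 3 (by decide), hp]) h5
        (by rw [h3 5 (by decide), hn']) (by rw [h3 7 (by decide), hk]) h4 (by rw [e8, hoff])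
        h1).mono le_rfl ?_
      rintro m'' ⟨h7, h8, h9⟩
      refine ⟨⟨⟨_, h7, ?_⟩, h3.trans h9⟩, by rw [h9 9 (by decide), h4],
        by rw [h9 4 (by decide), h5]⟩
      rw [h8]
      exact IsEliminated.pivot (j := ⟨j, hj⟩) h2 hkn h6
    · rw [he, ZMod.val_eq_zero] at h6
      refine ⟨1, m', .skip m', by rw [pivotCost]; omega, ⟨⟨A', h1, ?_⟩, h3⟩, h4, h5⟩
      exact IsEliminated.skip (j := ⟨j, hj⟩) h2 h6
    · simp only [Expr.cost, var]
      omega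
  · exact ⟨⟨A, hA, hE⟩, Agree.refl _ _⟩
  · rintro m' ⟨⟨A', h1, h2⟩, h3⟩
    exact ⟨⟨A', h1, h2.next⟩, h3⟩

/-- The elimination of all variables; the number of pivots appears in bank `19`. -/
def elimProg : Program :=
  .seq (.seq (assign 19 (.lit 0)) (assign 8 (.lit 0)))
    (forLoop 7 4 (.seq columnElimProg (assign 8 (.add (var 8) (var 4)))))

theorem halts_elimProg [Fact p.Prime] (A : Fin n → ℕ → ZMod p) (m : Memory)
    (hp : m 3 0 = p) (hn : m 4 0 = n) (hn' : m 5 0 = n + 1) (hA : RepMat (m 22) A (n + 1)) :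
    Halts elimProg m (n * (n * (pivotCost n p.size + 22) + 41) + 29) fun m' =>
      (∃ A', RepMat (m' 22) A' (n + 1) ∧ IsEliminated A A' (m' 19 0) n 0) ∧ m' 8 0 = n * n ∧
      Agree [7, 8, 9, 10, 12, 13, 14, 15, 17, 18, 19, 22, 23, 24] m m' := by
  refine Halts.mono (Halts.seq (T := 20) (T' := n * (n * (pivotCost n p.size + 22) + 41) + 9)
    (Halts.mono (Halts.of_run (by rfl) (Q := fun m' => m' = setCell (setCell m 19 0 0) 8 0 0) ?_)
    (by decide) ?_)) (by omega) fun _ h => h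
  · simp [Program.run, assign, Expr.eval]
  rintro m₁ rfl
  refine (Halts.forLoop (n := n) (T := n * (pivotCost n p.size + 22) + 29) (by decide) (fun k m' =>
    (∃ A', RepMat (m' 22) A' (n + 1) ∧ IsEliminated A A' (m' 19 0) k 0) ∧ m' 8 0 = n * k ∧
      Agree [7, 8, 9, 10, 12, 13, 14, 15, 17, 18, 19, 22, 23, 24] m m') ?_ ?_ _ ?_ ?_).mono le_rfl
      fun _ h => h
  · rintro k m' v ⟨⟨A', h1, h2⟩, h3, h4⟩
    exact ⟨⟨A', by simpa [setCell_apply] using h1, by simpa [setCell_apply] using h2⟩,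
      by simpa [setCell_apply] using h3, h4.setCell _ _ _⟩
  · rintro k m' hk ⟨⟨A', h1, h2⟩, h3, h4⟩ h5 h6
    refine Halts.mono (Halts.seq (T := n * (pivotCost n p.size + 22) + 9) (T' := 20)
      ((halts_columnElimProg A A' m' k hk (by rw [h4 3 (by decide), hp]) h6
        (by rw [h4 5 (by decide), hn']) h5 h3 h1 h2).mono le_rfl ?_)) (by omega) fun _ h => h
    rintro m₂ ⟨⟨A'', h7, h8⟩, h9⟩
    have e8 : m₂ 8 = m' 8 := h9 8 (by decide)
    have e4 : m₂ 4 = m' 4 := h9 4 (by decide)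
    have e7 : m₂ 7 = m' 7 := h9 7 (by decide)
    refine (Halts.of_run (by rfl) (Q := fun m'' => m'' = setCell m₂ 8 0 (n * k + n)) ?_).mono
      (by decide) ?_
    · simp [Program.run, assign, Expr.eval, var, e8, e4, h3, h6]
    · rintro m'' rfl
      refine ⟨⟨⟨A'', by simpa [setCell_apply] using h7, by simpa [setCell_apply] using h8⟩, ?_,
        (h4.trans h9).setCell _ _ _⟩, by simp [setCell_apply, e7, h5],
        by simp [setCell_apply, e4, h6]⟩
      simp [setCell_apply]
      ring
  · refine ⟨⟨A, by simpa [setCell_apply] using hA, ?_⟩, by simp [setCell_apply],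
      ((Agree.refl _ _).setCell _ _ _).setCell _ _ _⟩
    constructor
    · simp [setCell_apply]
    · intro i k hk
      omega
    · intro i hi
      omega
    · simp [setCell_apply]
  · simp [setCell_apply, hn]

end EliminationProgram

/-! ### The description of the input -/

section Input

variable {p n m : ℕ}

theorem getD_append_ofFn (l₁ l₂ : List ℕ) {k : ℕ} (f : Fin k → ℕ) (j : Fin k) {q : ℕ}
    (hq : q = l₁.length) : (l₁ ++ List.ofFn f ++ l₂).getD (q + j) 0 = f j := by
  subst hq
  rw [List.append_assoc, List.getD_append_right _ _ _ _ (Nat.le_add_right _ _),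
    Nat.add_sub_cancel_left, List.getD_append _ _ _ _ (by simp)]
  simp

theorem Gate.length_encode (g : Gate n) : g.encode.length = 3 := by
  cases g <;> rfl

theorem length_flatMap_encode (C : Circuit n) :
    (C.flatMap Gate.encode).length = 3 * C.length := by
  induction C with
  | nil => rfl
  | cons g C ih =>
    rw [List.flatMap_cons, List.length_append, ih, g.length_encode, List.length_cons]
    ring

theorem encodesAt_append (l₁ l₂ : List ℕ) (C : Circuit n) :
    EncodesAt (fun i => (l₁ ++ C.flatMap Gate.encode ++ l₂).getD i 0) l₁.length C := by
  induction C generalizing l₁ with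
  | nil => trivial
  | cons g C ih =>
    obtain ⟨x, y, z, hg⟩ : ∃ x y z, g.encode = [x, y, z] := List.length_eq_three.1 g.length_encode
    refine ⟨?_, ?_⟩
    · simp [List.flatMap_cons, hg]
    · have := ih (l₁ ++ g.encode)
      rw [List.length_append, g.length_encode] at this
      simpa only [List.flatMap_cons, List.append_assoc] using this

theorem initialMemory_encodeInput (C : Circuit n) (a : Fin n → ZMod p) (I : Fin m ↪ Fin n)
    (y : Fin m → ZMod p) (f : ℕ → ℕ) (hf : f = initialMemory (encodeInput p C a I y) 0) :
    f 0 = p ∧ f 1 = n ∧ f 2 = C.length ∧ EncodesAt f 4 C ∧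
      (∀ j : Fin n, f (4 + 3 * C.length + j) = (a j).val) ∧
      (∀ j : Fin m, f (4 + 3 * C.length + n + j) = I j) ∧
      ∀ j : Fin m, f (4 + 3 * C.length + (n + m) + j) = (y j).val := by
  have h : f = fun i => (encodeInput p C a I y).getD i 0 := hf
  rw [h]
  refine ⟨rfl, rfl, rfl, ?_, fun j => ?_, fun j => ?_, fun j => ?_⟩
  · have := encodesAt_append [p, n, C.length, m] (List.ofFn (fun j => (a j).val) ++
      (List.ofFn (fun k => (I k : ℕ)) ++ List.ofFn (fun k => (y k).val))) C
    simp only [encodeInput, List.append_assoc] at this ⊢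
    exact this
  · have := getD_append_ofFn ([p, n, C.length, m] ++ C.flatMap Gate.encode)
      (List.ofFn (fun k => (I k : ℕ)) ++ List.ofFn (fun k => (y k).val)) (fun j => (a j).val) j
      (q := 4 + 3 * C.length) (by simp [-List.length_flatMap, length_flatMap_encode]; ring)
    simpa only [encodeInput, List.append_assoc] using this
  · exact getD_append_ofFn _ _ (fun k => (I k : ℕ)) j
      (by simp [-List.length_flatMap, length_flatMap_encode]; ring)
  · have := getD_append_ofFn ([p, n, C.length, m] ++ C.flatMap Gate.encode ++
      List.ofFn (fun j => (a j).val) ++ List.ofFn (fun k => (I k : ℕ))) [] (fun j => (y j).val) j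
      (q := 4 + 3 * C.length + (n + m))
      (by simp [-List.length_flatMap, length_flatMap_encode]; ring)
    simpa only [encodeInput, List.append_nil] using this

theorem length_le_inputSize (l : List ℕ) : l.length ≤ inputSize l := by
  induction l with
  | nil => exact le_rfl
  | cons x l ih =>
    simp only [inputSize, List.map_cons, List.sum_cons, List.length_cons] at ih ⊢
    omega

theorem le_inputSize_encodeInput (C : Circuit n) (a : Fin n → ZMod p) (I : Fin m ↪ Fin n)
    (y : Fin m → ZMod p) :
    n ≤ inputSize (encodeInput p C a I y) ∧ C.length ≤ inputSize (encodeInput p C a I y) ∧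
      p.size ≤ inputSize (encodeInput p C a I y) := by
  have h1 := length_le_inputSize (encodeInput p C a I y)
  have h2 : (encodeInput p C a I y).length = 4 + 3 * C.length + n + m + m := by
    simp [-List.length_flatMap, encodeInput, length_flatMap_encode]
    ring
  refine ⟨by omega, by omega, ?_⟩
  simp only [encodeInput, List.cons_append, inputSize, List.map_cons, List.sum_cons]
  omega

end Input

/-! ### The outcome probability -/

section Probability

variable {p n : ℕ}

/-- The affine system of the momenta that lead from the position `a` to the position `b`. -/
noncomputable def outcomeMatrix (C : Circuit n) (a b : Fin n → ZMod p) (i : Fin n) (k : ℕ) :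
    ZMod p :=
  if k = n then positionMatrix C a i k - b i else positionMatrix C a i k

/-- The point `(a, z)` is `(a, 0)` plus the combination of the momentum unit vectors with
coefficients `z_k`, and the circuit is linear once `h` is counted as a coordinate. -/
theorem rowVal_outcomeMatrix (C : Circuit n) (a b : Fin n → ZMod p) (i : Fin n)
    (z : Fin n → ZMod p) :
    rowVal (outcomeMatrix C a b) i z = (circuitStep 2⁻¹ C (a, z)).1 i - b i := by
  have h1 : (a, z) = columnPoint a n + ∑ k : Fin n, z k • columnPoint a k := by
    ext j
    · simp [columnPoint, Prod.fst_sum]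
    · simp [columnPoint, Prod.snd_sum, j.2.ne, Fin.val_inj]
  have h2 : ∀ k : Fin n, outcomeMatrix C a b i k = (circuitStep 0 C (columnPoint a k)).1 i :=
    fun k => by simp [outcomeMatrix, positionMatrix, columnParam, k.2.ne]
  have h3 : outcomeMatrix C a b i n = (circuitStep 2⁻¹ C (columnPoint a n)).1 i - b i := by
    simp [outcomeMatrix, positionMatrix, columnParam]
  rw [h1, circuitStep_sum, rowVal, h3]
  simp only [h2, Prod.fst_add, Prod.fst_sum, Pi.add_apply, Finset.sum_apply, Prod.smul_fst,
    Pi.smul_apply, smul_eq_mul, mul_comm]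
  ring

/-- After elimination all linear parts vanish, so the system has `p^n` solutions or none; each pivot
had multiplied the count by `p`. -/
theorem norm_circuitOp_sq_of_isEliminated [Fact p.Prime] (hp : p ≠ 2) (C : Circuit n)
    (a b : Fin n → ZMod p) (A : Fin n → ℕ → ZMod p) (r : ℕ)
    (h : IsEliminated (outcomeMatrix C a b) A r n 0) :
    ‖circuitOp p C b a‖ ^ 2 = (if ∀ i, A i n = 0 then 1 else 0) / (p : ℝ) ^ r := by
  have hp0 : (p : ℝ) ≠ 0 := Nat.cast_ne_zero.2 (Fact.out : p.Prime).ne_zero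
  have h1 : solCount (outcomeMatrix C a b) = (Finset.univ.filter fun z : Fin n → ZMod p =>
      (circuitStep 2⁻¹ C (a, z)).1 = b).card := by
    rw [solCount]
    congr 1
    ext z
    simp only [rowVal_outcomeMatrix, sub_eq_zero, funext_iff]
  have h2 := norm_circuitOp_sq hp C a b
  have h3 := congrArg (Nat.cast (R := ℝ)) (h.solCount_eq.symm.trans (solCount_of_zero A h.before))
  rw [h1, Nat.cast_mul, ← h2] at h3
  rw [eq_div_iff (pow_ne_zero _ hp0)]
  apply mul_left_cancel₀ (pow_ne_zero n hp0)
  split_ifs at h3 ⊢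
  · push_cast at h3
    linear_combination h3
  · push_cast at h3
    linear_combination h3

/-- An injection of a finite set into itself is a bijection, so the outcomes determine `b`. -/
theorem outcomeProb_eq [NeZero p] (C : Circuit n) (a : Fin n → ZMod p) (I : Fin n ↪ Fin n)
    (y : Fin n → ZMod p) :
    outcomeProb p C a I y =
      ‖circuitOp p C (fun i => y (I.equivOfFiniteSelfEmbedding.symm i)) a‖ ^ 2 := by
  have h : (Finset.univ.filter fun b : Fin n → ZMod p => ∀ k, b (I k) = y k) =
      {fun i => y (I.equivOfFiniteSelfEmbedding.symm i)} := by
    ext b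
    simp only [Finset.mem_filter, Finset.mem_univ, true_and, Finset.mem_singleton, funext_iff]
    refine ⟨fun h i => ?_, fun h k => ?_⟩
    · rw [← h]
      congr 1
      exact (I.equivOfFiniteSelfEmbedding.apply_symm_apply i).symm
    · rw [h]
      congr 1
      exact I.equivOfFiniteSelfEmbedding.symm_apply_apply k
  rw [outcomeProb, h, Finset.sum_singleton]

end Probability

/-! ### The simulation -/

section Main

variable {p n : ℕ}

/-- The parameters of the computation, and the matrix of the positions. -/
def positionProg : Program :=
  .seq (.seq (assign 3 (.load 0 (.lit 0)))
    (.seq (assign 4 (.load 0 (.lit 1)))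
    (.seq (assign 5 (.add (var 4) (.lit 1)))
    (assign 6 (.add (.lit 4) (.add (.load 0 (.lit 2))
      (.add (.load 0 (.lit 2)) (.load 0 (.lit 2)))))))))
    (.seq (forLoop 7 5 columnProg) (assign 8 (.sub (var 8) (var 4))))

theorem halts_positionProg [Fact p.Prime] (hp2 : p ≠ 2) (C : Circuit n) (a : Fin n → ZMod p)
    (m : Memory) (hp : m 0 0 = p) (hn : m 0 1 = n) (hlen : m 0 2 = C.length)
    (hoff : m 8 0 = 0) (ha : ∀ j : Fin n, m 0 (4 + 3 * C.length + j) = (a j).val)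
    (hC : EncodesAt (m 0) 4 C) :
    Halts positionProg m ((n + 1) * (n * 100 + C.length * 300 + 112) + 89) fun m' =>
      RepMat (m' 22) (positionMatrix C a) (n + 1) ∧ m' 8 0 = n * n ∧ m' 3 0 = p ∧ m' 4 0 = n ∧
      m' 5 0 = n + 1 ∧ m' 6 0 = 4 + 3 * C.length ∧ m' 0 = m 0 := by
  refine Halts.mono (Halts.seq (T := 60)
    (T' := (n + 1) * (n * 100 + C.length * 300 + 112) + 29)
    (Halts.mono (Halts.of_run (by rfl) (Q := fun m' => m' = setCell (setCell (setCell (setCell m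
      3 0 p) 4 0 n) 5 0 (n + 1)) 6 0 (4 + 3 * C.length)) ?_) (by decide) ?_)) (by omega)
    fun _ h => h
  · have h : 4 + (C.length + (C.length + C.length)) = 4 + 3 * C.length := by ring
    simp [Program.run, assign, Expr.eval, var, setCell_apply, hp, hn, hlen, h]
  rintro m₁ rfl
  refine Halts.mono (Halts.seq (T := (n + 1) * (n * 100 + C.length * 300 + 112) + 9) (T' := 20)
    (Halts.mono (Halts.forLoop (n := n + 1) (T := n * 100 + C.length * 300 + 100) (by decide)
    (fun k m' => RepMat (m' 22) (positionMatrix C a) k ∧ m' 8 0 = n * k ∧ m' 3 0 = p ∧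
      m' 4 0 = n ∧ m' 5 0 = n + 1 ∧ m' 6 0 = 4 + 3 * C.length ∧ m' 0 = m 0) ?_ ?_ _ ?_ ?_)
    le_rfl ?_)) (by omega) fun _ h => h
  · rintro k m' v ⟨h1, h2, h3, h4, h5, h6, h7⟩
    simpa [setCell_apply] using ⟨h1, h2, h3, h4, h5, h6, h7⟩
  · rintro k m' hk ⟨h1, h2, h3, h4, h5, h6, h7⟩ h8 h9
    refine (halts_columnProg hp2 C a m' k h3 h4 h8 (by omega) h2 (by rwa [h6, h7]) (by rwa [h7])
      h6 h1).mono le_rfl ?_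
    rintro m'' ⟨g1, g2, g3⟩
    have e0 : m'' 0 = m' 0 := g3 0 (by decide)
    have e3 : m'' 3 = m' 3 := g3 3 (by decide)
    have e4 : m'' 4 = m' 4 := g3 4 (by decide)
    have e5 : m'' 5 = m' 5 := g3 5 (by decide)
    have e6 : m'' 6 = m' 6 := g3 6 (by decide)
    have e7 : m'' 7 = m' 7 := g3 7 (by decide)
    exact ⟨⟨g1, g2, by rw [e3, h3], by rw [e4, h4], by rw [e5, h5], by rw [e6, h6],
      by rw [e0, h7]⟩, by rw [e7, h8], by rw [e5, h5]⟩
  · refine ⟨fun i k hk => absurd hk (Nat.not_lt_zero _), ?_⟩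
    simp [setCell_apply, hoff]
  · simp [setCell_apply]
  rintro m' ⟨h1, h2, h3, h4, h5, h6, h7⟩
  refine (Halts.of_run (by rfl) (Q := fun m'' => m'' = setCell m' 8 0 (n * n)) ?_).mono
    (by decide) ?_
  -- After the last column the running address is `n(n + 1)`; it is set back to the constant column.
  · have h : n * (n + 1) - n = n * n := by
      rw [Nat.mul_add, Nat.mul_one, Nat.add_sub_cancel]
    simp [Program.run, assign, Expr.eval, var, h2, h4, h]
  · rintro m'' rfl
    simpa [setCell_apply] using ⟨h1, h3, h4, h5, h6, h7⟩

/-- The test whether the column, whose address is in bank `8`, is zero. -/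
def zeroTestProg : Program :=
  .seq (assign 26 (.lit 1))
    (forLoop 9 4 (.branch (.load 22 (.add (var 9) (var 8))) (assign 26 (.lit 0)) .skip))

theorem halts_zeroTestProg [NeZero p] (A : Fin n → ℕ → ZMod p) (m : Memory) (hn : m 4 0 = n)
    (hoff : m 8 0 = n * n) (hA : RepMat (m 22) A (n + 1)) :
    Halts zeroTestProg m (n * 32 + 12) fun m' =>
      m' 26 0 = (if ∀ i, A i n = 0 then 1 else 0) ∧ Agree [9, 26] m m' := by
  refine Halts.mono (Halts.seq (T := 3) (T' := n * 32 + 9) (Halts.mono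
    (Halts.of_run (by rfl) (Q := fun m' => m' = setCell m 26 0 1) ?_) (by decide) ?_)) (by omega)
    fun _ h => h
  · simp [Program.run, assign, Expr.eval]
  rintro m₁ rfl
  refine (Halts.forLoop (n := n) (T := 20) (by decide) (fun j m' =>
    m' 26 0 = (if ∀ i : Fin n, (i : ℕ) < j → A i n = 0 then 1 else 0) ∧ Agree [9, 26] m m')
    ?_ ?_ _ ?_ ?_).mono le_rfl ?_
  · rintro j m' v ⟨h1, h2⟩
    exact ⟨by simpa [setCell_apply] using h1, h2.setCell _ _ _⟩
  · rintro j m' hj ⟨h1, h2⟩ h3 h4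
    have e22 : m' 22 = m 22 := h2 22 (by decide)
    have e8 : m' 8 = m 8 := h2 8 (by decide)
    have hx := hA ⟨j, hj⟩ n (Nat.lt_succ_self n)
    simp only at hx
    have h5 : (∀ i : Fin n, (i : ℕ) < j + 1 → A i n = 0) ↔
        (∀ i : Fin n, (i : ℕ) < j → A i n = 0) ∧ A ⟨j, hj⟩ n = 0 := by
      refine ⟨fun h => ⟨fun i hi => h i (by omega), h ⟨j, hj⟩ (Nat.lt_succ_self j)⟩,
        fun h i hi => ?_⟩
      rcases Nat.lt_succ_iff_lt_or_eq.1 hi with hi | hi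
      · exact h.1 i hi
      · rw [show i = ⟨j, hj⟩ from Fin.ext hi, h.2]
    refine (Halts.of_run (by rfl) (Q := fun m'' => m'' = if A ⟨j, hj⟩ n = 0 then m' else
      setCell m' 26 0 0) ?_).mono (by decide) ?_
    · simp only [Program.run, Expr.eval, assign, var, h3, e8, hoff, e22, hx, ZMod.val_eq_zero]
    · rintro m'' rfl
      by_cases h6 : A ⟨j, hj⟩ n = 0
      · simp only [h5, h6, if_true, and_true]
        exact ⟨⟨h1, h2⟩, h3, h4⟩
      · simp only [h5, h6, if_false, and_false]
        exact ⟨⟨by simp [setCell_apply], h2.setCell _ _ _⟩, by simp [setCell_apply, h3],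
          by simp [setCell_apply, h4]⟩
  · exact ⟨by simp [setCell_apply], (Agree.refl _ _).setCell _ _ _⟩
  · simpa [setCell_apply] using hn
  · rintro m' ⟨h1, h2⟩
    refine ⟨?_, h2⟩
    simpa using h1

/-- The power of the variable of bank `3` with the exponent in bank `19`. -/
def powProg : Program :=
  .seq (.seq (assign 27 (var 3)) (.seq (assign 3 (.lit 0)) (assign 28 (.lit 1))))
    (forLoop 9 19 (.seq (.seq (assign 13 (var 28)) (assign 14 (var 27)))
      (.seq mulMod (assign 28 (var 15)))))

/-- The modulus is set to `0` to get exact products. The base `p`, not the growing power, is the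
multiplier whose bits are scanned, so each product costs a multiple of the bit length of `p`. -/
theorem halts_powProg (m : Memory) (p r : ℕ) (hp : m 3 0 = p) (hr : m 19 0 = r) :
    Halts powProg m (r * (p.size * 100 + 132) + 29) fun m' =>
      m' 28 0 = p ^ r ∧ Agree [3, 9, 13, 14, 15, 27, 28] m m' := by
  refine Halts.mono (Halts.seq (T := 20) (T' := r * (p.size * 100 + 132) + 9) (Halts.mono
    (Halts.of_run (by rfl) (Q := fun m' => m' = setCell (setCell (setCell m 27 0 p) 3 0 0) 28 0 1)
    ?_) (by decide) ?_)) (by omega) fun _ h => h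
  · simp [Program.run, assign, Expr.eval, var, hp]
  rintro m₁ rfl
  refine (Halts.forLoop (n := r) (T := p.size * 100 + 120) (by decide) (fun j m' =>
    m' 28 0 = p ^ j ∧ m' 27 0 = p ∧ m' 3 0 = 0 ∧ Agree [3, 9, 13, 14, 15, 27, 28] m m')
    ?_ ?_ _ ?_ ?_).mono le_rfl fun m' h => ⟨h.1, h.2.2.2⟩
  · rintro j m' v ⟨h1, h2, h3, h4⟩
    exact ⟨by simpa [setCell_apply] using h1, by simpa [setCell_apply] using h2,
      by simpa [setCell_apply] using h3, h4.setCell _ _ _⟩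
  · rintro j m' hj ⟨h1, h2, h3, h4⟩ h5 h6
    refine Halts.mono (Halts.seq (T := 10) (T' := p.size * 100 + 110) (Halts.mono
      (Halts.of_run (by rfl) (Q := fun m'' => m'' = setCell (setCell m' 13 0 (p ^ j)) 14 0 p) ?_)
      (by decide) ?_)) (by omega) fun _ h => h
    · simp [Program.run, assign, Expr.eval, var, setCell_apply, h1, h2]
    rintro m₂ rfl
    refine Halts.mono (Halts.seq (T := p.size * 100 + 100) (T' := 10) (Halts.mono
      (halts_mulMod _ p.size (by simp [setCell_apply]) (by simp [setCell_apply, h3])) le_rfl ?_))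
      (by omega) fun _ h => h
    rintro m₃ ⟨g1, -, g3⟩
    simp only [setCell_apply, if_true, if_false, Nat.reduceEqDiff, Function.update_self, h3] at g1
    have e27 := g3 27 (by decide) (by decide) (by decide)
    have e3 := g3 3 (by decide) (by decide) (by decide)
    have e9 := g3 9 (by decide) (by decide) (by decide)
    have e19 := g3 19 (by decide) (by decide) (by decide)
    simp only [setCell_apply, if_false, Nat.reduceEqDiff] at e27 e3 e9 e19
    have g4 : m₃ 15 0 = p ^ (j + 1) := by
      rw [pow_succ]
      simpa [Nat.ModEq, Nat.mod_zero] using g1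
    refine (Halts.of_run (by rfl) (Q := fun m'' => m'' = setCell m₃ 28 0 (p ^ (j + 1)))
      ?_).mono (by decide) ?_
    · simp [Program.run, assign, Expr.eval, var, g4]
    rintro m₄ rfl
    refine ⟨⟨by simp [setCell_apply], by simp [setCell_apply, e27, h2],
      by simp [setCell_apply, e3, h3], Agree.setCell (fun k hk => ?_) _ _ _⟩,
      by simp [setCell_apply, e9, h5], by simp [setCell_apply, e19, h6]⟩
    have hk' := hk
    simp only [List.mem_cons, not_or] at hk'
    rw [g3 k hk'.2.2.1 hk'.2.2.2.1 hk'.2.2.2.2.1, setCell_apply, if_neg hk'.2.2.2.1,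
      setCell_apply, if_neg hk'.2.2.1, h4 k hk]
  · exact ⟨by simp [setCell_apply], by simp [setCell_apply], by simp [setCell_apply],
      (((Agree.refl _ _).setCell _ _ _).setCell _ _ _).setCell _ _ _⟩
  · simpa [setCell_apply] using hr

/-- The simulation of a circuit. -/
def simProg : Program :=
  .seq positionProg (.seq outcomeProg (.seq elimProg (.seq zeroTestProg (.seq powProg
    (.seq (.store 2 (.lit 0) (var 26)) (.store 2 (.lit 1) (var 28)))))))

/-- A bound for the cost of the simulation of a circuit with `c` gates on `n` registers, where `p`
has `s` bits. -/
def simCost (n c s : ℕ) : ℕ :=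
  (n + 1) * (n * 100 + c * 300 + 112) + n * 144 + n * (n * (pivotCost n s + 22) + 41) +
    n * n * (s * 100 + 132) + 200

theorem halts_simProg [Fact p.Prime] (hp2 : p ≠ 2) (C : Circuit n) (a : Fin n → ZMod p)
    (I : Fin n ↪ Fin n) (y : Fin n → ZMod p) :
    Halts simProg (initialMemory (encodeInput p C a I y)) (simCost n C.length p.size) fun m' =>
      m' 2 1 ≠ 0 ∧ (m' 2 0 : ℝ) / (m' 2 1 : ℝ) = outcomeProb p C a I y := by
  obtain ⟨h0, h1, h2, h3, h4, h5, h6⟩ := initialMemory_encodeInput C a I y _ rfl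
  have hz : initialMemory (encodeInput p C a I y) 8 0 = 0 := rfl
  generalize initialMemory (encodeInput p C a I y) = m at *
  set e := I.equivOfFiniteSelfEmbedding
  refine Halts.mono (Halts.seq (T := (n + 1) * (n * 100 + C.length * 300 + 112) + 89)
    (T' := n * 144 + n * (n * (pivotCost n p.size + 22) + 41) + n * n * (p.size * 100 + 132) + 110)
    ((halts_positionProg hp2 C a m h0 h1 h2 hz h4 h3).mono le_rfl ?_))
    (by rw [simCost]; omega) fun _ h => h
  rintro m₁ ⟨g1, g2, g3, g4, g5, g6, g7⟩
  refine Halts.mono (Halts.seq (T := n * 112 + 9)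
    (T' := n * 32 + n * (n * (pivotCost n p.size + 22) + 41) + n * n * (p.size * 100 + 132) + 100)
    ((halts_outcomeProg (positionMatrix C a) e y m₁ g3 g4 g2 (by rwa [g6, g7])
      (by rwa [g6, g7]) g1).mono le_rfl ?_)) (by omega) fun _ h => h
  rintro m₂ ⟨i1, i2⟩
  refine Halts.mono (Halts.seq (T := n * (n * (pivotCost n p.size + 22) + 41) + 29)
    (T' := n * 32 + n * n * (p.size * 100 + 132) + 70)
    ((halts_elimProg (outcomeMatrix C a fun i => y (e.symm i)) m₂ (by rw [i2 3 (by decide), g3])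
      (by rw [i2 4 (by decide), g4]) (by rw [i2 5 (by decide), g5]) i1).mono le_rfl ?_))
    (by omega) fun _ h => h
  rintro m₃ ⟨⟨A, j1, j2⟩, j3, j4⟩
  have j5 : Agree [7, 8, 9, 10, 12, 13, 14, 15, 17, 18, 19, 22, 23, 24, 25] m₁ m₃ := i2.trans j4
  -- The number of pivots is read at run time; this crude bound makes the cost of the power
  -- polynomial.
  have hr : m₃ 19 0 ≤ n * n := j2.rank_le
  refine Halts.mono (Halts.seq (T := n * 32 + 12) (T' := n * n * (p.size * 100 + 132) + 50)
    ((halts_zeroTestProg A m₃ (by rw [j5 4 (by decide), g4]) j3 j1).mono le_rfl ?_))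
    (by omega) fun _ h => h
  rintro m₄ ⟨k1, k2⟩
  refine Halts.mono (Halts.seq (T := n * n * (p.size * 100 + 132) + 29) (T' := 20)
    ((halts_powProg m₄ p (m₃ 19 0) (by rw [k2 3 (by decide), j5 3 (by decide), g3])
      (by rw [k2 19 (by decide)])).mono
      (Nat.add_le_add_right (Nat.mul_le_mul_right _ hr) _) ?_)) (by omega) fun _ h => h
  rintro m₅ ⟨l1, l2⟩
  have e26 : m₅ 26 = m₄ 26 := l2 26 (by decide)
  refine (Halts.of_run (by rfl) (Q := fun m' => m' = setCell (setCell m₅ 2 0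
    (if ∀ i, A i n = 0 then 1 else 0)) 2 1 (p ^ m₃ 19 0)) ?_).mono (by decide) ?_
  · simp [Program.run, Expr.eval, var, setCell_apply, e26, k1, l1]
  · rintro m₆ rfl
    have hp0 : p ≠ 0 := (Fact.out : p.Prime).ne_zero
    refine ⟨by simp [setCell_apply, hp0], ?_⟩
    rw [outcomeProb_eq, norm_circuitOp_sq_of_isEliminated hp2 C a _ A _ j2]
    simp [setCell_apply]

theorem simCost_mono {n n' c c' s s' : ℕ} (hn : n ≤ n') (hc : c ≤ c') (hs : s ≤ s') :
    simCost n c s ≤ simCost n' c' s' := by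
  simp only [simCost, pivotCost]
  gcongr

/-- The numbers of registers and gates and the bit length of `p` are all at most the input size, so
by monotonicity a polynomial in one variable suffices. -/
theorem exists_polynomial_simCost : ∃ P : Polynomial ℕ, ∀ s, P.eval s = simCost s s s := by
  refine ⟨(.X + 1) * (.X * 100 + .X * 300 + 112) + .X * 144 + .X * (.X * ((.X + 1) * 42 +
    .X * ((.X + 1) * (.X * 200 + 412) + 62) + 50 + 22) + 41) + .X * .X * (.X * 100 + 132) + 200,
    fun s => ?_⟩
  simp [simCost, pivotCost]

theorem hasEfficientSTRSimulation : HasEfficientSTRSimulation fun n => n := by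
  obtain ⟨P, hP⟩ := exists_polynomial_simCost
  refine ⟨simProg, P, fun p _ hp2 n C a I y => ?_⟩
  obtain ⟨t, m, h1, h2, h3⟩ := halts_simProg hp2 C a I y
  obtain ⟨h4, h5, h6⟩ := le_inputSize_encodeInput C a I y
  refine ⟨t, m, h1, h2.trans ?_, h3⟩
  rw [hP]
  exact simCost_mono h4 h5 h6

end Main

end QuopitClifford

theorem theorem4 :
    HasEfficientSTRSimulation (fun n => n) ∧
    ∀ (p : ℕ) [Fact p.Prime], p ≠ 2 → ∀ (n : ℕ),
      (∀ C : Circuit n,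
        IsStandardForm (standardize C) ∧ circuitOp p (standardize C) = circuitOp p C) ∧
      ∀ C : Circuit n, IsStandardForm C →
        ∃ Θ : Matrix (Fin (numNonterminal C)) (Fin (numNonterminal C)) (ZMod p),
          Θ.IsSymm ∧
          (∃ (L : Matrix (Fin (numNonterminal C)) (Fin (numNonterminal C)) (ZMod p))
            (lam : Fin (numNonterminal C) → ZMod p),
            IsUnit L ∧ Lᵀ * Θ * L = Matrix.diagonal lam) ∧
          ∀ a b : Fin n → ZMod p,
            ∃ (η : Fin (numNonterminal C) → ZMod p) (ζ : ZMod p),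
              phasePoly p C a b = quadraticPoly Θ η ζ ∧
              ∀ (L : Matrix (Fin (numNonterminal C)) (Fin (numNonterminal C)) (ZMod p))
                (lam μ : Fin (numNonterminal C) → ZMod p)
                (X Y Z : Finset (Fin (numNonterminal C))),
                IsUnit L → Lᵀ * Θ * L = Matrix.diagonal lam → μ = Lᵀ *ᵥ η →
                X = {i | lam i ≠ 0} → Y = {i | lam i = 0 ∧ μ i = 0} →
                Z = {i | lam i = 0 ∧ μ i ≠ 0} →
                X.card = Θ.rank ∧
                circuitOp p C b a =
                  chi p ζ / (((p : ℝ) ^ (((n : ℝ) + numNonterminal C) / 2) : ℝ) : ℂ) *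
                    ∏ i, ∑ y : ZMod p, chi p (lam i * y ^ 2 + μ i * y) ∧
                circuitOp p C b a =
                  chi p ζ / (((p : ℝ) ^ (((n : ℝ) + numNonterminal C) / 2) : ℝ) : ℂ) *
                    (∏ i ∈ X, Complex.I ^ eps p * chi p (-4⁻¹ * (lam i)⁻¹ * μ i ^ 2) *
                      (legendreSym p ((lam i).val : ℤ) : ℂ) * ((Real.sqrt p : ℝ) : ℂ)) *
                    (∏ _j ∈ Y, (p : ℂ)) * (∏ _k ∈ Z, (0 : ℂ)) ∧
                circuitOp p C b a =
                  (((p : ℝ) ^ (-((n : ℝ) + Θ.rank - numNonterminal C) / 2) : ℝ) : ℂ) *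
                    (if Z.card = 0 then 1 else 0) * Complex.I ^ (Θ.rank * eps p) *
                    (legendreSym p ((∏ i ∈ X, lam i).val : ℤ) : ℂ) *
                    chi p (ζ - 4⁻¹ * ∑ i ∈ X, (lam i)⁻¹ * μ i ^ 2) ∧
                ‖circuitOp p C b a‖ ^ 2 =
                  (p : ℝ) ^ (-((n : ℤ) + Θ.rank - numNonterminal C)) *
                    (if Z.card = 0 then 1 else 0) :=
  ⟨hasEfficientSTRSimulation, fun _ _ hp _ =>
    ⟨fun C => ⟨isStandardForm_standardize C, circuitOp_standardize C⟩,
      fun C hC => amplitude_formulas hp C hC⟩⟩
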